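/- Let $K$ be a field, $n\ge 0$, $S=K[x_1,\dots,x_n]$ the polynomial ring and $E=\bigwedge(V)$ the exterior algebra of the $K$-vector space $V$ with basis $x_1,\dots,x_n$, both $\mathbb Z^n$-graded so that $x_j$ has degree the $j$-th unit vector. For $a\in\mathbb N^n$ put $\operatorname{supp}(a)=\{j: a_j\neq 0\}$; degrees $a\in\{0,1\}^n$ are called square-free and are identified with the monomials of $S$, or of $E$ (products of distinct variables in increasing order), with that support. If $a\le b$ are square-free, let $ba^{-1}\in E$ denote the element of degree $b-a$ (a monomial up to sign) with $(ba^{-1})\,a=b$ in $E$. Let $C=(c_{ij})$ be a $p\times q$ matrix over $K$, and let $a_1,\dots,a_p$ and $b_1,\dots,b_q$ be square-free degrees such that $c_{ij}\neq 0$ implies $a_i\le b_j$. Let ${}_SM$ be the $\mathbb Z^n$-graded $S$-module $${}_SM=\operatorname{coker}\Big(\bigoplus_{j}S(-b_j)\xrightarrow{\;(c_{ij}\,x^{b_j-a_i})\;}\bigoplus_i S(-a_i)\Big)$$ (such modules are called square-free), and let ${}_EM$ be the corresponding $\mathbb Z^n$-graded left $E$-module, that is, the square-free part of the cokernel of the same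 matrix read over $E$: the quotient of $$\operatorname{coker}\Big(\bigoplus_{j}E(-b_j)\xrightarrow{\;(c_{ij}\,b_ja_i^{-1})\;}\bigoplus_i E(-a_i)\Big)$$ by the submodule generated by all homogeneous elements whose degree is not in $\{0,1\}^n$. Put $\beta^S_{i,a}({}_SM)=\dim_K\operatorname{Tor}^S_i({}_SM,K)_a$ and $\beta^E_{i,a}({}_EM)=\dim_K\operatorname{Tor}^E_i({}_EM,K)_a$. Then all these dimensions are finite, and in the ring of formal power series in $t,u_1,\dots,u_n$ $$\sum_{i\ge 0}\sum_{a\in\mathbb N^n}\beta^E_{i,a}({}_EM)\,t^iu^a=\sum_{i\ge 0}\sum_{a\in\mathbb N^n}\beta^S_{i,a}({}_SM)\,\frac{t^iu^a}{\prod_{j\in\operatorname{supp}(a)}(1-t\,u_j)} .$$ -/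

import Mathlib

open scoped DirectSum MvPowerSeries.WithPiTopology

universe u v w

noncomputable section

set_option linter.unusedSectionVars false

namespace SqFree

/-! ### Graded modules over a graded algebra, graded free modules, graded `Tor` -/

section Graded

variable {K : Type u} {A : Type u} {G : Type} [Field K] [Ring A] [Algebra K A]
  [AddCommGroup G] [DecidableEq G]

/-- The component of degree `d` of the graded free left module `⨁ₓ A(-deg x)`
whose basis element `x` is placed in degree `deg x`. -/
def freePart (𝒜 : G → Submodule K A) {X : Type w} (deg : X → G) (d : G) :
    Submodule K (X →₀ A) where
  carrier := {f | ∀ x, f x ∈ 𝒜 (d - deg x)}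
  add_mem' hf hg x := (𝒜 (d - deg x)).add_mem (hf x) (hg x)
  zero_mem' x := (𝒜 (d - deg x)).zero_mem
  smul_mem' c _ hf x := (𝒜 (d - deg x)).smul_mem c (hf x)

theorem mem_freePart (𝒜 : G → Submodule K A) {X : Type w} (deg : X → G) (d : G)
    (f : X →₀ A) : f ∈ freePart 𝒜 deg d ↔ ∀ x, f x ∈ 𝒜 (d - deg x) := Iff.rfl

theorem single_mem_freePart (𝒜 : G → Submodule K A) {X : Type w} (deg : X → G) (x : X)
    {e d : G} (h : e = d - deg x) {a : A} (ha : a ∈ 𝒜 e) :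
    Finsupp.single x a ∈ freePart 𝒜 deg d := by
  intro y
  by_cases hxy : x = y
  · subst hxy
    rw [Finsupp.single_eq_same, ← h]
    exact ha
  · rw [Finsupp.single_eq_of_ne (Ne.symm hxy)]
    exact (𝒜 _).zero_mem

/-- The map decomposing an element of a graded free module into homogeneous components. -/
def freeDecompose (𝒜 : G → Submodule K A) [GradedAlgebra 𝒜] {X : Type w} (deg : X → G) :
    (X →₀ A) →+ ⨁ d, freePart 𝒜 deg d :=
  Finsupp.liftAddHom fun x =>
    (DirectSum.toAddMonoid fun e =>
      (DirectSum.of (fun d => freePart 𝒜 deg d) (e + deg x)).comp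
        { toFun := fun a : 𝒜 e => ⟨Finsupp.single x (a : A),
            single_mem_freePart 𝒜 deg x (add_sub_cancel_right e (deg x)).symm a.2⟩
          map_zero' := by ext; simp
          map_add' := fun a b => by
            apply Subtype.ext
            simp }).comp
      (DirectSum.decomposeAddEquiv 𝒜).toAddMonoidHom

theorem freeDecompose_single (𝒜 : G → Submodule K A) [GradedAlgebra 𝒜] {X : Type w}
    (deg : X → G) (x : X) {e d : G} (h : e = d - deg x) {a : A} (ha : a ∈ 𝒜 e) :
    freeDecompose 𝒜 deg (Finsupp.single x a) =
      DirectSum.of (fun d => freePart 𝒜 deg d) d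
        ⟨Finsupp.single x a, single_mem_freePart 𝒜 deg x h ha⟩ := by
  obtain rfl : d = e + deg x := by rw [h]; abel
  simp only [freeDecompose, Finsupp.liftAddHom_apply_single, AddMonoidHom.comp_apply]
  have : (DirectSum.decomposeAddEquiv 𝒜).toAddMonoidHom a
      = DirectSum.of (fun i => 𝒜 i) e ⟨a, ha⟩ := DirectSum.decompose_of_mem 𝒜 ha
  rw [this, DirectSum.toAddMonoid_of]
  rfl

instance freeDecomposition (𝒜 : G → Submodule K A) [GradedAlgebra 𝒜] {X : Type w}
    (deg : X → G) : DirectSum.Decomposition (freePart 𝒜 deg) :=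
  DirectSum.Decomposition.ofAddHom _ (freeDecompose 𝒜 deg)
    (by
      refine Finsupp.addHom_ext fun x a => ?_
      induction a using DirectSum.Decomposition.inductionOn 𝒜 with
      | zero => simp
      | @homogeneous e a =>
        rw [AddMonoidHom.comp_apply, freeDecompose_single 𝒜 deg x
          (add_sub_cancel_right e (deg x)).symm a.2]
        simp
      | add a b ha hb => rw [Finsupp.single_add, map_add, map_add, ha, hb])
    (by
      ext1 d
      ext1 ⟨f, hf⟩
      simp only [AddMonoidHom.comp_apply, DirectSum.coeAddMonoidHom_of, AddMonoidHom.id_apply]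
      have key : ∀ x, freeDecompose 𝒜 deg (Finsupp.single x (f x)) =
          DirectSum.of (fun d => freePart 𝒜 deg d) d
            ⟨Finsupp.single x (f x), single_mem_freePart 𝒜 deg x rfl (hf x)⟩ :=
        fun x => freeDecompose_single 𝒜 deg x rfl (hf x)
      conv_lhs => rw [← Finsupp.sum_single f, Finsupp.sum, map_sum]
      rw [Finset.sum_congr rfl fun x _ => key x, ← map_sum]
      congr 1
      apply Subtype.ext
      rw [AddSubmonoidClass.coe_finsetSum]
      exact Finsupp.sum_single f)

/-- The maximal graded submodule `𝔪F` of an `A`-module `F`, spanned by the products `y • f` with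
`y` homogeneous of non-zero degree. For `A = S` and `A = E` one has `A / 𝔪A = K`
and `K ⊗ F = F / 𝔪F`. -/
def irrelevantSMul (𝒜 : G → Submodule K A) (F : Type w) [AddCommGroup F] [Module A F] :
    Submodule A F :=
  Submodule.span A {g | ∃ d : G, d ≠ 0 ∧ ∃ y ∈ 𝒜 d, ∃ f : F, g = y • f}

/-- A `G`-graded free resolution `⋯ → F₁ → F₀ → M → 0` of a graded left `A`-module `M`, where
`Fᵢ = ⨁_{x ∈ X i} A(-deg x)` and all maps are homogeneous of degree `0`. -/
structure GradedFreeResolution (𝒜 : G → Submodule K A) {M : Type v} [AddCommGroup M] [Module K M]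
    [Module A M] (𝓜 : G → Submodule K M) where
  X : ℕ → Type (max u v)
  deg : ∀ i, X i → G
  aug : (X 0 →₀ A) →ₗ[A] M
  d : ∀ i, (X (i + 1) →₀ A) →ₗ[A] (X i →₀ A)
  aug_mem : ∀ x, aug (Finsupp.single x 1) ∈ 𝓜 (deg 0 x)
  d_mem : ∀ i x, d i (Finsupp.single x 1) ∈ freePart 𝒜 (deg i) (deg (i + 1) x)
  aug_surjective : Function.Surjective aug
  exact_zero : Function.Exact (d 0) aug
  exact_succ : ∀ i, Function.Exact (d (i + 1)) (d i)

namespace GradedFreeResolution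

variable {𝒜 : G → Submodule K A} {M : Type v} [AddCommGroup M] [Module K M] [Module A M]
  {𝓜 : G → Submodule K M}

/-- Elements of degree `a` of `Fᵢ` that become cycles in the complex `K ⊗ F = F / 𝔪F`. -/
def cycles (P : GradedFreeResolution 𝒜 𝓜) : (i : ℕ) → G → Submodule K (P.X i →₀ A)
  | 0, a => freePart 𝒜 (P.deg 0) a
  | i + 1, a => freePart 𝒜 (P.deg (i + 1)) a ⊓
      ((irrelevantSMul 𝒜 (P.X i →₀ A)).comap (P.d i)).restrictScalars K

/-- Elements of `Fᵢ` that become boundaries in the complex `K ⊗ F = F / 𝔪F`. -/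
def boundaries (P : GradedFreeResolution 𝒜 𝓜) (i : ℕ) : Submodule K (P.X i →₀ A) :=
  (irrelevantSMul 𝒜 (P.X i →₀ A) ⊔ LinearMap.range (P.d i)).restrictScalars K

/-- The component of degree `a` of the homology `Hᵢ(K ⊗ F)`, that is the cycles of degree `a`
modulo boundaries, realized as the image of the cycles in the quotient of `Fᵢ` by all
boundaries. -/
def homology (P : GradedFreeResolution 𝒜 𝓜) (i : ℕ) (a : G) :
    Submodule K ((P.X i →₀ A) ⧸ P.boundaries i) :=
  (P.cycles i a).map (P.boundaries i).mkQ

end GradedFreeResolution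

/-! #### The standard (functorial) graded free resolution -/

/-- The data of one step in the construction of a free resolution: a set `X` of homogeneous
generators of a free module, and the submodule of relations that has to be covered next. -/
structure Stage (A : Type u) (G : Type) [Ring A] where
  X : Type w
  deg : X → G
  ker : Submodule A (X →₀ A)

/-- The free module on all homogeneous elements of `M`, with the kernel of its map onto `M`. -/
def Stage.zero (A : Type u) [Ring A] [Algebra K A] {M : Type v} [AddCommGroup M] [Module K M]
    [Module A M] (𝓜 : G → Submodule K M) : Stage.{u, max u v} A G where
  X := ULift.{u} (Σ d, 𝓜 d)
  deg x := x.down.1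
  ker := LinearMap.ker (Finsupp.linearCombination A fun x : ULift.{u} (Σ d, 𝓜 d) =>
    (x.down.2 : M))

/-- The homogeneous elements of the module of relations. -/
abbrev Stage.Next (𝒜 : G → Submodule K A) (s : Stage.{u, max u v} A G) : Type (max u v) :=
  Σ d, {f : s.X →₀ A // f ∈ s.ker ∧ f ∈ freePart 𝒜 s.deg d}

/-- The map from the free module on the homogeneous relations to the previous free module. -/
def Stage.map (𝒜 : G → Submodule K A) (s : Stage.{u, max u v} A G) :
    (Stage.Next.{u, v} 𝒜 s →₀ A) →ₗ[A] (s.X →₀ A) :=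
  Finsupp.linearCombination A fun x : Stage.Next.{u, v} 𝒜 s => x.2.1

/-- The free module on all homogeneous relations of the previous step. -/
def Stage.next (𝒜 : G → Submodule K A) (s : Stage.{u, max u v} A G) :
    Stage.{u, max u v} A G where
  X := Stage.Next.{u, v} 𝒜 s
  deg x := x.1
  ker := LinearMap.ker (Stage.map.{u, v} 𝒜 s)

/-- The steps of the standard resolution. -/
def stage (𝒜 : G → Submodule K A) {M : Type v} [AddCommGroup M] [Module K M] [Module A M]
    (𝓜 : G → Submodule K M) : ℕ → Stage.{u, max u v} A G
  | 0 => Stage.zero A 𝓜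
  | i + 1 => Stage.next.{u, v} 𝒜 (stage 𝒜 𝓜 i)

theorem decompose_comm {V W σ τ : Type*} [AddCommGroup V] [AddCommGroup W]
    [SetLike σ V] [AddSubmonoidClass σ V] [SetLike τ W] [AddSubmonoidClass τ W]
    (𝓥 : G → σ) (𝓦 : G → τ)
    [DirectSum.Decomposition 𝓥] [DirectSum.Decomposition 𝓦] (φ : V →+ W)
    (h : ∀ d, ∀ v ∈ 𝓥 d, φ v ∈ 𝓦 d) (v : V) (d : G) :
    φ (DirectSum.decompose 𝓥 v d) = DirectSum.decompose 𝓦 (φ v) d := by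
  induction v using DirectSum.Decomposition.inductionOn 𝓥 with
  | zero => simp
  | @homogeneous e v =>
    by_cases hed : e = d
    · subst hed
      rw [DirectSum.decompose_of_mem_same _ v.2, DirectSum.decompose_of_mem_same _ (h _ _ v.2)]
    · rw [DirectSum.decompose_of_mem_ne _ v.2 hed, DirectSum.decompose_of_mem_ne _ (h _ _ v.2) hed,
        map_zero]
  | add a b ha hb => simp [ha, hb]

theorem linearCombination_mem {𝒜 : G → Submodule K A} {M : Type v}
    [AddCommGroup M] [Module K M] [Module A M] {𝓜 : G → Submodule K M}
    [SetLike.GradedSMul 𝒜 𝓜] {X : Type w} (deg : X → G) (m : X → M) (hm : ∀ x, m x ∈ 𝓜 (deg x))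
    (d : G) (f : X →₀ A) (hf : f ∈ freePart 𝒜 deg d) :
    Finsupp.linearCombination A m f ∈ 𝓜 d := by
  rw [Finsupp.linearCombination_apply, Finsupp.sum]
  refine Submodule.sum_mem _ fun x _ => ?_
  have := SetLike.GradedSMul.smul_mem (hf x) (hm x)
  rwa [vadd_eq_add, sub_add_cancel] at this

instance freeGradedSMul (𝒜 : G → Submodule K A) [GradedAlgebra 𝒜] {X : Type w} (deg : X → G) :
    SetLike.GradedSMul 𝒜 (freePart 𝒜 deg) where
  smul_mem := by
    intro i j a f ha hf x
    have := SetLike.mul_mem_graded ha (hf x)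
    rw [vadd_eq_add, Finsupp.smul_apply, smul_eq_mul, add_sub_assoc]
    exact this

theorem ker_homogeneous (𝒜 : G → Submodule K A) [GradedAlgebra 𝒜] {M : Type v}
    [AddCommGroup M] [Module K M] [Module A M] (𝓜 : G → Submodule K M)
    [DirectSum.Decomposition 𝓜] [SetLike.GradedSMul 𝒜 𝓜] {X : Type w} (deg : X → G)
    (m : X → M) (hm : ∀ x, m x ∈ 𝓜 (deg x)) :
    ∀ (d : G), ∀ f ∈ LinearMap.ker (Finsupp.linearCombination A m),
      (DirectSum.decompose (freePart 𝒜 deg) f d : X →₀ A) ∈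
        LinearMap.ker (Finsupp.linearCombination A m) := by
  intro d f hf
  have := decompose_comm (freePart 𝒜 deg) 𝓜 (Finsupp.linearCombination A m).toAddMonoidHom
    (fun d v hv => linearCombination_mem deg m hm d v hv) f d
  rw [LinearMap.mem_ker] at hf ⊢
  simpa [hf] using this

theorem stage_homogeneous (𝒜 : G → Submodule K A) [GradedAlgebra 𝒜] {M : Type v}
    [AddCommGroup M] [Module K M] [Module A M] (𝓜 : G → Submodule K M)
    [DirectSum.Decomposition 𝓜] [SetLike.GradedSMul 𝒜 𝓜] (i : ℕ) :
    ∀ (d : G), ∀ f ∈ (stage.{u, v} 𝒜 𝓜 i).ker,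
      (DirectSum.decompose (freePart 𝒜 (stage.{u, v} 𝒜 𝓜 i).deg) f d : _ →₀ A) ∈
        (stage.{u, v} 𝒜 𝓜 i).ker := by
  cases i with
  | zero => exact ker_homogeneous 𝒜 𝓜 _ _ fun x => x.down.2.2
  | succ i => exact ker_homogeneous 𝒜 (freePart 𝒜 (stage.{u, v} 𝒜 𝓜 i).deg) _ _ fun x => x.2.2.2

theorem stage_exact (𝒜 : G → Submodule K A) [GradedAlgebra 𝒜] {M : Type v}
    [AddCommGroup M] [Module K M] [Module A M] (𝓜 : G → Submodule K M)
    [DirectSum.Decomposition 𝓜] [SetLike.GradedSMul 𝒜 𝓜] (i : ℕ) :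
    LinearMap.range (Stage.map.{u, v} 𝒜 (stage.{u, v} 𝒜 𝓜 i)) = (stage.{u, v} 𝒜 𝓜 i).ker := by
  classical
  rw [Stage.map, Finsupp.range_linearCombination]
  apply le_antisymm
  · rw [Submodule.span_le]
    rintro _ ⟨x, rfl⟩
    exact x.2.2.1
  · intro f hf
    rw [← DirectSum.sum_support_decompose (freePart 𝒜 (stage.{u, v} 𝒜 𝓜 i).deg) f]
    refine Submodule.sum_mem _ fun d _ => Submodule.subset_span ?_
    exact ⟨⟨d, _, stage_homogeneous 𝒜 𝓜 i d f hf, SetLike.coe_mem _⟩, rfl⟩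

/-- The standard graded free resolution of a graded module: `F₀` is free on the homogeneous
elements of `M`, and `Fᵢ₊₁` is free on the homogeneous elements of the kernel of the previous
map. -/
def standardResolution (𝒜 : G → Submodule K A) [GradedAlgebra 𝒜] {M : Type v}
    [AddCommGroup M] [Module K M] [Module A M] (𝓜 : G → Submodule K M)
    [DirectSum.Decomposition 𝓜] [SetLike.GradedSMul 𝒜 𝓜] :
    GradedFreeResolution.{u, v} 𝒜 𝓜 where
  X i := (stage.{u, v} 𝒜 𝓜 i).X
  deg i := (stage.{u, v} 𝒜 𝓜 i).deg
  aug := Finsupp.linearCombination A fun x : ULift.{u} (Σ d, 𝓜 d) => (x.down.2 : M)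
  d i := Stage.map.{u, v} 𝒜 (stage.{u, v} 𝒜 𝓜 i)
  aug_mem := by
    intro x
    have h := Finsupp.linearCombination_single A (1 : A) x
      (v := fun x : ULift.{u} (Σ d, 𝓜 d) => (x.down.2 : M))
    rw [one_smul] at h
    exact Set.mem_of_eq_of_mem h x.down.2.2
  d_mem := by
    intro i x
    have h := Finsupp.linearCombination_single A (1 : A) x
      (v := fun x : Stage.Next.{u, v} 𝒜 (stage.{u, v} 𝒜 𝓜 i) => x.2.1)
    rw [one_smul] at h
    exact Set.mem_of_eq_of_mem h x.2.2.2
  aug_surjective := by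
    classical
    intro m
    change m ∈ LinearMap.range
      (Finsupp.linearCombination A fun x : ULift.{u} (Σ d, 𝓜 d) => (x.down.2 : M))
    rw [Finsupp.range_linearCombination,
      ← DirectSum.sum_support_decompose 𝓜 m]
    exact Submodule.sum_mem _ fun d _ => Submodule.subset_span ⟨⟨⟨d, _⟩⟩, rfl⟩
  exact_zero y := (SetLike.ext_iff.1 (stage_exact.{u, v} 𝒜 𝓜 0) y).symm
  exact_succ i y := (SetLike.ext_iff.1 (stage_exact.{u, v} 𝒜 𝓜 (i + 1)) y).symm

/-- The component of degree `a` of `Torᵢᴬ(M, K)`, a `K`-vector space. -/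
abbrev Tor (𝒜 : G → Submodule K A) [GradedAlgebra 𝒜] {M : Type v}
    [AddCommGroup M] [Module K M] [Module A M] (𝓜 : G → Submodule K M)
    [DirectSum.Decomposition 𝓜] [SetLike.GradedSMul 𝒜 𝓜] (i : ℕ) (a : G) :=
  (standardResolution.{u, v} 𝒜 𝓜).homology i a

/-- The graded Betti number `β_{i,a}(M) = dim_K Torᵢᴬ(M, K)_a`. -/
def betti (𝒜 : G → Submodule K A) [GradedAlgebra 𝒜] {M : Type v}
    [AddCommGroup M] [Module K M] [Module A M] (𝓜 : G → Submodule K M)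
    [DirectSum.Decomposition 𝓜] [SetLike.GradedSMul 𝒜 𝓜] (i : ℕ) (a : G) : ℕ :=
  Module.finrank K (Tor 𝒜 𝓜 i a)

end Graded

/-! ### The `ℤⁿ`-graded symmetric and exterior algebras -/

section Algebras

variable (K : Type u) [Field K] (n : ℕ)

/-- The polynomial ring `S = K[x₁, …, xₙ]`. -/
abbrev Sy : Type u := MvPolynomial (Fin n) K

/-- The exterior algebra `E` of the vector space `Kⁿ`. -/
abbrev Ex : Type u := ExteriorAlgebra K (Fin n → K)

/-- The `ℤⁿ`-grading of `S`, in which `xⱼ` has as its degree the `j`-th unit vector. -/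
abbrev symGrading : (Fin n → ℤ) → Submodule K (Sy K n) :=
  MvPolynomial.weightedHomogeneousSubmodule K fun j : Fin n => (Pi.single j 1 : Fin n → ℤ)

instance symGradedAlgebra : GradedAlgebra (symGrading K n) := MvPolynomial.weightedGradedAlgebra K _

/-- The `j`-th standard generator of `E`. -/
def extVar (j : Fin n) : Ex K n := ExteriorAlgebra.ι K (Pi.single j 1)

/-- The product in `E` of a list of variables. -/
def extListProd (l : List (Fin n)) : Ex K n := (l.map (extVar K n)).prod

variable {n} in
/-- The degree of the product of a list of variables. -/
def listDeg (l : List (Fin n)) : Fin n → ℤ := fun j => (l.count j : ℤ)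

/-- The `ℤⁿ`-grading of `E`: the component of degree `a` is spanned by the products of variables
in which each variable `j` occurs exactly `a j` times. -/
def extGrading (a : Fin n → ℤ) : Submodule K (Ex K n) :=
  Submodule.span K {y | ∃ l : List (Fin n), listDeg l = a ∧ y = extListProd K n l}

theorem extListProd_mem (l : List (Fin n)) : extListProd K n l ∈ extGrading K n (listDeg l) :=
  Submodule.subset_span ⟨l, rfl, rfl⟩

theorem listDeg_append (l l' : List (Fin n)) : listDeg (l ++ l') = listDeg l + listDeg l' := by
  ext j; simp [listDeg]

theorem listDeg_singleton (j : Fin n) : listDeg [j] = Pi.single j 1 := by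
  ext k
  by_cases h : j = k
  · subst h; simp [listDeg]
  · simp [listDeg, h, Ne.symm h]

theorem extVar_mem (j : Fin n) : extVar K n j ∈ extGrading K n (Pi.single j 1) := by
  have := extListProd_mem K n [j]
  rwa [listDeg_singleton, extListProd, List.map_singleton, List.prod_singleton] at this

theorem extVar_sq (j : Fin n) : extVar K n j * extVar K n j = 0 := ExteriorAlgebra.ι_sq_zero _

theorem extVar_anticomm (j k : Fin n) :
    extVar K n j * extVar K n k = -(extVar K n k * extVar K n j) :=
  eq_neg_of_add_eq_zero_left (ExteriorAlgebra.ι_add_mul_swap _ _)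

instance extGradedMonoid : SetLike.GradedMonoid (extGrading K n) where
  one_mem := by
    have := extListProd_mem K n []
    have h0 : listDeg ([] : List (Fin n)) = 0 := by ext; simp [listDeg]
    rwa [h0] at this
  mul_mem := by
    intro a b x y hx hy
    have := Submodule.mul_mem_mul hx hy
    rw [extGrading, extGrading, Submodule.span_mul_span] at this
    refine Submodule.span_le.2 ?_ this
    rintro _ ⟨_, ⟨l, rfl, rfl⟩, _, ⟨l', rfl, rfl⟩, rfl⟩
    refine Submodule.subset_span ⟨l ++ l', listDeg_append n l l', ?_⟩
    simp [extListProd]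

/-- The decomposition into homogeneous components, on the space of linear forms. -/
def extDecomposeι : (Fin n → K) →ₗ[K] ⨁ a, extGrading K n a :=
  ∑ j, (DirectSum.lof K _ (fun a => extGrading K n a) (Pi.single j 1) ∘ₗ
    LinearMap.toSpanSingleton K _ ⟨extVar K n j, extVar_mem K n j⟩) ∘ₗ LinearMap.proj j

theorem extDecomposeι_apply (v : Fin n → K) : extDecomposeι K n v =
    ∑ j, v j • DirectSum.of (fun a => extGrading K n a) (Pi.single j 1)
      ⟨extVar K n j, extVar_mem K n j⟩ := by
  simp only [extDecomposeι, LinearMap.sum_apply, LinearMap.comp_apply, LinearMap.proj_apply,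
    LinearMap.toSpanSingleton_apply, map_smul]
  rfl

theorem extDecomposeι_sq (v : Fin n → K) : extDecomposeι K n v * extDecomposeι K n v = 0 := by
  rw [extDecomposeι_apply]
  set g : Fin n → ⨁ a, extGrading K n a := fun j =>
    DirectSum.of (fun a => extGrading K n a) (Pi.single j 1) ⟨extVar K n j, extVar_mem K n j⟩
    with hg
  have hsq : ∀ j, g j * g j = 0 := by
    intro j
    rw [hg]
    simp only [DirectSum.of_mul_of]
    rw [← map_zero (DirectSum.of (fun a => extGrading K n a) (Pi.single j 1 + Pi.single j 1))]
    congr 1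
    exact Subtype.ext (extVar_sq K n j)
  have hanti : ∀ j k, g j * g k = -(g k * g j) := by
    intro j k
    rw [hg]
    simp only [DirectSum.of_mul_of]
    rw [← map_neg]
    apply DirectSum.of_eq_of_gradedMonoid_eq
    exact Sigma.subtype_ext (add_comm _ _) (extVar_anticomm K n j k)
  have gen : ∀ s : Finset (Fin n), (∑ j ∈ s, v j • g j) * (∑ j ∈ s, v j • g j) = 0 := by
    intro s
    induction s using Finset.induction_on with
    | empty => simp
    | insert a s ha ih =>
      have hcross : (v a • g a) * (∑ j ∈ s, v j • g j) + (∑ j ∈ s, v j • g j) * (v a • g a) = 0 := by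
        rw [Finset.mul_sum, Finset.sum_mul, ← Finset.sum_add_distrib]
        refine Finset.sum_eq_zero fun j _ => ?_
        simp only [smul_mul_assoc, mul_smul_comm]
        rw [hanti a j, smul_comm (v j) (v a)]
        simp
      rw [Finset.sum_insert ha, add_mul, mul_add, mul_add, ih, add_zero, add_assoc, hcross]
      simp [hsq]
  exact gen Finset.univ

/-- The map decomposing an element of `E` into homogeneous components. -/
def extDecompose : Ex K n →ₐ[K] ⨁ a, extGrading K n a :=
  ExteriorAlgebra.lift K ⟨extDecomposeι K n, extDecomposeι_sq K n⟩

theorem extDecompose_extVar (j : Fin n) : extDecompose K n (extVar K n j) =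
    DirectSum.of (fun a => extGrading K n a) (Pi.single j 1)
      ⟨extVar K n j, extVar_mem K n j⟩ := by
  have h : extDecompose K n (extVar K n j) = extDecomposeι K n (Pi.single j 1) :=
    ExteriorAlgebra.lift_ι_apply K _ _ _
  rw [h, extDecomposeι_apply, Finset.sum_eq_single j]
  · simp
  · intro k _ hk
    simp [hk]
  · simp

theorem extDecompose_listProd (l : List (Fin n)) : extDecompose K n (extListProd K n l) =
    DirectSum.of (fun a => extGrading K n a) (listDeg l)
      ⟨extListProd K n l, extListProd_mem K n l⟩ := by
  induction l with
  | nil =>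
    have : extDecompose K n (extListProd K n []) = 1 := map_one (extDecompose K n)
    rw [this, DirectSum.one_def]
    apply DirectSum.of_eq_of_gradedMonoid_eq
    refine Sigma.subtype_ext ?_ rfl
    change (0 : Fin n → ℤ) = listDeg []
    ext; simp [listDeg]
  | cons j l ih =>
    have : extListProd K n (j :: l) = extVar K n j * extListProd K n l := by simp [extListProd]
    have h := congrArg (extDecompose K n) this
    rw [map_mul, ih, extDecompose_extVar, DirectSum.of_mul_of] at h
    rw [h]
    apply DirectSum.of_eq_of_gradedMonoid_eq
    refine Sigma.subtype_ext ?_ this.symm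
    change Pi.single j 1 + listDeg l = listDeg ([j] ++ l)
    rw [listDeg_append, listDeg_singleton]

instance extGradedAlgebra : GradedAlgebra (extGrading K n) :=
  GradedAlgebra.ofAlgHom _ (extDecompose K n)
    (by
      ext j
      simp only [LinearMap.comp_apply, AlgHom.toLinearMap_apply, AlgHom.comp_apply,
        AlgHom.id_apply, LinearMap.coe_single]
      change DirectSum.coeAlgHom _ (extDecompose K n (extVar K n j)) = _
      rw [extDecompose_extVar, DirectSum.coeAlgHom_of]
      rfl)
    (by
      rintro a ⟨x, hx⟩
      induction hx using Submodule.span_induction with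
      | mem x h =>
        obtain ⟨l, rfl, rfl⟩ := h
        exact extDecompose_listProd K n l
      | zero => 
        change extDecompose K n 0 = _
        rw [map_zero]
        exact (map_zero (DirectSum.of (fun a => extGrading K n a) a)).symm
      | add x y hx hy ihx ihy =>
        change extDecompose K n (x + y) = _
        rw [map_add]
        change extDecompose K n x = _ at ihx
        change extDecompose K n y = _ at ihy
        rw [ihx, ihy, ← map_add]
        rfl
      | smul c x hx ih =>
        change extDecompose K n (c • x) = _
        rw [map_smul]
        change extDecompose K n x = _ at ih
        rw [ih, ← DirectSum.lof_eq_of K, ← map_smul]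
        rfl)

variable {n} in
/-- The square-free degree in `{0,1}ⁿ` with support `s`. -/
def sqDeg (s : Finset (Fin n)) : Fin n → ℤ := fun j => if j ∈ s then 1 else 0

variable {n} in
/-- The square-free monomial of `S` with support `s`. -/
def symMon (s : Finset (Fin n)) : Sy K n := ∏ j ∈ s, MvPolynomial.X j

variable {n} in
/-- The monomial of `E` with support `s`: the product of its variables in increasing order. -/
def extMon (s : Finset (Fin n)) : Ex K n := extListProd K n s.sort

variable {n} in
/-- The signed monomial `b a⁻¹` of `E` for square-free monomials `a ∣ b`, which is the element of
degree `b - a` with `(b a⁻¹) a = b`. -/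
def extQuot (b a : Finset (Fin n)) : Ex K n :=
  (-1 : K) ^ (∑ p ∈ b \ a, (a.filter (· < p)).card) • extMon K (b \ a)

variable {n} in
theorem extMon_insert (k : Fin n) (s : Finset (Fin n)) (h : ∀ x ∈ s, k < x) :
    extMon K (insert k s) = extVar K n k * extMon K s := by
  have hk : k ∉ s := fun hk => lt_irrefl _ (h k hk)
  rw [extMon, Finset.sort_insert _ (fun b hb => (h b hb).le) hk]
  simp [extListProd, extMon]

variable {n} in
theorem extVar_mul_extMon (m : Fin n) (s : Finset (Fin n)) (hm : m ∉ s) :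
    extVar K n m * extMon K s =
      (-1 : K) ^ (s.filter (· < m)).card • extMon K (insert m s) := by
  induction s using Finset.induction_on_min with
  | empty => rw [extMon_insert K m ∅ (by simp)]; simp
  | insert k s hk ih =>
    have hks : k ∉ s := fun h => lt_irrefl _ (hk k h)
    have hmk : m ≠ k := fun h => hm (by simp [h])
    have hms : m ∉ s := fun h => hm (by simp [h])
    rcases lt_or_gt_of_ne hmk with h | h
    · have hall : ∀ x ∈ insert k s, m < x := by
        intro x hx
        rcases Finset.mem_insert.1 hx with rfl | hx
        · exact h
        · exact h.trans (hk x hx)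
      rw [extMon_insert K m _ hall, Finset.filter_false_of_mem]
      · simp
      · intro x hx
        exact (hall x hx).le.not_gt
    · have hall : ∀ x ∈ insert m s, k < x := by
        intro x hx
        rcases Finset.mem_insert.1 hx with rfl | hx
        · exact h
        · exact hk x hx
      rw [extMon_insert K k s hk, ← mul_assoc, extVar_anticomm, neg_mul, mul_assoc, ih hms,
        mul_smul_comm, ← extMon_insert K k _ hall, Finset.insert_comm, Finset.filter_insert,
        if_pos h, Finset.card_insert_of_notMem (by simp [hks]), pow_succ]
      simp

variable {n} in
theorem extMon_mul_extMon (s t : Finset (Fin n)) (h : Disjoint s t) :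
    extMon K s * extMon K t =
      (-1 : K) ^ (∑ p ∈ s, (t.filter (· < p)).card) • extMon K (s ∪ t) := by
  induction s using Finset.induction_on_min with
  | empty => simp [extMon, extListProd]
  | insert m s hm ih =>
    have hms : m ∉ s := fun h => lt_irrefl _ (hm m h)
    rw [Finset.disjoint_insert_left] at h
    have hf : (s ∪ t).filter (· < m) = t.filter (· < m) := by
      rw [Finset.filter_union, Finset.filter_false_of_mem fun x hx => (hm x hx).le.not_gt,
        Finset.empty_union]
    rw [extMon_insert K m s hm, mul_assoc, ih h.2, mul_smul_comm,
      extVar_mul_extMon K m _ (by simp [hms, h.1]), hf, Finset.sum_insert hms, smul_smul,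
      ← pow_add, Finset.insert_union, add_comm]

variable {n} in
theorem extQuot_mul_extMon (b a : Finset (Fin n)) (h : a ⊆ b) :
    extQuot K b a * extMon K a = extMon K b := by
  rw [extQuot, smul_mul_assoc, extMon_mul_extMon K _ _ Finset.sdiff_disjoint, smul_smul, ← mul_pow,
    Finset.sdiff_union_of_subset h]
  simp

end Algebras

/-! ### Square-free modules and the correspondence between `S` and `E` -/

/-- A `ℤⁿ`-homogeneous matrix between finite free modules whose generators have square-free
degrees: row `i` belongs to a generator of the target, of degree `row i`, column `j` to a
generator of the source, of degree `col j`; the entry at `(i, j)` is the scalar `coeff i j` times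
the monomial `col j / row i`, and vanishes unless `row i` divides `col j`. -/
structure SquareFreeMatrix (K : Type u) [Field K] (n : ℕ) where
  p : ℕ
  q : ℕ
  row : Fin p → Finset (Fin n)
  col : Fin q → Finset (Fin n)
  coeff : Matrix (Fin p) (Fin q) K
  subset : ∀ i j, coeff i j ≠ 0 → row i ⊆ col j

namespace SquareFreeMatrix

variable {K : Type u} [Field K] {n : ℕ} (P : SquareFreeMatrix K n)

/-- The columns of the matrix, read over `S`. -/
def symCol (j : Fin P.q) : Fin P.p → Sy K n :=
  fun i => P.coeff i j • symMon K (P.col j \ P.row i)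

/-- The columns of the matrix, read over `E`. -/
def extCol (j : Fin P.q) : Fin P.p → Ex K n :=
  fun i => P.coeff i j • extQuot K (P.col j) (P.row i)

/-- `P` is the matrix of a graded free presentation of the `ℤⁿ`-graded `S`-module `M`: there is
a homogeneous surjection `⨁ᵢ S(-row i) → M` whose kernel is generated by the columns of `P`. -/
def PresentsSym {M : Type v} [AddCommGroup M] [Module K M] [Module (Sy K n) M]
    (𝓜 : (Fin n → ℤ) → Submodule K M) : Prop :=
  ∃ π : (Fin P.p → Sy K n) →ₗ[Sy K n] M, Function.Surjective π ∧
    (∀ i, π (Pi.single i 1) ∈ 𝓜 (sqDeg (P.row i))) ∧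
    LinearMap.ker π = Submodule.span (Sy K n) (Set.range P.symCol)

/-- The homogeneous elements of `⨁ᵢ E(-row i)` whose degree is not square-free. -/
def nonSquareFree : Set (Fin P.p → Ex K n) :=
  {v | ∃ d : Fin n → ℤ, (¬ ∃ s, d = sqDeg s) ∧ ∀ i, v i ∈ extGrading K n (d - sqDeg (P.row i))}

/-- The `ℤⁿ`-graded left `E`-module `N` is the square-free part of the cokernel of the matrix `P`
read over `E`: there is a homogeneous surjection `⨁ᵢ E(-row i) → N` whose kernel is generated by
the columns of `P` and all homogeneous elements of non-square-free degree. -/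
def PresentsExt {N : Type w} [AddCommGroup N] [Module K N] [Module (Ex K n) N]
    (𝓝 : (Fin n → ℤ) → Submodule K N) : Prop :=
  ∃ π : (Fin P.p → Ex K n) →ₗ[Ex K n] N, Function.Surjective π ∧
    (∀ i, π (Pi.single i 1) ∈ 𝓝 (sqDeg (P.row i))) ∧
    LinearMap.ker π = Submodule.span (Ex K n) (Set.range P.extCol ∪ P.nonSquareFree)

end SquareFreeMatrix

/-! ### Poincaré series -/

section Series

variable {n : ℕ}

/-- The variable `t`. -/
def tVar (n : ℕ) : MvPowerSeries (Option (Fin n)) ℚ := MvPowerSeries.X none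

/-- The variable `uⱼ`. -/
def uVar (j : Fin n) : MvPowerSeries (Option (Fin n)) ℚ := MvPowerSeries.X (some j)

/-- An exponent in `ℕⁿ` regarded as a degree in `ℤⁿ`. -/
def natDeg (a : Fin n → ℕ) : Fin n → ℤ := fun j => (a j : ℤ)

/-- The power series `∑_{i ≥ 0} ∑_{a ∈ ℕⁿ} β i a tⁱ uᵃ`. -/
def poincareSeries (β : ℕ → (Fin n → ℤ) → ℕ) : MvPowerSeries (Option (Fin n)) ℚ :=
  fun m => (β (m none) (natDeg fun j => m (some j)) : ℚ)

/-- The power series `tⁱ uᵃ / ∏_{j ∈ supp a} (1 - t uⱼ)`. -/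
def cartanTerm (i : ℕ) (a : Fin n → ℕ) : MvPowerSeries (Option (Fin n)) ℚ :=
  tVar n ^ i * (∏ j, uVar j ^ a j) *
    ∏ j ∈ Finset.univ.filter (fun j => a j ≠ 0), (1 - tVar n * uVar j)⁻¹

end Series

end SqFree

end

noncomputable section

set_option linter.unusedSectionVars false

namespace SqFree

/-! ### Strands of Koszul-type complexes -/

section Strands

variable {K : Type*} [Field K] {n : ℕ}

/-! Both kinds of graded `Tor` are computed by explicit complexes, and these complexes turn out to
be the same up to a shift. Tensoring the Koszul resolution of `K` over `S`, or the Cartan resolution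
of `K` over `E`, with a module `X` and taking degree `a` gives a strand: in homological degree `k`
it is the sum of the components of `X` in degree `a - c`, over exponents `c` with `|c| = k`, and its
differential multiplies by the variables. Over `S` the exponents are square-free, while over `E` all
of `ℕⁿ` occurs. Dimension shifting along a free resolution identifies `Tor` with strand homology
(`GradedFreeResolution.nonempty_homology_equiv`), provided that the strands of free modules are
exact in positive homological degrees (`KoszulData.free_acyclic`).

In a square-free degree `F`, each of the two modules is the cokernel of the same scalar matrix,
namely the rows and columns of `C` whose degrees divide `F` (`SqModel`). The sign of `x_k : M_F →
M_{F ∪ k}` depends only on `k` and `F`, so inserting Koszul signs over `S` makes the two actions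
agree (`SqModel.sqIso`). Since `N` lives in square-free degrees, a strand over `E` in degree `a`
only sees `c = (a - 1) + c'` with truncated subtraction, and then `a - c = supp(a) - c'`. It is
therefore the strand over `S` in degree `supp(a)`, shifted by `∑ (a_j - 1)`
(`SqIso.nonempty_strandHomology_equiv`). The same comparison, applied to `S` and `E` themselves,
yields the acyclicity over `E` from that over `S`.

Hence `β^E_{k + ∑ (a_j - 1), a}(N) = β^S_{k, supp a}(M)`, and `β^E_{i,a}(N)` vanishes for smaller
`i`. Over `S` the Betti numbers vanish outside square-free degrees, because multiplication by `x_j`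
is bijective on `M` above degree one in that direction (`PresentsSym.strand_exact`). Expanding the
geometric series turns these equalities into the identity of power series. -/

/-- Two subquotients related by a linear relation that is total on both sides and matches the
denominators are isomorphic. -/
theorem nonempty_subquotient_equiv {V W : Type*} [AddCommGroup V] [Module K V] [AddCommGroup W]
    [Module K W] (Z B : Submodule K V) (Z' B' : Submodule K W) (R : Submodule K (V × W))
    (hZ : ∀ x ∈ R, x.1 ∈ Z) (hZ' : ∀ x ∈ R, x.2 ∈ Z')
    (hB : ∀ x ∈ R, x.1 ∈ B ↔ x.2 ∈ B')
    (hl : ∀ v ∈ Z, ∃ w, (v, w) ∈ R) (hr : ∀ w ∈ Z', ∃ v, (v, w) ∈ R) :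
    Nonempty (Z.map B.mkQ ≃ₗ[K] Z'.map B'.mkQ) := by
  let f : R →ₗ[K] Z.map B.mkQ :=
    ((B.mkQ ∘ₗ LinearMap.fst K V W) ∘ₗ R.subtype).codRestrict _
      (fun x => Submodule.mem_map_of_mem (hZ x x.2))
  let g : R →ₗ[K] Z'.map B'.mkQ :=
    ((B'.mkQ ∘ₗ LinearMap.snd K V W) ∘ₗ R.subtype).codRestrict _
      (fun x => Submodule.mem_map_of_mem (hZ' x x.2))
  have hf : Function.Surjective f := by
    rintro ⟨_, v, hv, rfl⟩
    obtain ⟨w, hw⟩ := hl v hv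
    exact ⟨⟨_, hw⟩, rfl⟩
  have hg : Function.Surjective g := by
    rintro ⟨_, v, hv, rfl⟩
    obtain ⟨w, hw⟩ := hr v hv
    exact ⟨⟨_, hw⟩, rfl⟩
  have hk : LinearMap.ker f = LinearMap.ker g := by
    ext x
    rw [LinearMap.mem_ker, LinearMap.mem_ker, ← Subtype.coe_inj, ← Subtype.coe_inj]
    change B.mkQ x.1.1 = 0 ↔ B'.mkQ x.1.2 = 0
    rw [Submodule.mkQ_apply, Submodule.mkQ_apply, Submodule.Quotient.mk_eq_zero,
      Submodule.Quotient.mk_eq_zero]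
    exact hB x x.2
  exact ⟨(f.quotKerEquivOfSurjective hf).symm ≪≫ₗ Submodule.quotEquivOfEq _ _ hk ≪≫ₗ
    g.quotKerEquivOfSurjective hg⟩

theorem natDeg_add (c c' : Fin n → ℕ) : natDeg (c + c') = natDeg c + natDeg c' := by
  ext; simp [natDeg]

theorem natDeg_single (j : Fin n) : natDeg (Pi.single j 1) = Pi.single j 1 := by
  ext k
  by_cases h : k = j
  · subst h; simp [natDeg]
  · simp [natDeg, h]

theorem natDeg_zero : natDeg (0 : Fin n → ℕ) = 0 := by
  ext; simp [natDeg]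

theorem sub_natDeg_add_single (a : Fin n → ℤ) (c : Fin n → ℕ) (j : Fin n) :
    a - natDeg (c + Pi.single j 1) + Pi.single j 1 = a - natDeg c := by
  rw [natDeg_add, natDeg_single]; abel

variable {X : Type*} [AddCommGroup X] [Module K X] {Y : Type*} [AddCommGroup Y] [Module K Y]

/-- The chains of homological degree `k` in the strand of degree `a` of the complex
`⨁_{c ∈ B} 𝒳(-c)`. -/
def chains (B : Set (Fin n → ℕ)) (𝒳 : (Fin n → ℤ) → Submodule K X) (a : Fin n → ℤ) (k : ℕ) :
    Submodule K ((Fin n → ℕ) → X) where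
  carrier := {m | (∀ c, m c ∈ 𝒳 (a - natDeg c)) ∧ ∀ c, ¬ (c ∈ B ∧ ∑ j, c j = k) → m c = 0}
  add_mem' := fun h h' => ⟨fun c => (𝒳 _).add_mem (h.1 c) (h'.1 c), fun c hc => by
    rw [Pi.add_apply, h.2 c hc, h'.2 c hc, add_zero]⟩
  zero_mem' := ⟨fun c => (𝒳 _).zero_mem, fun _ _ => rfl⟩
  smul_mem' := fun r _ h => ⟨fun c => (𝒳 _).smul_mem r (h.1 c), fun c hc => by
    rw [Pi.smul_apply, h.2 c hc, smul_zero]⟩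

variable {B : Set (Fin n → ℕ)} {𝒳 : (Fin n → ℤ) → Submodule K X} {a : Fin n → ℤ} {k : ℕ}

theorem mem_chains_of_imp {m : (Fin n → ℕ) → X}
    (h : ∀ c ∈ B, ∑ j, c j = k → m c ∈ 𝒳 (a - natDeg c))
    (h0 : ∀ c, ¬ (c ∈ B ∧ ∑ j, c j = k) → m c = 0) : m ∈ chains B 𝒳 a k := by
  refine ⟨fun c => ?_, h0⟩
  by_cases hc : c ∈ B ∧ ∑ j, c j = k
  · exact h c hc.1 hc.2
  · rw [h0 c hc]; exact Submodule.zero_mem _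

/-- The differential of the strand of degree `a`, for operators `ξ j d` of degree `eⱼ`. -/
def bdry (ξ : Fin n → (Fin n → ℤ) → X →ₗ[K] X) (a : Fin n → ℤ) :
    ((Fin n → ℕ) → X) →ₗ[K] ((Fin n → ℕ) → X) :=
  LinearMap.pi fun c => ∑ j, ξ j (a - natDeg (c + Pi.single j 1)) ∘ₗ
    LinearMap.proj (c + Pi.single j 1)

variable {ξ : Fin n → (Fin n → ℤ) → X →ₗ[K] X}

theorem bdry_apply (m : (Fin n → ℕ) → X) (c : Fin n → ℕ) :
    bdry ξ a m c = ∑ j, ξ j (a - natDeg (c + Pi.single j 1)) (m (c + Pi.single j 1)) := by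
  simp [bdry]

/-- The operators `ξ j d : 𝒳 d → 𝒳 (d + eⱼ)` anticommute, as needed for a complex with index
set `B`. -/
structure IsKoszul (B : Set (Fin n → ℕ)) (𝒳 : (Fin n → ℤ) → Submodule K X)
    (ξ : Fin n → (Fin n → ℤ) → X →ₗ[K] X) : Prop where
  map_mem : ∀ j d, ∀ v ∈ 𝒳 d, ξ j d v ∈ 𝒳 (d + Pi.single j 1)
  anti : ∀ j k, j ≠ k → ∀ d, ∀ v ∈ 𝒳 d,
    ξ j (d + Pi.single k 1) (ξ k d v) + ξ k (d + Pi.single j 1) (ξ j d v) = 0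
  -- Squares only matter where `B` contains an exponent that is at least two in direction `j`. This
  -- is vacuous for square-free exponents, so the variables of `S` qualify, while for `B = ℕⁿ` the
  -- operators must square to zero.
  sq : ∀ j (c : Fin n → ℕ), c + Pi.single j 1 + Pi.single j 1 ∈ B → ∀ d, ∀ v ∈ 𝒳 d,
    ξ j (d + Pi.single j 1) (ξ j d v) = 0

theorem sum_add_single (c : Fin n → ℕ) (j : Fin n) :
    ∑ i, (c + Pi.single j 1 : Fin n → ℕ) i = (∑ i, c i) + 1 := by
  simp [Finset.sum_add_distrib]

theorem bdry_apply_mem (hmap : ∀ j d, ∀ v ∈ 𝒳 d, ξ j d v ∈ 𝒳 (d + Pi.single j 1))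
    {m : (Fin n → ℕ) → X} (hm : ∀ c, m c ∈ 𝒳 (a - natDeg c)) (c : Fin n → ℕ) :
    bdry ξ a m c ∈ 𝒳 (a - natDeg c) := by
  rw [bdry_apply]
  refine Submodule.sum_mem _ fun j _ => ?_
  have := hmap j _ _ (hm (c + Pi.single j 1))
  rwa [sub_natDeg_add_single] at this

/-- Lowering an exponent must not leave the index set: the term reaching `c` comes from `c + e_j`,
so a nonzero value at `c` forces `c ∈ B` when `B` is a lower set. -/
theorem bdry_mem (hB : IsLowerSet B)
    (hmap : ∀ j d, ∀ v ∈ 𝒳 d, ξ j d v ∈ 𝒳 (d + Pi.single j 1)) {m : (Fin n → ℕ) → X}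
    (hm : m ∈ chains B 𝒳 a (k + 1)) : bdry ξ a m ∈ chains B 𝒳 a k := by
  refine ⟨bdry_apply_mem hmap hm.1, ?_⟩
  · intro c hc
    rw [bdry_apply]
    refine Finset.sum_eq_zero fun j _ => ?_
    rw [hm.2, map_zero]
    rintro ⟨h1, h2⟩
    refine hc ⟨hB (le_add_of_nonneg_right (zero_le (a := _))) h1, ?_⟩
    rw [sum_add_single] at h2
    omega

theorem bdry_bdry (h : IsKoszul B 𝒳 ξ) {m : (Fin n → ℕ) → X}
    (hm : m ∈ chains B 𝒳 a k) : bdry ξ a (bdry ξ a m) = 0 := by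
  funext c
  rw [bdry_apply]
  simp only [bdry_apply, map_sum, Pi.zero_apply]
  rw [← Finset.sum_product', Finset.univ_product_univ]
  -- The terms for `(j, l)` and `(l, j)` both start at `c + e_j + e_l` and cancel by
  -- anticommutation. Diagonal terms vanish individually.
  refine Finset.sum_involution (fun p _ => p.swap) ?_ ?_ (fun _ _ => Finset.mem_univ _)
    (fun p _ => Prod.swap_swap p)
  · rintro ⟨j, l⟩ -
    have e1 : c + Pi.single j 1 + Pi.single l 1 = c + Pi.single l 1 + Pi.single j 1 := by abel
    simp only [Prod.swap]
    rw [e1]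
    set c' := c + Pi.single l 1 + Pi.single j 1 with hc'
    have e2 : a - natDeg (c + Pi.single j 1) = a - natDeg c' + Pi.single l 1 := by
      rw [← e1, sub_natDeg_add_single]
    have e3 : a - natDeg (c + Pi.single l 1) = a - natDeg c' + Pi.single j 1 := by
      rw [hc', sub_natDeg_add_single]
    rw [e2, e3]
    by_cases hjl : j = l
    · subst hjl
      by_cases hB : c' ∈ B
      · rw [h.sq j c hB _ _ (hm.1 c'), add_zero]
      · rw [hm.2 c' (fun h => hB h.1)]; simp
    · exact h.anti j l hjl _ _ (hm.1 c')
  · rintro ⟨j, l⟩ - hne heq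
    obtain rfl : l = j := congrArg Prod.fst heq
    apply hne
    by_cases hB : c + Pi.single l 1 + Pi.single l 1 ∈ B
    · have := h.sq l c hB _ _ (hm.1 (c + Pi.single l 1 + Pi.single l 1))
      rwa [sub_natDeg_add_single] at this
    · rw [hm.2 _ (fun h => hB h.1)]; simp

/-- The cycles of the strand of degree `a`. -/
def strandCycles (B : Set (Fin n → ℕ)) (𝒳 : (Fin n → ℤ) → Submodule K X)
    (ξ : Fin n → (Fin n → ℤ) → X →ₗ[K] X) (a : Fin n → ℤ) :
    ℕ → Submodule K ((Fin n → ℕ) → X)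
  | 0 => chains B 𝒳 a 0
  | k + 1 => chains B 𝒳 a (k + 1) ⊓ LinearMap.ker (bdry ξ a)

/-- The boundaries of the strand of degree `a`. -/
def strandBoundaries (B : Set (Fin n → ℕ)) (𝒳 : (Fin n → ℤ) → Submodule K X)
    (ξ : Fin n → (Fin n → ℤ) → X →ₗ[K] X) (a : Fin n → ℤ) (k : ℕ) :
    Submodule K ((Fin n → ℕ) → X) :=
  (chains B 𝒳 a (k + 1)).map (bdry ξ a)

/-- The homology of the strand of degree `a`. -/
abbrev strandHomology (B : Set (Fin n → ℕ)) (𝒳 : (Fin n → ℤ) → Submodule K X)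
    (ξ : Fin n → (Fin n → ℤ) → X →ₗ[K] X) (a : Fin n → ℤ) (k : ℕ) :
    Submodule K (((Fin n → ℕ) → X) ⧸ strandBoundaries B 𝒳 ξ a k) :=
  (strandCycles B 𝒳 ξ a k).map (strandBoundaries B 𝒳 ξ a k).mkQ

theorem mem_strandBoundaries {m : (Fin n → ℕ) → X} : m ∈ strandBoundaries B 𝒳 ξ a k ↔
    ∃ f ∈ chains B 𝒳 a (k + 1), bdry ξ a f = m := Iff.rfl

theorem bdry_eq_zero_of_chains_zero {m : (Fin n → ℕ) → X} (hm : m ∈ chains B 𝒳 a 0) :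
    bdry ξ a m = 0 := by
  funext c
  rw [bdry_apply]
  refine Finset.sum_eq_zero fun j _ => ?_
  rw [hm.2, map_zero]
  rintro ⟨-, h⟩
  rw [sum_add_single] at h
  omega

/-- The differential kills chains of homological degree zero anyway, so the case distinction
defining cycles can be forgotten. -/
theorem mem_strandCycles {m : (Fin n → ℕ) → X} : m ∈ strandCycles B 𝒳 ξ a k ↔
    m ∈ chains B 𝒳 a k ∧ bdry ξ a m = 0 := by
  cases k with
  | zero => exact ⟨fun h => ⟨h, bdry_eq_zero_of_chains_zero h⟩, fun h => h.1⟩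
  | succ k => exact Iff.rfl

/-- Exactness of all strands in positive homological degrees. -/
def Acyclic (B : Set (Fin n → ℕ)) (𝒳 : (Fin n → ℤ) → Submodule K X)
    (ξ : Fin n → (Fin n → ℤ) → X →ₗ[K] X) : Prop :=
  ∀ a k, strandCycles B 𝒳 ξ a (k + 1) ≤ strandBoundaries B 𝒳 ξ a (k + 1)

/-- A degreewise surjection compatible with the operators. -/
structure IsSurj (𝒳 : (Fin n → ℤ) → Submodule K X) (ξ : Fin n → (Fin n → ℤ) → X →ₗ[K] X)
    (𝒴 : (Fin n → ℤ) → Submodule K Y) (η : Fin n → (Fin n → ℤ) → Y →ₗ[K] Y)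
    (p : X →ₗ[K] Y) : Prop where
  map_mem : ∀ d, ∀ x ∈ 𝒳 d, p x ∈ 𝒴 d
  exists_lift : ∀ d, ∀ y ∈ 𝒴 d, ∃ x ∈ 𝒳 d, p x = y
  comm : ∀ j d x, p (ξ j d x) = η j d (p x)

/-- The homogeneous components of the kernel of a map. -/
abbrev kerPart (𝒳 : (Fin n → ℤ) → Submodule K X) (p : X →ₗ[K] Y) (d : Fin n → ℤ) :
    Submodule K X := 𝒳 d ⊓ LinearMap.ker p

variable {𝒴 : (Fin n → ℤ) → Submodule K Y} {η : Fin n → (Fin n → ℤ) → Y →ₗ[K] Y}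
  {p : X →ₗ[K] Y}

theorem IsSurj.comp_bdry (hp : IsSurj 𝒳 ξ 𝒴 η p) (m : (Fin n → ℕ) → X) :
    bdry η a (p ∘ m) = p ∘ bdry ξ a m := by
  funext c
  simp [bdry_apply, hp.comm]

theorem IsSurj.comp_mem (hp : IsSurj 𝒳 ξ 𝒴 η p) {m : (Fin n → ℕ) → X}
    (hm : m ∈ chains B 𝒳 a k) : p ∘ m ∈ chains B 𝒴 a k :=
  ⟨fun c => hp.map_mem _ _ (hm.1 c), fun c hc => by simp [hm.2 c hc]⟩

/-- Components are lifted one at a time; outside the prescribed exponents the lift is reset to zero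
so that it is again a chain. -/
theorem IsSurj.lift_chains (hp : IsSurj 𝒳 ξ 𝒴 η p) {m : (Fin n → ℕ) → Y}
    (hm : m ∈ chains B 𝒴 a k) : ∃ f ∈ chains B 𝒳 a k, p ∘ f = m := by
  classical
  choose f hf hpf using fun c => hp.exists_lift _ _ (hm.1 c)
  refine ⟨fun c => if c ∈ B ∧ ∑ j, c j = k then f c else 0, ⟨fun c => ?_, fun c hc => if_neg hc⟩, ?_⟩
  · dsimp only
    split_ifs
    · exact hf c
    · exact Submodule.zero_mem _
  · funext c
    simp only [Function.comp_apply]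
    split_ifs with h
    · exact hpf c
    · rw [map_zero, hm.2 c h]

theorem mem_chains_kerPart {m : (Fin n → ℕ) → X} :
    m ∈ chains B (kerPart 𝒳 p) a k ↔ m ∈ chains B 𝒳 a k ∧ p ∘ m = 0 := by
  constructor
  · intro h
    exact ⟨⟨fun c => (h.1 c).1, h.2⟩, funext fun c => (h.1 c).2⟩
  · rintro ⟨h, h'⟩
    exact ⟨fun c => ⟨h.1 c, congrFun h' c⟩, h.2⟩

theorem comp_sub_fun (p : X →ₗ[K] Y) (m m' : (Fin n → ℕ) → X) :
    p ∘ (m - m') = p ∘ m - p ∘ m' := by funext c; simp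

/-- The connecting isomorphism for a degreewise surjection with acyclic source. -/
theorem strandHomology_shift (hB : IsLowerSet B) (hX : IsKoszul B 𝒳 ξ)
    (hp : IsSurj 𝒳 ξ 𝒴 η p) (hac : Acyclic B 𝒳 ξ) (a : Fin n → ℤ) (k : ℕ) :
    Nonempty (strandHomology B 𝒴 η a (k + 2) ≃ₗ[K]
      strandHomology B (kerPart 𝒳 p) ξ a (k + 1)) := by
  -- The connecting homomorphism of the snake lemma, kept as a relation so that no lift has to be
  -- chosen: a chain `f` with `p ∂f = 0` relates the cycle `p ∘ f` to the cycle `∂f` of the kernel.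
  refine nonempty_subquotient_equiv _ _ _ _
    (R := ((chains B 𝒳 a (k + 2) ⊓
      LinearMap.ker ((p.compLeft (Fin n → ℕ)) ∘ₗ bdry ξ a)).map
      ((p.compLeft (Fin n → ℕ)).prod (bdry ξ a)))) ?_ ?_ ?_ ?_ ?_
  · rintro _ ⟨f, ⟨hf, hf'⟩, rfl⟩
    refine ⟨hp.comp_mem hf, ?_⟩
    change bdry η a (p ∘ f) = 0
    rw [hp.comp_bdry]
    exact hf'
  · rintro _ ⟨f, ⟨hf, hf'⟩, rfl⟩
    exact ⟨mem_chains_kerPart.2 ⟨bdry_mem hB hX.map_mem hf, hf'⟩, bdry_bdry hX hf⟩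
  · rintro _ ⟨f, ⟨hf, hf'⟩, rfl⟩
    change p ∘ f ∈ _ ↔ bdry ξ a f ∈ _
    rw [mem_strandBoundaries, mem_strandBoundaries]
    constructor
    · rintro ⟨y, hy, hyf⟩
      obtain ⟨g, hg, rfl⟩ := hp.lift_chains hy
      refine ⟨f - bdry ξ a g, mem_chains_kerPart.2
        ⟨Submodule.sub_mem _ hf (bdry_mem hB hX.map_mem hg), ?_⟩, ?_⟩
      · rw [comp_sub_fun, ← hp.comp_bdry, hyf, sub_self]
      · rw [map_sub, bdry_bdry hX hg, sub_zero]
    · rintro ⟨z, hz, hzf⟩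
      rw [mem_chains_kerPart] at hz
      -- `f - z` is a cycle of the acyclic complex of `𝒳`, and `p` kills `z`; so `p ∘ f` is the
      -- image of a boundary.
      obtain ⟨g, hg, hgf⟩ := hac a (k + 1) (x := f - z)
        ⟨Submodule.sub_mem _ hf hz.1, by
          rw [SetLike.mem_coe, LinearMap.mem_ker, map_sub, hzf, sub_self]⟩
      refine ⟨p ∘ g, hp.comp_mem hg, ?_⟩
      rw [hp.comp_bdry, hgf, comp_sub_fun, hz.2, sub_zero]
  · rintro y ⟨hy, hy'⟩
    obtain ⟨f, hf, rfl⟩ := hp.lift_chains hy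
    refine ⟨bdry ξ a f, f, ⟨hf, ?_⟩, rfl⟩
    change p ∘ bdry ξ a f = 0
    rw [← hp.comp_bdry]
    exact hy'
  · rintro z ⟨hz, hz'⟩
    rw [SetLike.mem_coe, mem_chains_kerPart] at hz
    obtain ⟨f, hf, rfl⟩ := hac a k ⟨hz.1, hz'⟩
    exact ⟨p ∘ f, f, ⟨hf, hz.2⟩, rfl⟩

end Strands

/-! ### Computing graded `Tor` by strands -/

section Compare

variable {K : Type u} [Field K] {A : Type u} [Ring A] [Algebra K A] {n : ℕ}

/-- Multiplication by the elements `x j`, twisted by scalars `sg j d`. -/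
def opAct (x : Fin n → A) (sg : Fin n → (Fin n → ℤ) → K) (X : Type*) [AddCommGroup X]
    [Module K X] [Module A X] [IsScalarTower K A X] (j : Fin n) (d : Fin n → ℤ) : X →ₗ[K] X :=
  sg j d • Algebra.lsmul K K X (x j)

theorem opAct_apply (x : Fin n → A) (sg : Fin n → (Fin n → ℤ) → K) {X : Type*} [AddCommGroup X]
    [Module K X] [Module A X] [IsScalarTower K A X] (j : Fin n) (d : Fin n → ℤ) (v : X) :
    opAct x sg X j d v = sg j d • x j • v := rfl

theorem isKoszul_opAct {𝒜 : (Fin n → ℤ) → Submodule K A} {B : Set (Fin n → ℕ)} {x : Fin n → A}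
    {sg : Fin n → (Fin n → ℤ) → K} {X : Type*} [AddCommGroup X] [Module K X] [Module A X]
    [IsScalarTower K A X] (𝒳 : (Fin n → ℤ) → Submodule K X) [SetLike.GradedSMul 𝒜 𝒳]
    (x_mem : ∀ j, x j ∈ 𝒜 (Pi.single j 1))
    (anti : ∀ j k, j ≠ k → ∀ d, (sg j (d + Pi.single k 1) * sg k d) • (x j * x k) +
      (sg k (d + Pi.single j 1) * sg j d) • (x k * x j) = 0)
    (sq : ∀ j (c : Fin n → ℕ), c + Pi.single j 1 + Pi.single j 1 ∈ B → x j * x j = 0) :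
    IsKoszul B 𝒳 (opAct x sg X) where
  map_mem j d v hv := by
    have := SetLike.GradedSMul.smul_mem (x_mem j) hv
    rw [vadd_eq_add, add_comm] at this
    exact (𝒳 _).smul_mem _ this
  anti j k hjk d v _ := by
    have := congrArg (· • v) (anti j k hjk d)
    simp only [add_smul, zero_smul, smul_assoc, mul_smul] at this
    simp only [opAct_apply]
    rw [← this]
    congr 1
    · rw [smul_comm (x j)]
    · rw [smul_comm (x k)]
  sq j c hc d v _ := by
    simp only [opAct_apply]
    rw [smul_comm (x j) (sg j d), ← mul_smul (x j), sq j c hc]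
    simp

/-- Generators of a `ℤⁿ`-graded algebra, with signs making them anticommute, such that the
associated complex on the algebra is a resolution of the residue field. -/
structure KoszulData (𝒜 : (Fin n → ℤ) → Submodule K A) where
  B : Set (Fin n → ℕ)
  x : Fin n → A
  sg : Fin n → (Fin n → ℤ) → K
  lower : IsLowerSet B
  zero_mem : 0 ∈ B
  single_mem : ∀ j, Pi.single j 1 ∈ B
  x_mem : ∀ j, x j ∈ 𝒜 (Pi.single j 1)
  sg_ne : ∀ j d, sg j d ≠ 0
  anti : ∀ j k, j ≠ k → ∀ d, (sg j (d + Pi.single k 1) * sg k d) • (x j * x k) +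
    (sg k (d + Pi.single j 1) * sg j d) • (x k * x j) = 0
  sq : ∀ j (c : Fin n → ℕ), c + Pi.single j 1 + Pi.single j 1 ∈ B → x j * x j = 0
  exists_sum : ∀ d, d ≠ 0 → ∀ y ∈ 𝒜 d, ∃ z : Fin n → A, y = ∑ j, x j * z j
  -- This makes the right ideal generated by the `x k` two-sided, so that sums of products `x k • z
  -- k` in a module are closed under the left action.
  mul_x : ∀ y j, ∃ z : Fin n → A, y * x j = ∑ k, x k * z k
  -- The shift `s` is needed because the signs depend on the total degree: on a summand `A(-s)` an
  -- element of `A` of degree `d` has total degree `d + s`.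
  acyclic : ∀ s, Acyclic B 𝒜 (opAct x (fun j d => sg j (d + s)) A)

variable {𝒜 : (Fin n → ℤ) → Submodule K A} (D : KoszulData 𝒜)

namespace KoszulData

/-- The operators of a Koszul datum on a module. -/
abbrev op (X : Type*) [AddCommGroup X] [Module K X] [Module A X] [IsScalarTower K A X] :
    Fin n → (Fin n → ℤ) → X →ₗ[K] X := opAct D.x D.sg X

theorem isKoszul {X : Type*} [AddCommGroup X] [Module K X] [Module A X] [IsScalarTower K A X]
    (𝒳 : (Fin n → ℤ) → Submodule K X) [SetLike.GradedSMul 𝒜 𝒳] :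
    IsKoszul D.B 𝒳 (D.op X) := isKoszul_opAct 𝒳 D.x_mem D.anti D.sq

theorem mem_irrelevantSMul {X : Type*} [AddCommGroup X] [Module A X] (f : X) :
    f ∈ irrelevantSMul 𝒜 X ↔ ∃ z : Fin n → X, f = ∑ j, D.x j • z j := by
  constructor
  · intro h
    refine Submodule.span_induction ?_ ⟨0, by simp⟩ ?_ ?_ h
    · rintro _ ⟨d, hd, y, hy, f, rfl⟩
      obtain ⟨z, rfl⟩ := D.exists_sum d hd y hy
      exact ⟨fun j => z j • f, by simp [Finset.sum_smul, mul_smul]⟩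
    · rintro _ _ - - ⟨z, rfl⟩ ⟨z', rfl⟩
      exact ⟨z + z', by simp [Finset.sum_add_distrib]⟩
    · rintro y _ - ⟨z, rfl⟩
      choose t ht using D.mul_x y
      refine ⟨fun k => ∑ j, t j k • z j, ?_⟩
      simp only [Finset.smul_sum]
      rw [Finset.sum_comm]
      refine Finset.sum_congr rfl fun j _ => ?_
      rw [← mul_smul, ht j, Finset.sum_smul]
      simp only [mul_smul]
  · rintro ⟨z, rfl⟩
    refine Submodule.sum_mem _ fun j _ => Submodule.subset_span
      ⟨Pi.single j 1, ?_, D.x j, D.x_mem j, z j, rfl⟩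
    intro h
    have := congrFun h j
    simp at this

/-- A free module is a direct sum of shifts of `A`, so cycles bound coordinate by coordinate. For an
infinite basis the preimages must be assembled with finite support. -/
theorem free_acyclic {X : Type w} (deg : X → Fin n → ℤ) :
    Acyclic D.B (freePart 𝒜 deg) (D.op (X →₀ A)) := by
  classical
  rintro a k m ⟨hm, hm'⟩
  have hcyc : ∀ y, (fun c => m c y) ∈ strandCycles D.B 𝒜
      (opAct D.x (fun j d => D.sg j (d + deg y)) A) (a - deg y) (k + 1) := by
    intro y
    refine ⟨⟨fun c => ?_, fun c hc => by simp [hm.2 c hc]⟩, ?_⟩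
    · have := hm.1 c y
      rwa [sub_right_comm] at this
    · rw [SetLike.mem_coe, LinearMap.mem_ker]
      funext c
      have h := congrArg (fun f : (Fin n → ℕ) → (X →₀ A) => f c y) hm'
      simp only [bdry_apply, opAct_apply] at h ⊢
      simp only [Finsupp.finsetSum_apply, Finsupp.smul_apply] at h
      refine Eq.trans (Finset.sum_congr rfl fun j _ => ?_) h
      congr 2
      abel
  -- The preimage of a zero coordinate is required to be zero, which is what bounds the support of
  -- the assembled chain.
  have hpre : ∀ y, ∃ g ∈ chains D.B 𝒜 (a - deg y) (k + 2),
      bdry (opAct D.x (fun j d => D.sg j (d + deg y)) A) (a - deg y) g = (fun c => m c y) ∧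
      ((fun c => m c y) = 0 → g = 0) := by
    intro y
    by_cases h0 : (fun c => m c y) = 0
    · exact ⟨0, Submodule.zero_mem _, by rw [map_zero, h0], fun _ => rfl⟩
    · obtain ⟨g, hg, hgm⟩ := D.acyclic (deg y) (a - deg y) k (hcyc y)
      exact ⟨g, hg, hgm, fun h => absurd h h0⟩
  choose g hg hgm hg0 using hpre
  -- Only the finitely many `c` with `|c| = k + 1` carry nonzero components of `m`, so their
  -- supports have a finite union.
  let T : Finset X := (Finset.piAntidiag Finset.univ (k + 1)).biUnion fun c => (m c).support
  have hT : ∀ y c, g y c ≠ 0 → y ∈ T := by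
    intro y c hy
    by_contra hyT
    apply hy
    rw [hg0 y, Pi.zero_apply]
    funext c'
    by_contra hne
    apply hyT
    refine Finset.mem_biUnion.2 ⟨c', ?_, Finsupp.mem_support_iff.2 hne⟩
    by_contra hc'
    apply hne
    have : m c' = 0 := by
      apply hm.2
      rintro ⟨-, h⟩
      exact hc' (by simp [Finset.mem_piAntidiag, h])
    simp [this]
  refine ⟨fun c => Finsupp.onFinset T (fun y => g y c) (fun y => hT y c), ⟨fun c y => ?_,
    fun c hc => ?_⟩, ?_⟩
  · have := (hg y).1 c
    rw [Finsupp.onFinset_apply, sub_right_comm]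
    exact this
  · ext y
    exact (hg y).2 c hc
  · funext c
    ext y
    have h := congrFun (hgm y) c
    simp only [bdry_apply, opAct_apply] at h ⊢
    simp only [Finsupp.finsetSum_apply, Finsupp.smul_apply, Finsupp.onFinset_apply]
    rw [← h]
    refine Finset.sum_congr rfl fun j _ => ?_
    congr 2
    abel

end KoszulData

theorem decompose_comm_shift {G V W σ τ : Type*} [AddCommGroup G] [DecidableEq G]
    [AddCommGroup V] [AddCommGroup W]
    [SetLike σ V] [AddSubmonoidClass σ V] [SetLike τ W] [AddSubmonoidClass τ W]
    (𝓥 : G → σ) (𝓦 : G → τ)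
    [DirectSum.Decomposition 𝓥] [DirectSum.Decomposition 𝓦] (φ : V →+ W) (s : G)
    (h : ∀ d, ∀ v ∈ 𝓥 d, φ v ∈ 𝓦 (d + s)) (v : V) (d : G) :
    φ (DirectSum.decompose 𝓥 v d) = DirectSum.decompose 𝓦 (φ v) (d + s) := by
  induction v using DirectSum.Decomposition.inductionOn 𝓥 with
  | zero => simp
  | @homogeneous e v =>
    by_cases hed : e = d
    · subst hed
      rw [DirectSum.decompose_of_mem_same _ v.2, DirectSum.decompose_of_mem_same _ (h _ _ v.2)]
    · rw [DirectSum.decompose_of_mem_ne _ v.2 hed, DirectSum.decompose_of_mem_ne _ (h _ _ v.2)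
        (fun he => hed (add_right_cancel he)), map_zero]
  | add a b ha hb => simp [ha, hb]

/-- The chain of homological degree one with given components. -/
def chainOne {X : Type*} [AddCommGroup X] (z : Fin n → X) (c : Fin n → ℕ) : X :=
  ∑ j, if c = Pi.single j 1 then z j else 0

theorem single_one_inj {j k : Fin n} :
    (Pi.single j 1 : Fin n → ℕ) = Pi.single k 1 ↔ j = k := by
  constructor
  · intro h
    by_contra hne
    have := congrFun h j
    simp [hne] at this
  · rintro rfl; rfl

theorem chainOne_single {X : Type*} [AddCommGroup X] (z : Fin n → X) (j : Fin n) :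
    chainOne z (Pi.single j 1) = z j := by
  simp [chainOne, single_one_inj]

theorem chainOne_mem {X : Type*} [AddCommGroup X] [Module K X]
    {𝒳 : (Fin n → ℤ) → Submodule K X} {a : Fin n → ℤ} {z : Fin n → X}
    (hz : ∀ j, z j ∈ 𝒳 (a - Pi.single j 1)) : chainOne z ∈ chains D.B 𝒳 a 1 := by
  refine ⟨fun c => Submodule.sum_mem _ fun j _ => ?_, fun c hc => Finset.sum_eq_zero fun j _ => ?_⟩
  · split_ifs with h
    · subst h
      rw [natDeg_single]
      exact hz j
    · exact Submodule.zero_mem _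
  · rw [if_neg]
    rintro rfl
    exact hc ⟨D.single_mem j, by simp⟩

theorem bdry_chain_zero {X : Type*} [AddCommGroup X] [Module K X]
    {ξ : Fin n → (Fin n → ℤ) → X →ₗ[K] X} {a : Fin n → ℤ} (m : (Fin n → ℕ) → X) :
    bdry ξ a m 0 = ∑ j, ξ j (a - Pi.single j 1) (m (Pi.single j 1)) := by
  rw [bdry_apply]
  simp only [zero_add, natDeg_single]

theorem eq_single_of_mem_chains_zero {X : Type*} [AddCommGroup X] [Module K X]
    {B : Set (Fin n → ℕ)} {𝒳 : (Fin n → ℤ) → Submodule K X} {a : Fin n → ℤ}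
    {m : (Fin n → ℕ) → X} (hm : m ∈ chains B 𝒳 a 0) : m = Pi.single 0 (m 0) := by
  funext c
  by_cases hc : c = 0
  · subst hc; simp
  · rw [Pi.single_eq_of_ne hc, hm.2]
    rintro ⟨-, h⟩
    exact hc (funext fun j => by simpa using (Finset.sum_eq_zero_iff.1 h) j (Finset.mem_univ j))

theorem single_zero_mem_chains {X : Type*} [AddCommGroup X] [Module K X]
    {𝒳 : (Fin n → ℤ) → Submodule K X} {a : Fin n → ℤ} {v : X} (hv : v ∈ 𝒳 a) :
    (Pi.single 0 v : (Fin n → ℕ) → X) ∈ chains D.B 𝒳 a 0 := by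
  refine ⟨fun c => ?_, fun c hc => ?_⟩
  · by_cases hc : c = 0
    · subst hc
      rwa [Pi.single_eq_same, natDeg_zero, sub_zero]
    · rw [Pi.single_eq_of_ne hc]
      exact Submodule.zero_mem _
  · refine Pi.single_eq_of_ne ?_ _
    rintro rfl
    exact hc ⟨D.zero_mem, by simp⟩

theorem linearCombination_aug {X : Type w} {Y : Type*} [AddCommGroup Y] [Module A Y]
    (φ : (X →₀ A) →ₗ[A] Y) : φ = Finsupp.linearCombination A fun x => φ (Finsupp.single x 1) := by
  ext x; simp

/-- A homogeneous map from a free module to a graded module. -/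
theorem map_freePart_mem {X : Type w} (deg : X → Fin n → ℤ) {Y : Type*} [AddCommGroup Y]
    [Module K Y] [Module A Y] {𝒴 : (Fin n → ℤ) → Submodule K Y} [SetLike.GradedSMul 𝒜 𝒴]
    (φ : (X →₀ A) →ₗ[A] Y) (h : ∀ x, φ (Finsupp.single x 1) ∈ 𝒴 (deg x)) (d : Fin n → ℤ)
    (f : X →₀ A) (hf : f ∈ freePart 𝒜 deg d) : φ f ∈ 𝒴 d := by
  rw [linearCombination_aug φ]
  exact linearCombination_mem deg _ h d f hf

variable [GradedAlgebra 𝒜]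

/-- An arbitrary preimage of a homogeneous element can be replaced by its component of the same
degree, because `φ` commutes with taking components. -/
theorem isSurj_kerPart {X : Type w} (deg : X → Fin n → ℤ) {Y : Type*} [AddCommGroup Y]
    [Module K Y] [Module A Y] [IsScalarTower K A Y] {𝒴 : (Fin n → ℤ) → Submodule K Y}
    [DirectSum.Decomposition 𝒴] [SetLike.GradedSMul 𝒜 𝒴]
    (φ : (X →₀ A) →ₗ[A] Y) (h : ∀ x, φ (Finsupp.single x 1) ∈ 𝒴 (deg x))
    {W : Type*} [AddCommGroup W] [Module K W] [Module A W] [IsScalarTower K A W]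
    (ψ : Y →ₗ[A] W) (hψ : Function.Exact φ ψ) :
    IsSurj (freePart 𝒜 deg) (D.op (X →₀ A)) (kerPart 𝒴 (ψ.restrictScalars K)) (D.op Y)
      (φ.restrictScalars K) where
  map_mem d f hf := ⟨map_freePart_mem deg φ h d f hf, hψ.apply_apply_eq_zero f⟩
  exists_lift d y hy := by
    obtain ⟨f, rfl⟩ := (hψ y).1 hy.2
    refine ⟨DirectSum.decompose (freePart 𝒜 deg) f d, SetLike.coe_mem _, ?_⟩
    have := decompose_comm (freePart 𝒜 deg) 𝒴 φ.toAddMonoidHom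
      (fun d v hv => map_freePart_mem deg φ h d v hv) f d
    refine this.trans ?_
    exact DirectSum.decompose_of_mem_same _ hy.1
  comm j d f := by
    simp only [opAct_apply, LinearMap.coe_restrictScalars, map_smul]

theorem isSurj_of_surjective {X : Type w} (deg : X → Fin n → ℤ) {Y : Type*} [AddCommGroup Y]
    [Module K Y] [Module A Y] [IsScalarTower K A Y] {𝒴 : (Fin n → ℤ) → Submodule K Y}
    [DirectSum.Decomposition 𝒴] [SetLike.GradedSMul 𝒜 𝒴]
    (φ : (X →₀ A) →ₗ[A] Y) (h : ∀ x, φ (Finsupp.single x 1) ∈ 𝒴 (deg x))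
    (hφ : Function.Surjective φ) :
    IsSurj (freePart 𝒜 deg) (D.op (X →₀ A)) 𝒴 (D.op Y) (φ.restrictScalars K) := by
  have := isSurj_kerPart D deg φ h (0 : Y →ₗ[A] Y) (fun y => by simpa using hφ y)
  exact ⟨fun d x hx => (this.map_mem d x hx).1, fun d y hy => this.exists_lift d y ⟨hy, rfl⟩,
    this.comm⟩

/-- Elements of degree `a` of a free module that lie in `𝔪F + ker φ`. -/
theorem mem_irrelevantSMul_sup_ker {X : Type w} (deg : X → Fin n → ℤ) {Y : Type*}
    [AddCommGroup Y] [Module K Y] [Module A Y] {𝒴 : (Fin n → ℤ) → Submodule K Y}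
    [DirectSum.Decomposition 𝒴] [SetLike.GradedSMul 𝒜 𝒴]
    (φ : (X →₀ A) →ₗ[A] Y) (h : ∀ x, φ (Finsupp.single x 1) ∈ 𝒴 (deg x)) {a : Fin n → ℤ}
    {f : X →₀ A} (hf : f ∈ freePart 𝒜 deg a) :
    f ∈ irrelevantSMul 𝒜 (X →₀ A) ⊔ LinearMap.ker φ ↔
      ∃ m ∈ chains D.B (freePart 𝒜 deg) a 1, φ (bdry (D.op (X →₀ A)) a m 0) = φ f := by
  constructor
  · intro hm
    obtain ⟨u, hu, z, hz, rfl⟩ := Submodule.mem_sup.1 hm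
    obtain ⟨t, rfl⟩ := (D.mem_irrelevantSMul u).1 hu
    -- Write `f = ∑ x_j t_j + z`. Only the components of `t_j` in degree `a - e_j` are kept, and the
    -- inverse scalar cancels the twist in the differential. The value at `0` is then the degree-`a`
    -- part of `∑ x_j t_j`, whose image under `φ` is `φ f`, already homogeneous of degree `a`.
    refine ⟨chainOne fun j => (D.sg j (a - Pi.single j 1))⁻¹ •
      (DirectSum.decompose (freePart 𝒜 deg) (t j) (a - Pi.single j 1) : X →₀ A),
      chainOne_mem D fun j => Submodule.smul_mem _ _ (SetLike.coe_mem _), ?_⟩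
    rw [bdry_chain_zero]
    have e1 : ∀ j, D.op (X →₀ A) j (a - Pi.single j 1) (chainOne (fun j =>
        (D.sg j (a - Pi.single j 1))⁻¹ • (DirectSum.decompose (freePart 𝒜 deg) (t j)
          (a - Pi.single j 1) : X →₀ A)) (Pi.single j 1)) =
        (DirectSum.decompose (freePart 𝒜 deg) (D.x j • t j) a : X →₀ A) := by
      intro j
      rw [chainOne_single, map_smul, opAct_apply, smul_smul, inv_mul_cancel₀ (D.sg_ne _ _),
        one_smul]
      have := decompose_comm_shift (freePart 𝒜 deg) (freePart 𝒜 deg)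
        (Algebra.lsmul K K (X →₀ A) (D.x j)).toAddMonoidHom (Pi.single j 1)
        (fun d v hv => by
          have := SetLike.GradedSMul.smul_mem (D.x_mem j) hv
          rw [vadd_eq_add, add_comm] at this
          exact this) (t j) (a - Pi.single j 1)
      rw [sub_add_cancel] at this
      exact this
    rw [Finset.sum_congr rfl fun j _ => e1 j]
    have e2 : ∑ j, (DirectSum.decompose (freePart 𝒜 deg) (D.x j • t j) a : X →₀ A) =
        DirectSum.decompose (freePart 𝒜 deg) (∑ j, D.x j • t j) a := by
      rw [DirectSum.decompose_sum, DFinsupp.finsetSum_apply, AddSubmonoidClass.coe_finsetSum]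
    rw [e2]
    have e3 := decompose_comm (freePart 𝒜 deg) 𝒴 φ.toAddMonoidHom
      (fun d v hv => map_freePart_mem deg φ h d v hv) (∑ j, D.x j • t j) a
    refine e3.trans ?_
    have e4 : φ (∑ j, D.x j • t j) = φ (∑ j, D.x j • t j + z) := by
      rw [map_add φ _ z, LinearMap.mem_ker.1 hz, add_zero]
    change ((DirectSum.decompose 𝒴 (φ (∑ j, D.x j • t j))) a : Y) = _
    rw [e4]
    exact DirectSum.decompose_of_mem_same _ (map_freePart_mem deg φ h a _ hf)
  · rintro ⟨m, hm, hmf⟩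
    have : f = bdry (D.op (X →₀ A)) a m 0 + (f - bdry (D.op (X →₀ A)) a m 0) := by abel
    rw [this]
    refine Submodule.add_mem_sup ?_ ?_
    · rw [bdry_chain_zero, D.mem_irrelevantSMul]
      exact ⟨fun j => D.sg j (a - Pi.single j 1) • m (Pi.single j 1),
        Finset.sum_congr rfl fun j _ => by rw [opAct_apply, smul_comm]⟩
    · rw [LinearMap.mem_ker, map_sub, hmf, sub_self]

/-- Elements of degree `a` of `𝔪F`. -/
theorem mem_irrelevantSMul_iff_bdry {X : Type w} (deg : X → Fin n → ℤ) {a : Fin n → ℤ}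
    {f : X →₀ A} (hf : f ∈ freePart 𝒜 deg a) : f ∈ irrelevantSMul 𝒜 (X →₀ A) ↔
      ∃ m ∈ chains D.B (freePart 𝒜 deg) a 1, bdry (D.op (X →₀ A)) a m = Pi.single 0 f := by
  -- With the identity as `φ`, the kernel contributes nothing.
  have := mem_irrelevantSMul_sup_ker D deg (𝒴 := freePart 𝒜 deg) LinearMap.id
    (fun x => single_mem_freePart 𝒜 deg x (sub_self _).symm SetLike.GradedOne.one_mem) hf
  rw [LinearMap.ker_id, sup_bot_eq] at this
  rw [this]
  refine exists_congr fun m => and_congr_right fun hm => ?_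
  have h0 := eq_single_of_mem_chains_zero
    (bdry_mem D.lower (D.isKoszul (freePart 𝒜 deg)).map_mem hm)
  constructor
  · intro h
    rw [h0]
    exact congrArg _ h
  · intro h
    rw [h, Pi.single_eq_same]

end Compare

/-! ### Dimension shifting along a free resolution. -/

section Resolution

variable {K : Type u} [Field K] {A : Type u} [Ring A] [Algebra K A] {n : ℕ}
  {𝒜 : (Fin n → ℤ) → Submodule K A} (D : KoszulData 𝒜) [GradedAlgebra 𝒜]

/-- The components of degree `a` of `ker (K ⊗ F → K ⊗ G) / im` for the beginning of a free
resolution `H → F → G → Y` are computed by strands. -/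
theorem nonempty_tor_equiv_strandHomology_one {X : Type w} (deg : X → Fin n → ℤ) {X' : Type w}
    (deg' : X' → Fin n → ℤ) {Y : Type*} [AddCommGroup Y] [Module K Y] [Module A Y]
    [IsScalarTower K A Y] {𝒴 : (Fin n → ℤ) → Submodule K Y} (p : (X →₀ A) →ₗ[A] Y)
    (hp : IsSurj (freePart 𝒜 deg) (D.op (X →₀ A)) 𝒴 (D.op Y) (p.restrictScalars K))
    (g : (X' →₀ A) →ₗ[A] (X →₀ A))
    (hg : ∀ x, g (Finsupp.single x 1) ∈ freePart 𝒜 deg (deg' x))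
    (hgp : Function.Exact g p) (a : Fin n → ℤ) :
    Nonempty ((freePart 𝒜 deg' a ⊓
        ((irrelevantSMul 𝒜 (X →₀ A)).comap g).restrictScalars K).map
        ((irrelevantSMul 𝒜 (X' →₀ A) ⊔ LinearMap.ker g).restrictScalars K).mkQ ≃ₗ[K]
      strandHomology D.B 𝒴 (D.op Y) a 1) := by
  classical
  have hF := D.isKoszul (freePart 𝒜 deg)
  have hF' := D.isKoszul (freePart 𝒜 deg')
  have hgs := isSurj_kerPart D deg' g hg p hgp
  let gK := g.restrictScalars K
  let pK := p.restrictScalars K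
  let sg : (X →₀ A) →ₗ[K] ((Fin n → ℕ) → X →₀ A) := LinearMap.single K (fun _ => X →₀ A) 0
  have hbd : ∀ m ∈ chains D.B (freePart 𝒜 deg') a 1,
      bdry (D.op (X →₀ A)) a (gK ∘ m) = Pi.single 0 (g (bdry (D.op (X' →₀ A)) a m 0)) := by
    intro m hm
    rw [hgs.comp_bdry]
    rw [eq_single_of_mem_chains_zero (bdry_mem D.lower hF'.map_mem hm)]
    funext c
    by_cases hc : c = 0
    · subst hc; simp
    · simp [hc]
  -- Again a connecting relation: `f'` in degree `a` is paired with `p ∘ f` whenever `f` is a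
  -- one-chain whose boundary is `g f'` placed at exponent `0`. Such an `f` exists exactly when `g
  -- f'` lies in `𝔪F`.
  refine nonempty_subquotient_equiv _ _ _ _
    (R := (((freePart 𝒜 deg' a).prod (chains D.B (freePart 𝒜 deg) a 1)) ⊓
      LinearMap.ker (bdry (D.op (X →₀ A)) a ∘ₗ LinearMap.snd K _ _ -
        sg ∘ₗ gK ∘ₗ LinearMap.fst K _ _)).map
      ((LinearMap.fst K _ _).prod (pK.compLeft (Fin n → ℕ) ∘ₗ LinearMap.snd K _ _)))
    ?_ ?_ ?_ ?_ ?_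
  · rintro _ ⟨⟨f', f⟩, ⟨⟨hf', hf⟩, h⟩, rfl⟩
    replace h : bdry (D.op (X →₀ A)) a f = Pi.single 0 (g f') := sub_eq_zero.1 h
    exact ⟨hf', (mem_irrelevantSMul_iff_bdry D deg
      (map_freePart_mem deg' g hg a f' hf')).2 ⟨f, hf, h⟩⟩
  · rintro _ ⟨⟨f', f⟩, ⟨⟨hf', hf⟩, h⟩, rfl⟩
    replace h : bdry (D.op (X →₀ A)) a f = Pi.single 0 (g f') := sub_eq_zero.1 h
    refine ⟨hp.comp_mem hf, ?_⟩
    change bdry (D.op Y) a (pK ∘ f) = 0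
    rw [hp.comp_bdry, h]
    funext c
    by_cases hc : c = 0
    · subst hc
      simpa [pK] using hgp.apply_apply_eq_zero f'
    · simp [hc]
  · rintro _ ⟨⟨f', f⟩, ⟨⟨hf', hf⟩, h⟩, rfl⟩
    replace h : bdry (D.op (X →₀ A)) a f = Pi.single 0 (g f') := sub_eq_zero.1 h
    change f' ∈ irrelevantSMul 𝒜 (X' →₀ A) ⊔ LinearMap.ker g ↔ pK ∘ f ∈ _
    rw [mem_irrelevantSMul_sup_ker D deg' g hg hf', mem_strandBoundaries]
    constructor
    · rintro ⟨m, hm, hmf⟩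
      have hm' := mem_chains_kerPart.1 (hgs.comp_mem hm)
      -- Subtracting the one-chain `g ∘ m` turns `f` into a cycle without changing `p ∘ f`, since `p
      -- ∘ g = 0`.
      obtain ⟨r, hr, hrf⟩ := D.free_acyclic deg a 0 (x := f - gK ∘ m)
        ⟨Submodule.sub_mem _ hf hm'.1, by
          rw [SetLike.mem_coe, LinearMap.mem_ker, map_sub, h, hbd m hm, hmf, sub_self]⟩
      refine ⟨pK ∘ r, hp.comp_mem hr, ?_⟩
      rw [hp.comp_bdry, hrf, comp_sub_fun, hm'.2, sub_zero]
    · rintro ⟨y, hy, hyf⟩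
      obtain ⟨r, hr, rfl⟩ := hp.lift_chains hy
      have hq : f - bdry (D.op (X →₀ A)) a r ∈ chains D.B (kerPart (freePart 𝒜 deg) pK) a 1 :=
        mem_chains_kerPart.2 ⟨Submodule.sub_mem _ hf (bdry_mem D.lower hF.map_mem hr), by
          rw [comp_sub_fun, ← hp.comp_bdry, hyf, sub_self]⟩
      obtain ⟨m, hm, hmf⟩ := hgs.lift_chains hq
      refine ⟨m, hm, ?_⟩
      have := hbd m hm
      rw [hmf, map_sub, bdry_bdry hF hr, sub_zero, h] at this
      exact (Pi.single_injective _ this).symm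
  · rintro f' ⟨hf', hg'⟩
    obtain ⟨f, hf, hff⟩ := (mem_irrelevantSMul_iff_bdry D deg
      (map_freePart_mem deg' g hg a f' hf')).1 hg'
    exact ⟨pK ∘ f, (f', f), ⟨⟨hf', hf⟩, sub_eq_zero.2 hff⟩, rfl⟩
  · rintro y ⟨hy, hy'⟩
    obtain ⟨f, hf, rfl⟩ := hp.lift_chains hy
    have hz := bdry_mem D.lower hF.map_mem hf
    have hpz : pK ∘ bdry (D.op (X →₀ A)) a f = 0 := by
      rw [← hp.comp_bdry]; exact hy'
    obtain ⟨f', hf', hgf⟩ := hgs.exists_lift a (bdry (D.op (X →₀ A)) a f 0)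
      ⟨by simpa [natDeg_zero] using hz.1 0, congrFun hpz 0⟩
    refine ⟨f', (f', f), ⟨⟨hf', hf⟩, sub_eq_zero.2 ?_⟩, rfl⟩
    refine (eq_single_of_mem_chains_zero hz).trans ?_
    rw [← hgf]
    rfl

/-- Both sides are the degree-`a` part of `Y / 𝔪Y`: the right one because boundaries at exponent `0`
are sums of multiples of the `x j`, the left one through the surjection `p`. The relation used is
the graph of `f ↦ p f`. -/
theorem nonempty_tor_equiv_strandHomology_zero {X : Type w} (deg : X → Fin n → ℤ)
    {Y : Type*} [AddCommGroup Y] [Module K Y] [Module A Y]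
    [IsScalarTower K A Y] {𝒴 : (Fin n → ℤ) → Submodule K Y} [DirectSum.Decomposition 𝒴]
    [SetLike.GradedSMul 𝒜 𝒴] (p : (X →₀ A) →ₗ[A] Y)
    (hp : ∀ x, p (Finsupp.single x 1) ∈ 𝒴 (deg x))
    (hps : Function.Surjective p) (a : Fin n → ℤ) :
    Nonempty ((freePart 𝒜 deg a).map
        ((irrelevantSMul 𝒜 (X →₀ A) ⊔ LinearMap.ker p).restrictScalars K).mkQ ≃ₗ[K]
      strandHomology D.B 𝒴 (D.op Y) a 0) := by
  classical
  have hs := isSurj_of_surjective D deg p hp hps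
  have hF := D.isKoszul (freePart 𝒜 deg)
  let pK := p.restrictScalars K
  let sg : Y →ₗ[K] ((Fin n → ℕ) → Y) := LinearMap.single K (fun _ => Y) 0
  have hbd : ∀ m ∈ chains D.B (freePart 𝒜 deg) a 1,
      bdry (D.op Y) a (pK ∘ m) = Pi.single 0 (p (bdry (D.op (X →₀ A)) a m 0)) := by
    intro m hm
    rw [hs.comp_bdry]
    rw [eq_single_of_mem_chains_zero (bdry_mem D.lower hF.map_mem hm)]
    funext c
    by_cases hc : c = 0
    · subst hc; simp
    · simp [hc]
  refine nonempty_subquotient_equiv _ _ _ _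
    (R := (freePart 𝒜 deg a).map ((LinearMap.id).prod (sg ∘ₗ pK))) ?_ ?_ ?_ ?_ ?_
  · rintro _ ⟨f, hf, rfl⟩
    exact hf
  · rintro _ ⟨f, hf, rfl⟩
    exact single_zero_mem_chains D (hs.map_mem a f hf)
  · rintro _ ⟨f, hf, rfl⟩
    change f ∈ irrelevantSMul 𝒜 (X →₀ A) ⊔ LinearMap.ker p ↔ (Pi.single 0 (p f) : (Fin n → ℕ) → Y) ∈ _
    rw [mem_irrelevantSMul_sup_ker D deg p hp hf, mem_strandBoundaries]
    constructor
    · rintro ⟨m, hm, hmf⟩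
      exact ⟨pK ∘ m, hs.comp_mem hm, by rw [hbd m hm, hmf]⟩
    · rintro ⟨y, hy, hyf⟩
      obtain ⟨m, hm, rfl⟩ := hs.lift_chains hy
      rw [hbd m hm] at hyf
      exact ⟨m, hm, Pi.single_injective _ hyf⟩
  · intro f hf
    exact ⟨_, f, hf, rfl⟩
  · intro y hy
    have h0 := eq_single_of_mem_chains_zero hy
    obtain ⟨f, hf, hfy⟩ := hs.exists_lift a (y 0) (by simpa [natDeg_zero] using hy.1 0)
    refine ⟨f, f, hf, ?_⟩
    rw [h0, ← hfy]
    rfl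

variable {M : Type v} [AddCommGroup M] [Module K M] [Module A M] [IsScalarTower K A M]
  {𝓜 : (Fin n → ℤ) → Submodule K M} [DirectSum.Decomposition 𝓜] [SetLike.GradedSMul 𝒜 𝓜]

/-- The homogeneous components of the syzygy modules of a graded free resolution. -/
def GradedFreeResolution.syz (P : GradedFreeResolution 𝒜 𝓜) :
    (i : ℕ) → (Fin n → ℤ) → Submodule K (P.X i →₀ A)
  | 0 => kerPart (freePart 𝒜 (P.deg 0)) (P.aug.restrictScalars K)
  | i + 1 => kerPart (freePart 𝒜 (P.deg (i + 1))) ((P.d i).restrictScalars K)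

theorem GradedFreeResolution.isSurj_syz (P : GradedFreeResolution 𝒜 𝓜) (i : ℕ) :
    IsSurj (freePart 𝒜 (P.deg (i + 1))) (D.op _) (P.syz i) (D.op _)
      ((P.d i).restrictScalars K) := by
  cases i with
  | zero => exact isSurj_kerPart D _ (P.d 0) (P.d_mem 0) P.aug P.exact_zero
  | succ i => exact isSurj_kerPart D _ (P.d (i + 1)) (P.d_mem (i + 1)) (P.d i) (P.exact_succ i)

/-- Each passage to the next syzygy lowers the homological degree by one. The index `k` stays
universally quantified, since the induction step calls the hypothesis at `k + 1`. -/
theorem GradedFreeResolution.strandHomology_syz (P : GradedFreeResolution 𝒜 𝓜) (a : Fin n → ℤ)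
    (i : ℕ) : ∀ k, Nonempty (strandHomology D.B (P.syz i) (D.op _) a (k + 1) ≃ₗ[K]
      strandHomology D.B 𝓜 (D.op M) a (i + k + 2)) := by
  induction i with
  | zero =>
    intro k
    obtain ⟨e⟩ := strandHomology_shift D.lower (D.isKoszul _)
      (isSurj_of_surjective D _ P.aug P.aug_mem P.aug_surjective) (D.free_acyclic _) a k
    rw [zero_add]
    exact ⟨e.symm⟩
  | succ i ih =>
    intro k
    obtain ⟨e⟩ := strandHomology_shift D.lower (D.isKoszul _) (P.isSurj_syz D i)
      (D.free_acyclic _) a k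
    obtain ⟨e'⟩ := ih (k + 1)
    rw [show i + (k + 1) + 2 = i + 1 + k + 2 by ring] at e'
    exact ⟨e.symm ≪≫ₗ e'⟩

/-- Graded `Tor` with the residue field is the homology of the strands. -/
theorem GradedFreeResolution.nonempty_homology_equiv (P : GradedFreeResolution 𝒜 𝓜) (i : ℕ)
    (a : Fin n → ℤ) :
    Nonempty (P.homology i a ≃ₗ[K] strandHomology D.B 𝓜 (D.op M) a i) := by
  unfold GradedFreeResolution.homology
  match i with
  | 0 =>
    have h : P.boundaries 0 = (irrelevantSMul 𝒜 (P.X 0 →₀ A) ⊔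
        LinearMap.ker P.aug).restrictScalars K := by
      rw [GradedFreeResolution.boundaries, P.exact_zero.linearMap_ker_eq]
    rw [h]
    exact nonempty_tor_equiv_strandHomology_zero D _ P.aug P.aug_mem P.aug_surjective a
  | 1 =>
    have h : P.boundaries 1 = (irrelevantSMul 𝒜 (P.X 1 →₀ A) ⊔
        LinearMap.ker (P.d 0)).restrictScalars K := by
      rw [GradedFreeResolution.boundaries, (P.exact_succ 0).linearMap_ker_eq]
    rw [h]
    exact nonempty_tor_equiv_strandHomology_one D _ _ P.aug
      (isSurj_of_surjective D _ P.aug P.aug_mem P.aug_surjective) (P.d 0) (P.d_mem 0)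
      P.exact_zero a
  -- Here `P.d i` covers the syzygies `P.syz i`, so the computation of the first strand homology
  -- applies to them; dimension shifting carries the result to `𝓜` in homological degree `i + 2`.
  | i + 2 =>
    have h : P.boundaries (i + 2) = (irrelevantSMul 𝒜 (P.X (i + 2) →₀ A) ⊔
        LinearMap.ker (P.d (i + 1))).restrictScalars K := by
      rw [GradedFreeResolution.boundaries, (P.exact_succ (i + 1)).linearMap_ker_eq]
    rw [h]
    obtain ⟨e⟩ := nonempty_tor_equiv_strandHomology_one D _ _ (P.d i) (P.isSurj_syz D i)
      (P.d (i + 1)) (P.d_mem (i + 1)) (P.exact_succ i) a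
    obtain ⟨e'⟩ := P.strandHomology_syz D a i 0
    exact ⟨e ≪≫ₗ e'⟩

end Resolution

/-! ### The Koszul complex over the polynomial ring -/

section Sym

variable {K : Type u} [Field K] {n : ℕ}

/-- The exponents of square-free monomials. -/
def sqExp (n : ℕ) : Set (Fin n → ℕ) := {c | ∀ j, c j ≤ 1}

theorem sqExp_lower : IsLowerSet (sqExp n) := fun _ _ h hc j => (h j).trans (hc j)

/-- A strand of a Koszul complex is exact if one of the operators is bijective where needed. -/
theorem strand_exact_of_bijective {X : Type*} [AddCommGroup X] [Module K X]
    {𝒳 : (Fin n → ℤ) → Submodule K X} {ξ : Fin n → (Fin n → ℤ) → X →ₗ[K] X}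
    (hX : IsKoszul (sqExp n) 𝒳 ξ) (a : Fin n → ℤ) (j : Fin n)
    (hinj : ∀ d, d j = a j - 1 → ∀ u ∈ 𝒳 d, ξ j d u = 0 → u = 0)
    (hsurj : ∀ d, d j = a j - 1 → ∀ v ∈ 𝒳 (d + Pi.single j 1), ∃ u ∈ 𝒳 d, ξ j d u = v) (k : ℕ) :
    strandCycles (sqExp n) 𝒳 ξ a k ≤ strandBoundaries (sqExp n) 𝒳 ξ a k := by
  classical
  intro m hm
  obtain ⟨hm, hm'⟩ := mem_strandCycles.1 hm
  -- The chain `f` is supported on `c j = 1` and inverts `ξ j` there. Then `∂f` agrees with `m`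
  -- wherever `c j = 0`, because the terms in other directions meet `f` only at exponents with `c j
  -- = 0`.
  have key : ∀ c, ∃ u ∈ 𝒳 (a - natDeg c),
      (c ∈ sqExp n → ∑ i, c i = k + 1 → c j = 1 →
        ξ j (a - natDeg c) u = m (c - Pi.single j 1)) ∧
      (¬ (c ∈ sqExp n ∧ ∑ i, c i = k + 1 ∧ c j = 1) → u = 0) := by
    intro c
    by_cases hc : c ∈ sqExp n ∧ ∑ i, c i = k + 1 ∧ c j = 1
    · have hcj : c - Pi.single j 1 + Pi.single j 1 = c := by
        funext i
        by_cases hi : i = j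
        · subst hi; simp [hc.2.2]
        · simp [hi]
      obtain ⟨u, hu, huv⟩ := hsurj (a - natDeg c) (by simp [natDeg, hc.2.2])
        (m (c - Pi.single j 1)) (by
          have := hm.1 (c - Pi.single j 1)
          rwa [← sub_natDeg_add_single a _ j, hcj] at this)
      exact ⟨u, hu, fun _ _ _ => huv, fun h => absurd hc h⟩
    · exact ⟨0, Submodule.zero_mem _, fun h1 h2 h3 => absurd ⟨h1, h2, h3⟩ hc, fun _ => rfl⟩
  choose f hf hfm hf0 using key
  have hfc : f ∈ chains (sqExp n) 𝒳 a (k + 1) :=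
    ⟨hf, fun c hc => hf0 c fun h => hc ⟨h.1, h.2.1⟩⟩
  have hδc : bdry ξ a f - m ∈ chains (sqExp n) 𝒳 a k :=
    Submodule.sub_mem _ (bdry_mem sqExp_lower hX.map_mem hfc) hm
  have hδ : bdry ξ a (bdry ξ a f - m) = 0 := by
    rw [map_sub, bdry_bdry hX hfc, hm', sub_zero]
  have h0 : ∀ c : Fin n → ℕ, c j = 0 → (bdry ξ a f - m) c = 0 := by
    intro c hc
    by_cases hcB : c ∈ sqExp n ∧ ∑ i, c i = k
    · have hcB' : c + Pi.single j 1 ∈ sqExp n := by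
        intro i
        by_cases hi : i = j
        · subst hi; simp [hc]
        · simpa [hi] using hcB.1 i
      rw [Pi.sub_apply, bdry_apply, Finset.sum_eq_single j]
      · rw [hfm _ hcB' (by rw [sum_add_single, hcB.2]) (by simp [hc]), add_tsub_cancel_right,
          sub_self]
      · intro i _ hi
        rw [hf0, map_zero]
        rintro ⟨-, -, h⟩
        simp [hc, Ne.symm hi] at h
      · simp
    · exact hδc.2 c hcB
  refine mem_strandBoundaries.2 ⟨f, hfc, sub_eq_zero.1 (funext fun c => ?_)⟩
  by_cases hcB : c ∈ sqExp n ∧ ∑ i, c i = k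
  · rcases Nat.le_one_iff_eq_zero_or_eq_one.1 (hcB.1 j) with hc | hc
    · exact h0 c hc
    · have hcj : c - Pi.single j 1 + Pi.single j 1 = c := by
        funext i
        by_cases hi : i = j
        · subst hi; simp [hc]
        · simp [hi]
      -- The cycle `∂f - m` vanishes where `c j = 0`, so its boundary at `c - e_j` reduces to the
      -- single term `ξ j` applied to the value at `c`. Injectivity then kills that value.
      refine hinj (a - natDeg c) (by simp [natDeg, hc]) _ (hδc.1 c) ?_
      have := congrFun hδ (c - Pi.single j 1)
      rw [bdry_apply, Finset.sum_eq_single j, hcj] at this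
      · exact this
      · intro i _ hi
        rw [h0, map_zero]
        simp [hc, Ne.symm hi]
      · simp
  · exact hδc.2 c hcB

variable (K) in
/-- The sign making the variables of the polynomial ring anticommute. -/
def koszulSign (j : Fin n) (d : Fin n → ℤ) : K := (-1) ^ (∑ p ∈ Finset.univ.filter (· < j), d p)

theorem koszulSign_ne_zero (j : Fin n) (d : Fin n → ℤ) : koszulSign K j d ≠ 0 :=
  zpow_ne_zero _ (neg_ne_zero.2 one_ne_zero)

theorem koszulSign_add_single_of_lt {j k : Fin n} (h : k < j) (d : Fin n → ℤ) :
    koszulSign K j (d + Pi.single k 1) = -koszulSign K j d := by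
  have : ∑ p ∈ Finset.univ.filter (· < j), (d + Pi.single k 1 : Fin n → ℤ) p =
      (∑ p ∈ Finset.univ.filter (· < j), d p) + 1 := by
    simp [Finset.sum_add_distrib, h]
  rw [koszulSign, this, zpow_add₀ (neg_ne_zero.2 one_ne_zero), koszulSign]
  simp

theorem koszulSign_add_single_of_not_lt {j k : Fin n} (h : ¬ k < j) (d : Fin n → ℤ) :
    koszulSign K j (d + Pi.single k 1) = koszulSign K j d := by
  have : ∑ p ∈ Finset.univ.filter (· < j), (d + Pi.single k 1 : Fin n → ℤ) p =
      (∑ p ∈ Finset.univ.filter (· < j), d p) := by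
    simp [Finset.sum_add_distrib, h]
  rw [koszulSign, this, koszulSign]

/-- Raising the degree in direction `k` flips the sign of `x_j` exactly when `k < j`; for two
distinct indices this happens in just one of the two orders. -/
theorem koszulSign_anti (j k : Fin n) (hjk : j ≠ k) (d : Fin n → ℤ) :
    koszulSign K j (d + Pi.single k 1) * koszulSign K k d +
      koszulSign K k (d + Pi.single j 1) * koszulSign K j d = 0 := by
  rcases lt_or_gt_of_ne hjk with h | h
  · rw [koszulSign_add_single_of_lt h, koszulSign_add_single_of_not_lt h.le.not_gt]; ring
  · rw [koszulSign_add_single_of_lt h, koszulSign_add_single_of_not_lt h.le.not_gt]; ring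

theorem weight_single_eq_natDeg (m : Fin n →₀ ℕ) :
    Finsupp.weight (fun j : Fin n => (Pi.single j 1 : Fin n → ℤ)) m = natDeg m := by
  rw [Finsupp.weight_apply, Finsupp.sum_fintype _ _ (by simp)]
  funext k
  simp [natDeg, Finset.sum_apply, Pi.single_apply]

theorem natDeg_injective : Function.Injective (natDeg (n := n)) := fun c c' h =>
  funext fun j => by simpa [natDeg] using congrFun h j

theorem mem_symGrading {d : Fin n → ℤ} {y : Sy K n} :
    y ∈ symGrading K n d ↔ ∀ m, MvPolynomial.coeff m y ≠ 0 → natDeg m = d := by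
  rw [MvPolynomial.mem_weightedHomogeneousSubmodule]
  simp only [MvPolynomial.IsWeightedHomogeneous, weight_single_eq_natDeg]

theorem monomial_mem_symGrading (m : Fin n →₀ ℕ) (r : K) :
    MvPolynomial.monomial m r ∈ symGrading K n (natDeg m) := by
  classical
  rw [mem_symGrading]
  intro m' h
  rw [MvPolynomial.coeff_monomial] at h
  split_ifs at h with h'
  · rw [h']
  · exact absurd rfl h

theorem eq_monomial_of_mem_symGrading {d : Fin n → ℤ} {y : Sy K n} (hy : y ∈ symGrading K n d) :
    y = 0 ∨ ∃ m r, natDeg (m : Fin n →₀ ℕ) = d ∧ y = MvPolynomial.monomial m r := by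
  classical
  rw [or_iff_not_imp_left]
  intro h
  obtain ⟨m, hm⟩ := MvPolynomial.exists_coeff_ne_zero h
  rw [mem_symGrading] at hy
  refine ⟨m, MvPolynomial.coeff m y, hy m hm, ?_⟩
  ext m'
  rw [MvPolynomial.coeff_monomial]
  split_ifs with h'
  · rw [h']
  · by_contra hne
    exact h' (DFunLike.coe_injective (natDeg_injective ((hy m hm).trans (hy m' hne).symm)))

theorem symGrading_eq_zero_of_neg {d : Fin n → ℤ} {j : Fin n} (hd : d j < 0) {y : Sy K n}
    (hy : y ∈ symGrading K n d) : y = 0 := by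
  rcases eq_monomial_of_mem_symGrading hy with h | ⟨m, r, rfl, -⟩
  · exact h
  · simp only [natDeg] at hd
    omega

theorem X_mem_symGrading (j : Fin n) :
    (MvPolynomial.X j : Sy K n) ∈ symGrading K n (Pi.single j 1) := by
  have := monomial_mem_symGrading (K := K) (Finsupp.single j 1) 1
  rw [Finsupp.single_eq_pi_single, natDeg_single] at this
  exact this

theorem monomial_eq_X_mul {m : Fin n →₀ ℕ} {j : Fin n} (hj : m j ≠ 0) (r : K) :
    (MvPolynomial.monomial m r : Sy K n) =
      MvPolynomial.X j * MvPolynomial.monomial (m - Finsupp.single j 1) r := by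
  rw [MvPolynomial.X, MvPolynomial.monomial_mul, one_mul, add_tsub_cancel_of_le]
  rw [Finsupp.single_le_iff]
  omega

/-- Elements of `S` whose degree in `xⱼ` is positive are divisible by `xⱼ`. -/
theorem exists_X_mul_of_mem_symGrading {d : Fin n → ℤ} {j : Fin n} (hd : 0 ≤ d j) {v : Sy K n}
    (hv : v ∈ symGrading K n (d + Pi.single j 1)) :
    ∃ u ∈ symGrading K n d, MvPolynomial.X j * u = v := by
  rcases eq_monomial_of_mem_symGrading hv with rfl | ⟨m, r, hm, rfl⟩
  · exact ⟨0, Submodule.zero_mem _, mul_zero _⟩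
  · have hj : m j ≠ 0 := by
      have := congrFun hm j
      simp [natDeg] at this
      omega
    refine ⟨_, ?_, (monomial_eq_X_mul hj r).symm⟩
    have := monomial_mem_symGrading (m - Finsupp.single j 1) r
    convert this using 2
    rw [← add_left_inj (Pi.single j 1), ← hm, ← natDeg_single, ← natDeg_add]
    congr 1
    funext i
    by_cases hi : i = j
    · subst hi; simp; omega
    · simp [hi]

theorem isKoszul_sym {X : Type*} [AddCommGroup X] [Module K X] [Module (Sy K n) X]
    [IsScalarTower K (Sy K n) X] (𝒳 : (Fin n → ℤ) → Submodule K X)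
    [SetLike.GradedSMul (symGrading K n) 𝒳] (s : Fin n → ℤ) :
    IsKoszul (sqExp n) 𝒳 (opAct (MvPolynomial.X : Fin n → Sy K n)
      (fun j d => koszulSign K j (d + s)) X) := by
  refine isKoszul_opAct 𝒳 X_mem_symGrading ?_ ?_
  · intro j k hjk d
    rw [mul_comm (MvPolynomial.X k), ← add_smul, add_right_comm d _ s, add_right_comm d _ s,
      koszulSign_anti j k hjk, zero_smul]
  · intro j c hc
    have := hc j
    simp only [Pi.add_apply, Pi.single_eq_same] at this
    omega

/-- Multiplication by `x_j` is bijective from degree `d` to degree `d + e_j` as soon as `d j ≥ 0`.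
Exactness includes homological degree `0`, which is needed later over `E`. -/
theorem sym_strand_exact (s a : Fin n → ℤ) {j : Fin n} (hj : 1 ≤ a j) (k : ℕ) :
    strandCycles (sqExp n) (symGrading K n) (opAct (MvPolynomial.X : Fin n → Sy K n)
      (fun j d => koszulSign K j (d + s)) (Sy K n)) a k ≤
    strandBoundaries (sqExp n) (symGrading K n) (opAct (MvPolynomial.X : Fin n → Sy K n)
      (fun j d => koszulSign K j (d + s)) (Sy K n)) a k := by
  refine strand_exact_of_bijective (isKoszul_sym _ s) a j ?_ ?_ k
  · intro d _ u _ h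
    rw [opAct_apply, smul_eq_zero_iff_right (koszulSign_ne_zero _ _), smul_eq_mul] at h
    exact (mul_eq_zero.1 h).resolve_left (MvPolynomial.X_ne_zero j)
  · intro d hd v hv
    obtain ⟨u, hu, rfl⟩ := exists_X_mul_of_mem_symGrading (by omega) hv
    refine ⟨(koszulSign K j (d + s))⁻¹ • u, Submodule.smul_mem _ _ hu, ?_⟩
    rw [map_smul, opAct_apply, smul_smul, inv_mul_cancel₀ (koszulSign_ne_zero _ _), one_smul,
      smul_eq_mul]

theorem sym_acyclic (s : Fin n → ℤ) : Acyclic (sqExp n) (symGrading K n)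
    (opAct (MvPolynomial.X : Fin n → Sy K n) (fun j d => koszulSign K j (d + s)) (Sy K n)) := by
  intro a k
  by_cases ha : ∃ j, 1 ≤ a j
  · obtain ⟨j, hj⟩ := ha
    exact sym_strand_exact s a hj (k + 1)
  · push Not at ha
    rintro m ⟨hm, -⟩
    -- All coordinates of `a` are at most zero and `c` is nonzero, so `a - c` has a negative
    -- coordinate, where `S` vanishes.
    have : m = 0 := by
      funext c
      by_cases hc : ∑ i, c i = k + 1
      · obtain ⟨j, -, hj⟩ := Finset.exists_ne_zero_of_sum_ne_zero (by rw [hc]; omega)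
        refine symGrading_eq_zero_of_neg (j := j) ?_ (hm.1 c)
        have := ha j
        simp only [Pi.sub_apply, natDeg]
        omega
      · exact hm.2 c fun h => hc h.2
    rw [this]
    exact Submodule.zero_mem _

variable (K n) in
/-- The data of the Koszul complex over the polynomial ring. -/
def symKoszulData : KoszulData (symGrading K n) where
  B := sqExp n
  x := MvPolynomial.X
  sg := koszulSign K
  lower := sqExp_lower
  zero_mem _ := Nat.zero_le _
  single_mem j i := by
    by_cases h : i = j
    · subst h; simp
    · simp [h]
  x_mem := X_mem_symGrading
  sg_ne := koszulSign_ne_zero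
  anti j k hjk d := by
    rw [mul_comm (MvPolynomial.X k), ← add_smul, koszulSign_anti j k hjk, zero_smul]
  sq j c hc := by
    have := hc j
    simp only [Pi.add_apply, Pi.single_eq_same] at this
    omega
  exists_sum d hd y hy := by
    rcases eq_monomial_of_mem_symGrading hy with rfl | ⟨m, r, rfl, rfl⟩
    · exact ⟨0, by simp⟩
    · obtain ⟨j, hj⟩ : ∃ j, m j ≠ 0 := by
        by_contra! h
        exact hd (funext fun j => by simp [natDeg, h j])
      refine ⟨Pi.single j (MvPolynomial.monomial (m - Finsupp.single j 1) r), ?_⟩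
      rw [Finset.sum_eq_single j]
      · rw [Pi.single_eq_same, monomial_eq_X_mul hj]
      · intro i _ hi
        rw [Pi.single_eq_of_ne hi, mul_zero]
      · simp
  mul_x y j := ⟨Pi.single j y, by
    rw [Finset.sum_eq_single j, Pi.single_eq_same, mul_comm]
    · intro i _ hi
      rw [Pi.single_eq_of_ne hi, mul_zero]
    · simp⟩
  acyclic := sym_acyclic

end Sym

/-! ### Comparing strands over the polynomial ring and over the exterior algebra -/

section Comparison

variable {K : Type*} [Field K] {n : ℕ} {M : Type*} [AddCommGroup M] [Module K M]
  {N : Type*} [AddCommGroup N] [Module K N]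

/-- Square-free degrees. -/
def IsSq (d : Fin n → ℤ) : Prop := ∀ j, 0 ≤ d j ∧ d j ≤ 1

theorem isSq_sqDeg (s : Finset (Fin n)) : IsSq (sqDeg s) := fun j => by
  unfold sqDeg; split_ifs <;> simp

/-- The support of a degree. -/
def degSupp (d : Fin n → ℤ) : Finset (Fin n) := Finset.univ.filter (d · ≠ 0)

theorem IsSq.eq_sqDeg {d : Fin n → ℤ} (h : IsSq d) : d = sqDeg (degSupp d) := by
  funext j
  have := h j
  simp only [sqDeg, degSupp, Finset.mem_filter, Finset.mem_univ, true_and]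
  split_ifs <;> omega

theorem isSq_iff {d : Fin n → ℤ} : IsSq d ↔ ∃ s, d = sqDeg s :=
  ⟨fun h => ⟨_, h.eq_sqDeg⟩, fun ⟨s, h⟩ => h ▸ isSq_sqDeg s⟩

theorem sqDeg_injective : Function.Injective (sqDeg (n := n)) := fun s t h => by
  ext j
  have := congrFun h j
  simp only [sqDeg] at this
  by_cases h1 : j ∈ s <;> by_cases h2 : j ∈ t <;> simp_all

theorem degSupp_sqDeg (s : Finset (Fin n)) : degSupp (sqDeg s) = s :=
  (sqDeg_injective (isSq_sqDeg s).eq_sqDeg).symm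

/-- Isomorphisms between the square-free parts of two graded vector spaces that intertwine
given operators, where one of the spaces is concentrated in square-free degrees. -/
structure SqIso (𝒳 : (Fin n → ℤ) → Submodule K M) (ξ : Fin n → (Fin n → ℤ) → M →ₗ[K] M)
    (𝒴 : (Fin n → ℤ) → Submodule K N) (η : Fin n → (Fin n → ℤ) → N →ₗ[K] N) where
  φ : (Fin n → ℤ) → M →ₗ[K] N
  ψ : (Fin n → ℤ) → N →ₗ[K] M
  φ_mem : ∀ d, IsSq d → ∀ v ∈ 𝒳 d, φ d v ∈ 𝒴 d
  ψ_mem : ∀ d, IsSq d → ∀ v ∈ 𝒴 d, ψ d v ∈ 𝒳 d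
  ψ_φ : ∀ d, IsSq d → ∀ v ∈ 𝒳 d, ψ d (φ d v) = v
  φ_ψ : ∀ d, IsSq d → ∀ v ∈ 𝒴 d, φ d (ψ d v) = v
  comm : ∀ j d, IsSq d → IsSq (d + Pi.single j 1) → ∀ v ∈ 𝒳 d,
    φ (d + Pi.single j 1) (ξ j d v) = η j d (φ d v)
  map_mem : ∀ j d, ∀ v ∈ 𝒳 d, ξ j d v ∈ 𝒳 (d + Pi.single j 1)
  map_mem' : ∀ j d, ∀ v ∈ 𝒴 d, η j d v ∈ 𝒴 (d + Pi.single j 1)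
  eq_zero_of_neg : ∀ d j, d j < 0 → ∀ v ∈ 𝒳 d, v = 0
  eq_zero_of_not : ∀ d, ¬ IsSq d → ∀ v ∈ 𝒴 d, v = 0

namespace SqIso

variable {𝒳 : (Fin n → ℤ) → Submodule K M} {ξ : Fin n → (Fin n → ℤ) → M →ₗ[K] M}
  {𝒴 : (Fin n → ℤ) → Submodule K N} {η : Fin n → (Fin n → ℤ) → N →ₗ[K] N}
  (I : SqIso 𝒳 ξ 𝒴 η) (a : Fin n → ℕ)

/-- The support of an exponent. -/
abbrev expSupp (a : Fin n → ℕ) : Finset (Fin n) := Finset.univ.filter (a · ≠ 0)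

/-- The key reindexing. The subtraction in `a - 1` is truncated: it removes one from each positive
coordinate and leaves zeros alone, so `a - (a - 1)` is the indicator of the support. -/
theorem natDeg_sub_add (c : Fin n → ℕ) :
    natDeg a - natDeg (a - 1 + c) = sqDeg (expSupp a) - natDeg c := by
  funext j
  simp only [natDeg, sqDeg, Pi.sub_apply, Pi.add_apply, Pi.one_apply, Finset.mem_filter,
    Finset.mem_univ, true_and]
  split_ifs <;> push_cast <;> omega

/-- The chain map from the square-free strand to the strand of degree `a`. -/
def toExt : ((Fin n → ℕ) → M) →ₗ[K] ((Fin n → ℕ) → N) :=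
  open Classical in
  LinearMap.pi fun c => if a - 1 ≤ c then
    I.φ (sqDeg (expSupp a) - natDeg (c - (a - 1))) ∘ₗ LinearMap.proj (c - (a - 1)) else 0

/-- The inverse of the chain map from the square-free strand to the strand of degree `a`. -/
def toSym : ((Fin n → ℕ) → N) →ₗ[K] ((Fin n → ℕ) → M) :=
  open Classical in
  LinearMap.pi fun c => if c ∈ sqExp n then
    I.ψ (sqDeg (expSupp a) - natDeg c) ∘ₗ LinearMap.proj (a - 1 + c) else 0

theorem toExt_apply_add (m : (Fin n → ℕ) → M) (c : Fin n → ℕ) :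
    I.toExt a m (a - 1 + c) = I.φ (sqDeg (expSupp a) - natDeg c) (m c) := by
  simp [toExt]

theorem toExt_apply_of_not_le (m : (Fin n → ℕ) → M) {c : Fin n → ℕ} (hc : ¬ a - 1 ≤ c) :
    I.toExt a m c = 0 := by
  simp [toExt, hc]

theorem toSym_apply (m : (Fin n → ℕ) → N) {c : Fin n → ℕ} (hc : c ∈ sqExp n) :
    I.toSym a m c = I.ψ (sqDeg (expSupp a) - natDeg c) (m (a - 1 + c)) := by
  simp [toSym, hc]

theorem toSym_apply_of_not (m : (Fin n → ℕ) → N) {c : Fin n → ℕ} (hc : c ∉ sqExp n) :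
    I.toSym a m c = 0 := by
  simp [toSym, hc]

/-- A chain of the square-free strand vanishes or has square-free degree in each place. -/
theorem isSq_or_eq_zero (I : SqIso 𝒳 ξ 𝒴 η) {s : Finset (Fin n)} {k : ℕ} {m : (Fin n → ℕ) → M}
    (hm : m ∈ chains (sqExp n) 𝒳 (sqDeg s) k) (c : Fin n → ℕ) :
    (IsSq (sqDeg s - natDeg c)) ∨ m c = 0 := by
  rw [or_iff_not_imp_left]
  intro h
  obtain ⟨j, hj⟩ := not_forall.1 h
  refine I.eq_zero_of_neg _ j ?_ _ (hm.1 c)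
  have h1 := isSq_sqDeg s j
  simp only [Pi.sub_apply, natDeg] at hj ⊢
  omega

theorem not_isSq_of_not_le {c : Fin n → ℕ} (hc : ¬ a - 1 ≤ c) :
    ¬ IsSq (natDeg a - natDeg c) := by
  intro h
  apply hc
  intro j
  have := h j
  simp only [natDeg, Pi.sub_apply] at this
  simp only [Pi.sub_apply, Pi.one_apply]
  omega

theorem chains_eq_zero_of_not_le (I : SqIso 𝒳 ξ 𝒴 η) {k : ℕ} {m : (Fin n → ℕ) → N}
    (hm : m ∈ chains Set.univ 𝒴 (natDeg a) k) {c : Fin n → ℕ} (hc : ¬ a - 1 ≤ c) : m c = 0 :=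
  I.eq_zero_of_not _ (not_isSq_of_not_le a hc) _ (hm.1 c)

theorem sum_sub_one_add (c : Fin n → ℕ) :
    ∑ j, (a - 1 + c) j = (∑ j, c j) + ∑ j, (a j - 1) := by
  simp [Finset.sum_add_distrib, add_comm]

theorem toExt_mem {k : ℕ} {m : (Fin n → ℕ) → M}
    (hm : m ∈ chains (sqExp n) 𝒳 (sqDeg (expSupp a)) k) :
    I.toExt a m ∈ chains Set.univ 𝒴 (natDeg a) (k + ∑ j, (a j - 1)) := by
  constructor
  · intro c
    by_cases hc : a - 1 ≤ c
    · obtain ⟨c, rfl⟩ := exists_add_of_le hc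
      rw [toExt_apply_add, natDeg_sub_add]
      rcases I.isSq_or_eq_zero hm c with h | h
      · exact I.φ_mem _ h _ (hm.1 c)
      · rw [h, map_zero]; exact Submodule.zero_mem _
    · rw [toExt_apply_of_not_le _ _ _ hc]; exact Submodule.zero_mem _
  · intro c hcs
    by_cases hc : a - 1 ≤ c
    · obtain ⟨c, rfl⟩ := exists_add_of_le hc
      rw [toExt_apply_add, hm.2 c, map_zero]
      rintro ⟨-, h⟩
      exact hcs ⟨Set.mem_univ _, by rw [sum_sub_one_add, h]⟩
    · rw [toExt_apply_of_not_le _ _ _ hc]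

theorem toSym_mem {k : ℕ} {m : (Fin n → ℕ) → N}
    (hm : m ∈ chains Set.univ 𝒴 (natDeg a) (k + ∑ j, (a j - 1))) :
    I.toSym a m ∈ chains (sqExp n) 𝒳 (sqDeg (expSupp a)) k := by
  refine mem_chains_of_imp ?_ ?_
  · intro c hc _
    rw [toSym_apply _ _ _ hc]
    have h1 := hm.1 (a - 1 + c)
    rw [natDeg_sub_add] at h1
    by_cases h : IsSq (sqDeg (expSupp a) - natDeg c)
    · exact I.ψ_mem _ h _ h1
    · rw [I.eq_zero_of_not _ h _ h1, map_zero]; exact Submodule.zero_mem _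
  · intro c h
    by_cases hc : c ∈ sqExp n
    · rw [toSym_apply _ _ _ hc, hm.2, map_zero]
      rintro ⟨-, h'⟩
      rw [sum_sub_one_add] at h'
      exact h ⟨hc, by omega⟩
    · exact toSym_apply_of_not _ _ _ hc

theorem toExt_toSym {k : ℕ} {m : (Fin n → ℕ) → N}
    (hm : m ∈ chains Set.univ 𝒴 (natDeg a) k) : I.toExt a (I.toSym a m) = m := by
  funext c
  by_cases hc : a - 1 ≤ c
  · obtain ⟨c, rfl⟩ := exists_add_of_le hc
    rw [toExt_apply_add]
    have h1 := hm.1 (a - 1 + c)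
    rw [natDeg_sub_add] at h1
    by_cases h : IsSq (sqDeg (expSupp a) - natDeg c)
    · rw [toSym_apply, I.φ_ψ _ h _ h1]
      intro j
      have h2 := isSq_sqDeg (expSupp a) j
      have h3 := h j
      simp only [Pi.sub_apply, natDeg] at h3
      omega
    · rw [I.eq_zero_of_not _ h _ h1]
      by_cases hc' : c ∈ sqExp n
      · rw [toSym_apply _ _ _ hc', I.eq_zero_of_not _ h _ h1, map_zero, map_zero]
      · rw [toSym_apply_of_not _ _ _ hc', map_zero]
  · rw [toExt_apply_of_not_le _ _ _ hc, I.chains_eq_zero_of_not_le a hm hc]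

theorem toExt_injective {k : ℕ} {m : (Fin n → ℕ) → M}
    (hm : m ∈ chains (sqExp n) 𝒳 (sqDeg (expSupp a)) k) (h0 : I.toExt a m = 0) : m = 0 := by
  funext c
  rcases I.isSq_or_eq_zero hm c with h | h
  · have := congrFun h0 (a - 1 + c)
    rw [toExt_apply_add] at this
    rw [← I.ψ_φ _ h _ (hm.1 c), this, Pi.zero_apply, map_zero, Pi.zero_apply]
  · exact h

/-- Where a component of `m` is nonzero, its degree `d` is square-free; the target degree `d + e_j`
lies between `d` and `supp(a)`, so it is square-free as well and `I.comm` applies. Exponents not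
above `a - 1` correspond to non-square-free degrees, where the right side vanishes. -/
theorem toExt_bdry {k : ℕ} {m : (Fin n → ℕ) → M}
    (hm : m ∈ chains (sqExp n) 𝒳 (sqDeg (expSupp a)) k) :
    I.toExt a (bdry ξ (sqDeg (expSupp a)) m) = bdry η (natDeg a) (I.toExt a m) := by
  funext c
  by_cases hc : a - 1 ≤ c
  · obtain ⟨c, rfl⟩ := exists_add_of_le hc
    rw [toExt_apply_add, bdry_apply, bdry_apply, map_sum]
    refine Finset.sum_congr rfl fun j _ => ?_
    rw [add_assoc, toExt_apply_add, natDeg_sub_add]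
    set d := sqDeg (expSupp a) - natDeg (c + Pi.single j 1) with hd
    have hd' : sqDeg (expSupp a) - natDeg c = d + Pi.single j 1 :=
      (sub_natDeg_add_single _ _ _).symm
    rw [hd']
    by_cases h0 : m (c + Pi.single j 1) = 0
    · simp [h0]
    · have h1 := (I.isSq_or_eq_zero hm (c + Pi.single j 1)).resolve_right h0
      refine I.comm j d h1 ?_ _ (hm.1 _)
      rw [← hd']
      intro i
      have h2 := h1 i
      have h3 := isSq_sqDeg (expSupp a) i
      simp only [natDeg, Pi.sub_apply, Pi.add_apply] at h2 ⊢
      push_cast at h2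
      omega
  · rw [toExt_apply_of_not_le _ _ _ hc]
    exact (I.eq_zero_of_not _ (not_isSq_of_not_le a hc) _
      (bdry_apply_mem I.map_mem' (I.toExt_mem a hm).1 c)).symm

/-- The strand of degree `a` over the exterior algebra and the square-free strand over the
polynomial ring have isomorphic homology. -/
theorem nonempty_strandHomology_equiv (I : SqIso 𝒳 ξ 𝒴 η) (k : ℕ) :
    Nonempty (strandHomology (sqExp n) 𝒳 ξ (sqDeg (expSupp a)) k ≃ₗ[K]
      strandHomology Set.univ 𝒴 η (natDeg a) (k + ∑ j, (a j - 1))) := by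
  refine nonempty_subquotient_equiv _ _ _ _
    (R := (strandCycles (sqExp n) 𝒳 ξ (sqDeg (expSupp a)) k).map
      (LinearMap.id.prod (I.toExt a))) ?_ ?_ ?_ ?_ ?_
  · rintro _ ⟨m, hm, rfl⟩
    exact hm
  · rintro _ ⟨m, hm, rfl⟩
    obtain ⟨hm, hm'⟩ := mem_strandCycles.1 hm
    refine mem_strandCycles.2 ⟨I.toExt_mem a hm, ?_⟩
    change bdry η (natDeg a) (I.toExt a m) = 0
    rw [← I.toExt_bdry a hm, hm', map_zero]
  · rintro _ ⟨m, hm, rfl⟩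
    obtain ⟨hm, hm'⟩ := mem_strandCycles.1 hm
    change m ∈ _ ↔ I.toExt a m ∈ _
    rw [mem_strandBoundaries, mem_strandBoundaries]
    constructor
    · rintro ⟨f, hf, rfl⟩
      refine ⟨I.toExt a f, ?_, (I.toExt_bdry a hf).symm⟩
      have := I.toExt_mem a hf
      rwa [add_right_comm] at this
    · rintro ⟨y, hy, hym⟩
      rw [add_right_comm] at hy
      have hf := I.toSym_mem a hy
      -- It is not necessary to know that `toSym` is a chain map: the required identity is checked
      -- after applying `toExt`, which is injective on chains and undoes `toSym`.
      refine ⟨I.toSym a y, hf, sub_eq_zero.1 (I.toExt_injective a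
        (Submodule.sub_mem _ (bdry_mem sqExp_lower I.map_mem hf) hm) ?_)⟩
      rw [map_sub, I.toExt_bdry a hf, I.toExt_toSym a hy, hym, sub_self]
  · intro m hm
    exact ⟨_, m, hm, rfl⟩
  · intro y hy
    obtain ⟨hy, hy'⟩ := mem_strandCycles.1 hy
    have hf := I.toSym_mem a hy
    refine ⟨I.toSym a y, I.toSym a y, mem_strandCycles.2 ⟨hf, ?_⟩, ?_⟩
    · cases k with
      | zero => exact bdry_eq_zero_of_chains_zero hf
      | succ k =>
        refine I.toExt_injective a (bdry_mem sqExp_lower I.map_mem hf) ?_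
        rw [I.toExt_bdry a hf, I.toExt_toSym a hy, hy']
    · exact Prod.ext rfl (I.toExt_toSym a hy)

end SqIso

end Comparison

/-! ### Monomials of the exterior algebra -/

section Ext

variable (K : Type u) [Field K] {n : ℕ}

theorem extVar_mul_extMon_of_mem {j : Fin n} {s : Finset (Fin n)} (h : j ∈ s) :
    extVar K n j * extMon K s = 0 := by
  have h1 := extVar_mul_extMon K j (s.erase j) (Finset.notMem_erase j s)
  rw [Finset.insert_erase h] at h1
  have h2 := congrArg (extVar K n j * ·) h1
  rw [← mul_assoc, extVar_sq, zero_mul, mul_smul_comm] at h2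
  exact (smul_eq_zero_iff_right (pow_ne_zero _ (neg_ne_zero.2 one_ne_zero))).1 h2.symm

theorem sqDeg_insert {j : Fin n} {s : Finset (Fin n)} (h : j ∉ s) :
    sqDeg (insert j s) = sqDeg s + Pi.single j 1 := by
  funext i
  by_cases hi : i = j
  · subst hi; simp [sqDeg, h]
  · simp [sqDeg, hi]

theorem extListProd_eq (l : List (Fin n)) : extListProd K n l = 0 ∨
    ∃ s, ∃ r : K, listDeg l = sqDeg s ∧ extListProd K n l = r • extMon K s := by
  induction l with
  | nil =>
    refine Or.inr ⟨∅, 1, ?_, ?_⟩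
    · funext j; simp [listDeg, sqDeg]
    · simp [extMon, extListProd]
  | cons j l ih =>
    have hl : extListProd K n (j :: l) = extVar K n j * extListProd K n l := by
      simp [extListProd]
    rcases ih with h | ⟨s, r, hd, h⟩
    · exact Or.inl (by rw [hl, h, mul_zero])
    · by_cases hj : j ∈ s
      · exact Or.inl (by rw [hl, h, mul_smul_comm, extVar_mul_extMon_of_mem K hj, smul_zero])
      · refine Or.inr ⟨insert j s, r * (-1) ^ (s.filter (· < j)).card, ?_, ?_⟩
        · rw [sqDeg_insert hj, ← hd, add_comm, ← listDeg_singleton, ← listDeg_append]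
          rfl
        · rw [hl, h, mul_smul_comm, extVar_mul_extMon K j s hj, smul_smul]

theorem eq_smul_extMon_of_mem {s : Finset (Fin n)} {y : Ex K n}
    (hy : y ∈ extGrading K n (sqDeg s)) : ∃ r : K, y = r • extMon K s := by
  have : extGrading K n (sqDeg s) ≤ Submodule.span K {extMon K s} := by
    refine Submodule.span_le.2 ?_
    rintro _ ⟨l, hl, rfl⟩
    rcases extListProd_eq K l with h | ⟨t, r, ht, h⟩
    · rw [h]; exact Submodule.zero_mem _
    · rw [hl] at ht
      rw [h, ← sqDeg_injective ht]
      exact Submodule.smul_mem _ _ (Submodule.mem_span_singleton_self _)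
  obtain ⟨r, hr⟩ := Submodule.mem_span_singleton.1 (this hy)
  exact ⟨r, hr.symm⟩

theorem extGrading_eq_zero_of_not_isSq {d : Fin n → ℤ} (hd : ¬ IsSq d) {y : Ex K n}
    (hy : y ∈ extGrading K n d) : y = 0 := by
  have : extGrading K n d ≤ ⊥ := by
    refine Submodule.span_le.2 ?_
    rintro _ ⟨l, hl, rfl⟩
    rcases extListProd_eq K l with h | ⟨t, r, ht, h⟩
    · rw [h]; exact Submodule.zero_mem _
    · exact absurd (hl ▸ ht ▸ isSq_sqDeg t) hd
  exact (Submodule.mem_bot K).1 (this hy)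

theorem extMon_mem (s : Finset (Fin n)) : extMon K s ∈ extGrading K n (sqDeg s) := by
  have h : listDeg s.sort = sqDeg s := by
    funext j
    simp [listDeg, sqDeg, List.Nodup.count (Finset.sort_nodup s _)]
  have h' := extListProd_mem K n s.sort
  rw [h] at h'
  exact h'

/-- The contraction by the `j`-th coordinate kills products not involving `xⱼ`. -/
theorem contractLeft_extListProd (j : Fin n) (l : List (Fin n)) (h : j ∉ l) :
    CliffordAlgebra.contractLeft (Q := (0 : QuadraticForm K (Fin n → K)))
      (LinearMap.proj j) (extListProd K n l) = 0 := by
  induction l with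
  | nil =>
    exact CliffordAlgebra.contractLeft_one (Q := (0 : QuadraticForm K (Fin n → K)))
      (LinearMap.proj j)
  | cons k l ih =>
    rw [List.mem_cons, not_or] at h
    have hl : extListProd K n (k :: l) = CliffordAlgebra.ι (0 : QuadraticForm K (Fin n → K))
        (Pi.single k 1) * extListProd K n l := by
      simp [extListProd, extVar]
    rw [hl]
    refine (CliffordAlgebra.contractLeft_ι_mul _ _ _).trans ?_
    rw [ih h.2]
    simp [h.1]

/-- Contraction by the smallest coordinate `k` is an antiderivation that kills the remaining
factors, so it strips `x_k` from the monomial and allows induction. -/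
theorem extMon_ne_zero (s : Finset (Fin n)) : extMon K s ≠ 0 := by
  induction s using Finset.induction_on_min with
  | empty => simp [extMon, extListProd]
  | insert k s hk ih =>
    intro h0
    apply ih
    have hks : k ∉ s := fun h => lt_irrefl _ (hk k h)
    rw [extMon_insert K k s hk] at h0
    have h1 := CliffordAlgebra.contractLeft_ι_mul (Q := (0 : QuadraticForm K (Fin n → K)))
      (d := LinearMap.proj k) (Pi.single k 1) (extMon K s)
    have h2 : CliffordAlgebra.ι (0 : QuadraticForm K (Fin n → K)) (Pi.single k 1) * extMon K s
      = 0 := h0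
    have h3 := contractLeft_extListProd K k s.sort (by simpa using hks)
    rw [← extMon] at h3
    rw [h2, map_zero, h3, mul_zero, sub_zero, LinearMap.proj_apply, Pi.single_eq_same,
      one_smul] at h1
    exact h1.symm

theorem sqDeg_sub_sqDeg {a F : Finset (Fin n)} (h : a ⊆ F) :
    sqDeg F - sqDeg a = sqDeg (F \ a) := by
  funext j
  by_cases h1 : j ∈ a
  · simp [sqDeg, h1, h h1]
  · simp [sqDeg, h1]

theorem not_isSq_sqDeg_sub {a F : Finset (Fin n)} (h : ¬ a ⊆ F) :
    ∃ j, (sqDeg F - sqDeg a) j < 0 := by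
  obtain ⟨j, hj, hj'⟩ := Finset.not_subset.1 h
  exact ⟨j, by simp [sqDeg, hj, hj']⟩

/-- Homogeneous elements `F / a` of an algebra with the same multiplication rules as the
signed monomials of the exterior algebra. -/
structure SqMonomials {A : Type*} [Ring A] [Algebra K A] (𝒜 : (Fin n → ℤ) → Submodule K A)
    (x : Fin n → A) (sg : Fin n → (Fin n → ℤ) → K) where
  μ : Finset (Fin n) → Finset (Fin n) → A
  mem : ∀ F a, μ F a ∈ 𝒜 (sqDeg F - sqDeg a)
  span : ∀ F a, ∀ y ∈ 𝒜 (sqDeg F - sqDeg a), ∃ r : K, y = r • μ F a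
  zero : ∀ F a, ¬ a ⊆ F → μ F a = 0
  ne : ∀ F a, a ⊆ F → μ F a ≠ 0
  mul : ∀ F b a, a ⊆ b → b ⊆ F → μ F b * μ b a = μ F a
  op : ∀ k F a, k ∉ F → a ⊆ F → sg k (sqDeg F) • (x k * μ F a) =
    (-1 : K) ^ (F.filter (· < k)).card • μ (insert k F) a

theorem extQuot_mem {F a : Finset (Fin n)} (h : a ⊆ F) :
    extQuot K F a ∈ extGrading K n (sqDeg F - sqDeg a) := by
  rw [sqDeg_sub_sqDeg h]
  exact Submodule.smul_mem _ _ (extMon_mem K _)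

theorem exists_smul_extQuot {F a : Finset (Fin n)} (h : a ⊆ F) {y : Ex K n}
    (hy : y ∈ extGrading K n (sqDeg F - sqDeg a)) : ∃ r : K, y = r • extQuot K F a := by
  rw [sqDeg_sub_sqDeg h] at hy
  obtain ⟨r, rfl⟩ := eq_smul_extMon_of_mem K hy
  refine ⟨r * (-1) ^ (∑ p ∈ F \ a, (a.filter (· < p)).card), ?_⟩
  rw [extQuot, smul_smul, mul_assoc, ← mul_pow]
  simp

/-- Homogeneous elements of degree `F - a` are detected by right multiplication with the monomial
`a`. Identities among signed quotients thus follow without computing any sign exponent of a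
quotient. -/
theorem eq_smul_extQuot {F a : Finset (Fin n)} (h : a ⊆ F) {y : Ex K n}
    (hy : y ∈ extGrading K n (sqDeg F - sqDeg a)) {r : K}
    (hr : y * extMon K a = r • extMon K F) : y = r • extQuot K F a := by
  obtain ⟨r', rfl⟩ := exists_smul_extQuot K h hy
  rw [smul_mul_assoc, extQuot_mul_extMon K F a h] at hr
  rw [smul_left_injective K (extMon_ne_zero K F) hr]

/-- The signed monomials of the exterior algebra. -/
def extSqMonomials : SqMonomials K (extGrading K n) (extVar K n) (fun _ _ => 1) where
  μ F a := if a ⊆ F then extQuot K F a else 0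
  mem F a := by
    split_ifs with h
    · exact extQuot_mem K h
    · exact Submodule.zero_mem _
  span F a y hy := by
    by_cases h : a ⊆ F
    · simp only [if_pos h]
      exact exists_smul_extQuot K h hy
    · obtain ⟨j, hj⟩ := not_isSq_sqDeg_sub h
      have h0 := extGrading_eq_zero_of_not_isSq K (fun hs => absurd (hs j).1 (by omega)) hy
      exact ⟨0, by rw [zero_smul, h0]⟩
  zero F a h := if_neg h
  ne F a h h0 := by
    rw [if_pos h] at h0
    apply extMon_ne_zero K F
    rw [← extQuot_mul_extMon K F a h, h0, zero_mul]
  mul F b a hab hbF := by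
    rw [if_pos hab, if_pos hbF, if_pos (hab.trans hbF)]
    refine (eq_smul_extQuot K (hab.trans hbF) (r := 1) ?_ ?_).trans (one_smul _ _)
    · have := SetLike.mul_mem_graded (extQuot_mem K hbF) (extQuot_mem K hab)
      rwa [sub_add_sub_cancel] at this
    · rw [mul_assoc, extQuot_mul_extMon K b a hab, extQuot_mul_extMon K F b hbF, one_smul]
  op k F a hk ha := by
    have ha' := ha.trans (Finset.subset_insert k F)
    rw [if_pos ha, if_pos ha', one_smul]
    refine eq_smul_extQuot K ha' ?_ ?_
    · have := SetLike.mul_mem_graded (extVar_mem K n k) (extQuot_mem K ha)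
      rwa [sqDeg_insert hk, add_sub_right_comm, add_comm]
    · rw [mul_assoc, extQuot_mul_extMon K F a ha, extVar_mul_extMon K k F hk]

theorem symMon_mem (s : Finset (Fin n)) : symMon K s ∈ symGrading K n (sqDeg s) := by
  induction s using Finset.induction_on with
  | empty =>
    have : sqDeg (∅ : Finset (Fin n)) = 0 := by funext j; simp [sqDeg]
    rw [this, symMon, Finset.prod_empty]
    exact SetLike.GradedOne.one_mem
  | insert j s hj ih =>
    rw [symMon, Finset.prod_insert hj, sqDeg_insert hj, add_comm]
    exact SetLike.mul_mem_graded (X_mem_symGrading j) ih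

theorem symMon_ne_zero (s : Finset (Fin n)) : symMon K s ≠ 0 :=
  Finset.prod_ne_zero_iff.2 fun j _ => MvPolynomial.X_ne_zero j

theorem exists_smul_of_mem_symGrading {d : Fin n → ℤ} {z y : Sy K n} (hz : z ≠ 0)
    (hzd : z ∈ symGrading K n d) (hy : y ∈ symGrading K n d) : ∃ r : K, y = r • z := by
  rcases eq_monomial_of_mem_symGrading hzd with h | ⟨m, r, hm, rfl⟩
  · exact absurd h hz
  rcases eq_monomial_of_mem_symGrading hy with h | ⟨m', r', hm', rfl⟩
  · exact ⟨0, by rw [h, zero_smul]⟩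
  · obtain rfl : m' = m := DFunLike.coe_injective (natDeg_injective (hm'.trans hm.symm))
    have hr : r ≠ 0 := by
      rintro rfl
      simp at hz
    exact ⟨r' * r⁻¹, by rw [MvPolynomial.smul_monomial, smul_eq_mul, inv_mul_cancel_right₀ hr]⟩

theorem koszulSign_sqDeg (k : Fin n) (F : Finset (Fin n)) :
    koszulSign K k (sqDeg F) = (-1) ^ (F.filter (· < k)).card := by
  have : ∑ p ∈ Finset.univ.filter (· < k), sqDeg F p = ((F.filter (· < k)).card : ℤ) := by
    simp only [sqDeg]
    rw [Finset.sum_ite_mem, Finset.sum_const, nsmul_eq_mul, mul_one]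
    congr 2
    ext; simp [and_comm]
  rw [koszulSign, this, zpow_natCast]

/-- The square-free monomials of the polynomial ring. -/
def symSqMonomials :
    SqMonomials K (symGrading K n) (MvPolynomial.X : Fin n → Sy K n) (koszulSign K) where
  μ F a := if a ⊆ F then symMon K (F \ a) else 0
  mem F a := by
    split_ifs with h
    · rw [sqDeg_sub_sqDeg h]; exact symMon_mem K _
    · exact Submodule.zero_mem _
  span F a y hy := by
    by_cases h : a ⊆ F
    · rw [sqDeg_sub_sqDeg h] at hy
      simp only [if_pos h]
      exact exists_smul_of_mem_symGrading K (symMon_ne_zero K _) (symMon_mem K _) hy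
    · obtain ⟨j, hj⟩ := not_isSq_sqDeg_sub h
      exact ⟨0, by rw [zero_smul]; exact symGrading_eq_zero_of_neg hj hy⟩
  zero F a h := if_neg h
  ne F a h := by rw [if_pos h]; exact symMon_ne_zero K _
  mul F b a hab hbF := by
    rw [if_pos hab, if_pos hbF, if_pos (hab.trans hbF), symMon, symMon, symMon,
      ← Finset.prod_union (Finset.disjoint_left.2 fun j h h' =>
        (Finset.mem_sdiff.1 h).2 (Finset.mem_sdiff.1 h').1)]
    congr 1
    ext j
    have h1 := @hab j
    have h2 := @hbF j
    simp only [Finset.mem_union, Finset.mem_sdiff]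
    tauto
  op k F a hk ha := by
    rw [if_pos ha, if_pos (ha.trans (Finset.subset_insert k F)), koszulSign_sqDeg]
    congr 1
    rw [symMon, symMon, Finset.insert_sdiff_of_notMem _ (fun h => hk (ha h)),
      Finset.prod_insert]
    simp [hk]

end Ext

/-! ### The square-free part of a presented module -/

section Model

variable {K : Type u} [Field K] {n : ℕ}

/-- A description of the square-free part of a module by the scalar matrix of a presentation. -/
structure SqModel (P : SquareFreeMatrix K n) {M : Type*} [AddCommGroup M] [Module K M]
    (𝓜 : (Fin n → ℤ) → Submodule K M) (ξ : Fin n → (Fin n → ℤ) → M →ₗ[K] M) where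
  t : Finset (Fin n) → (Fin P.p → K) →ₗ[K] M
  mem : ∀ F α, t F α ∈ 𝓜 (sqDeg F)
  surj : ∀ F, ∀ v ∈ 𝓜 (sqDeg F), ∃ α, t F α = v
  -- The condition involves only the scalars of `P`, not the algebra. Coordinates with `row i ⊄ F`
  -- are unconstrained, since such a generator does not contribute in degree `F`.
  ker : ∀ F α, t F α = 0 ↔ ∃ γ : Fin P.q → K, ∀ i, P.row i ⊆ F →
    α i = ∑ j, if P.col j ⊆ F then P.coeff i j * γ j else 0
  op : ∀ k F α, k ∉ F → ξ k (sqDeg F) (t F α) =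
    (-1 : K) ^ (F.filter (· < k)).card • t (insert k F) (fun i => if P.row i ⊆ F then α i else 0)

/-- A linear section of `f` over its range is extended to all of `M`; composed with `g`, it is well
behaved on the range because `ker f ≤ ker g`. -/
theorem exists_factor {V M N : Type*} [AddCommGroup V] [Module K V] [AddCommGroup M] [Module K M]
    [AddCommGroup N] [Module K N] (f : V →ₗ[K] M) (g : V →ₗ[K] N)
    (h : ∀ v, f v = 0 → g v = 0) : ∃ φ : M →ₗ[K] N, ∀ v, φ (f v) = g v := by
  obtain ⟨s, hs⟩ := f.rangeRestrict.exists_rightInverse_of_surjective f.range_rangeRestrict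
  obtain ⟨s', hs'⟩ := LinearMap.exists_extend s
  refine ⟨g ∘ₗ s', fun v => sub_eq_zero.1 ?_⟩
  rw [LinearMap.comp_apply, ← map_sub]
  apply h
  have h1 : s' (f v) = s (f.rangeRestrict v) := LinearMap.congr_fun hs' (f.rangeRestrict v)
  have h2 : f (s (f.rangeRestrict v)) = f v :=
    congrArg Subtype.val (LinearMap.congr_fun hs (f.rangeRestrict v))
  rw [map_sub, h1, h2, sub_self]

namespace SqModel

variable {P : SquareFreeMatrix K n} {M : Type*} [AddCommGroup M] [Module K M]
  {𝓜 : (Fin n → ℤ) → Submodule K M} {ξ : Fin n → (Fin n → ℤ) → M →ₗ[K] M}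
  {N : Type*} [AddCommGroup N] [Module K N]
  {𝓝 : (Fin n → ℤ) → Submodule K N} {η : Fin n → (Fin n → ℤ) → N →ₗ[K] N}

/-- Transport between the square-free parts described by the same matrix. -/
def trans (m : SqModel P 𝓜 ξ) (m' : SqModel P 𝓝 η) (d : Fin n → ℤ) : M →ₗ[K] N :=
  (exists_factor (m.t (degSupp d)) (m'.t (degSupp d))
    fun α h => (m'.ker _ α).2 ((m.ker _ α).1 h)).choose

theorem trans_t (m : SqModel P 𝓜 ξ) (m' : SqModel P 𝓝 η) (F : Finset (Fin n))
    (α : Fin P.p → K) : m.trans m' (sqDeg F) (m.t F α) = m'.t F α := by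
  have : m.trans m' (sqDeg F) (m.t (degSupp (sqDeg F)) α) = m'.t (degSupp (sqDeg F)) α :=
    (exists_factor (m.t (degSupp (sqDeg F))) (m'.t (degSupp (sqDeg F)))
      fun α h => (m'.ker _ α).2 ((m.ker _ α).1 h)).choose_spec α
  rwa [degSupp_sqDeg] at this

/-- Two modules whose square-free parts are described by the same matrix. -/
def sqIso (m : SqModel P 𝓜 ξ) (m' : SqModel P 𝓝 η)
    (hM : ∀ j d, ∀ v ∈ 𝓜 d, ξ j d v ∈ 𝓜 (d + Pi.single j 1))
    (hN : ∀ j d, ∀ v ∈ 𝓝 d, η j d v ∈ 𝓝 (d + Pi.single j 1))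
    (h0 : ∀ d j, d j < 0 → ∀ v ∈ 𝓜 d, v = 0)
    (h0' : ∀ d, ¬ IsSq d → ∀ v ∈ 𝓝 d, v = 0) : SqIso 𝓜 ξ 𝓝 η where
  φ := m.trans m'
  ψ := m'.trans m
  φ_mem d hd v hv := by
    rw [hd.eq_sqDeg] at hv ⊢
    obtain ⟨α, rfl⟩ := m.surj _ v hv
    rw [trans_t]
    exact m'.mem _ _
  ψ_mem d hd v hv := by
    rw [hd.eq_sqDeg] at hv ⊢
    obtain ⟨α, rfl⟩ := m'.surj _ v hv
    rw [trans_t]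
    exact m.mem _ _
  ψ_φ d hd v hv := by
    rw [hd.eq_sqDeg] at hv ⊢
    obtain ⟨α, rfl⟩ := m.surj _ v hv
    rw [trans_t, trans_t]
  φ_ψ d hd v hv := by
    rw [hd.eq_sqDeg] at hv ⊢
    obtain ⟨α, rfl⟩ := m'.surj _ v hv
    rw [trans_t, trans_t]
  comm j d hd hd' v hv := by
    have hj : j ∉ degSupp d := by
      have h1 := hd j
      have h2 := (hd' j).2
      simp only [Pi.add_apply, Pi.single_eq_same] at h2
      simp only [degSupp, Finset.mem_filter, Finset.mem_univ, true_and]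
      omega
    rw [hd.eq_sqDeg] at hv ⊢
    obtain ⟨α, rfl⟩ := m.surj _ v hv
    rw [trans_t, m.op j _ α hj, m'.op j _ α hj, map_smul, ← sqDeg_insert hj, trans_t]
  map_mem := hM
  map_mem' := hN
  eq_zero_of_neg := h0
  eq_zero_of_not := h0'

variable {A : Type u} [Ring A] [Algebra K A] {𝒜 : (Fin n → ℤ) → Submodule K A}
  {x : Fin n → A} {sg : Fin n → (Fin n → ℤ) → K} [Module A M] [IsScalarTower K A M]

/-- The columns of a matrix read over an algebra with square-free monomials. -/
def colOf (P : SquareFreeMatrix K n) (m : SqMonomials K 𝒜 x sg) (j : Fin P.q) : Fin P.p → A :=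
  fun i => P.coeff i j • m.μ (P.col j) (P.row i)

/-- By the rule `(F / b)(b / a) = F / a`, a homogeneous combination of columns becomes a scalar
matrix product times the monomial `F / row i`, over either algebra. -/
theorem sum_smul_colOf (P : SquareFreeMatrix K n) (m : SqMonomials K 𝒜 x sg)
    (F : Finset (Fin n)) (γ : Fin P.q → K) (i : Fin P.p) :
    (∑ j, (γ j • m.μ F (P.col j)) • colOf P m j) i =
      (∑ j, if P.col j ⊆ F then P.coeff i j * γ j else 0) • m.μ F (P.row i) := by
  rw [Finset.sum_apply, Finset.sum_smul]
  refine Finset.sum_congr rfl fun j _ => ?_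
  rw [Pi.smul_apply, colOf, smul_eq_mul, smul_mul_smul_comm]
  by_cases hc : P.coeff i j = 0
  · simp [hc]
  · by_cases h : P.col j ⊆ F
    · rw [if_pos h, m.mul _ _ _ (P.subset i j hc) h, mul_comm]
    · rw [if_neg h, m.zero _ _ h, zero_mul, smul_zero, zero_smul]

theorem map_pi_mem [SetLike.GradedSMul 𝒜 𝓜] {p : ℕ} {deg : Fin p → Fin n → ℤ}
    (π : (Fin p → A) →ₗ[A] M) (hπ : ∀ i, π (Pi.single i 1) ∈ 𝓜 (deg i)) {d : Fin n → ℤ}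
    {f : Fin p → A} (hf : ∀ i, f i ∈ 𝒜 (d - deg i)) : π f ∈ 𝓜 d := by
  rw [LinearMap.pi_apply_eq_sum_univ]
  refine Submodule.sum_mem _ fun i _ => ?_
  have h1 : (fun j => if i = j then (1 : A) else 0) = Pi.single i 1 := by
    funext j; simp [Pi.single_apply, eq_comm]
  rw [h1]
  have := SetLike.GradedSMul.smul_mem (hf i) (hπ i)
  rwa [vadd_eq_add, sub_add_cancel] at this

/-- The description of the square-free part of a module given by a presentation. -/
def ofPresentation [SetLike.GradedSMul 𝒜 𝓜] (m : SqMonomials K 𝒜 x sg)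
    (π : (Fin P.p → A) →ₗ[A] M) (hπ : ∀ i, π (Pi.single i 1) ∈ 𝓜 (sqDeg (P.row i)))
    (hsurj : ∀ F, ∀ v ∈ 𝓜 (sqDeg F), ∃ f : Fin P.p → A,
      (∀ i, f i ∈ 𝒜 (sqDeg F - sqDeg (P.row i))) ∧ π f = v)
    (hcol : ∀ j, π (colOf P m j) = 0)
    (hker : ∀ F, ∀ f : Fin P.p → A, (∀ i, f i ∈ 𝒜 (sqDeg F - sqDeg (P.row i))) → π f = 0 →
      ∃ y : Fin P.q → A, (∀ j, y j ∈ 𝒜 (sqDeg F - sqDeg (P.col j))) ∧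
        f = ∑ j, y j • colOf P m j) :
    SqModel P 𝓜 (opAct x sg M) where
  t F := (π.restrictScalars K) ∘ₗ LinearMap.pi fun i =>
    LinearMap.toSpanSingleton K A (m.μ F (P.row i)) ∘ₗ LinearMap.proj i
  mem F α := map_pi_mem π hπ fun i => Submodule.smul_mem _ _ (m.mem _ _)
  surj F v hv := by
    obtain ⟨f, hf, rfl⟩ := hsurj F v hv
    choose α hα using fun i => m.span F _ _ (hf i)
    refine ⟨α, congrArg π (funext fun i => ?_)⟩
    exact (hα i).symm
  ker F α := by
    change π (fun i => α i • m.μ F (P.row i)) = 0 ↔ _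
    constructor
    · intro h
      obtain ⟨y, hy, hf⟩ := hker F _ (fun i => Submodule.smul_mem _ _ (m.mem _ _)) h
      choose γ hγ using fun j => m.span F _ _ (hy j)
      refine ⟨γ, fun i hi => ?_⟩
      have h1 := congrFun hf i
      rw [Finset.sum_congr rfl fun j _ => by rw [hγ j], sum_smul_colOf] at h1
      exact smul_left_injective K (m.ne _ _ hi) h1
    · rintro ⟨γ, hγ⟩
      have : (fun i => α i • m.μ F (P.row i)) =
          ∑ j, (γ j • m.μ F (P.col j)) • colOf P m j := by
        funext i
        rw [sum_smul_colOf]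
        by_cases hi : P.row i ⊆ F
        · rw [hγ i hi]
        · rw [m.zero _ _ hi, smul_zero, smul_zero]
      rw [this, map_sum]
      refine Finset.sum_eq_zero fun j _ => ?_
      rw [map_smul, hcol, smul_zero]
  op k F α hk := by
    change sg k (sqDeg F) • x k • π (fun i => α i • m.μ F (P.row i)) =
      _ • π (fun i => (if P.row i ⊆ F then α i else 0) • m.μ (insert k F) (P.row i))
    -- All scalars are moved inside `π`, which leaves an identity of monomials. The coordinates with
    -- `row i ⊄ F` are reset to zero on the right because `row i` may divide `insert k F`.
    rw [← map_smul, ← LinearMap.map_smul_of_tower, ← LinearMap.map_smul_of_tower]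
    congr 1
    funext i
    simp only [Pi.smul_apply, smul_eq_mul]
    by_cases hi : P.row i ⊆ F
    · rw [if_pos hi, mul_smul_comm, smul_comm, m.op k F _ hk hi, smul_comm]
    · rw [if_neg hi, m.zero _ _ hi]; simp

end SqModel

/-- The presentation of the free module on one generator of degree zero. -/
def unitMatrix (K : Type u) [Field K] (n : ℕ) : SquareFreeMatrix K n where
  p := 1
  q := 0
  row _ := ∅
  col := Fin.elim0
  coeff := fun _ j => j.elim0
  subset _ j := j.elim0

theorem sqDeg_empty : sqDeg (∅ : Finset (Fin n)) = 0 := by funext j; simp [sqDeg]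

/-- The square-free part of the algebra itself. -/
def SqMonomials.selfModel {A : Type u} [Ring A] [Algebra K A] {𝒜 : (Fin n → ℤ) → Submodule K A}
    {x : Fin n → A} {sg : Fin n → (Fin n → ℤ) → K} [SetLike.GradedMonoid 𝒜]
    (m : SqMonomials K 𝒜 x sg) :
    SqModel (unitMatrix K n) 𝒜 (opAct x sg A) :=
  SqModel.ofPresentation m (LinearMap.proj (0 : Fin 1))
    (fun i => by
      obtain rfl : i = (0 : Fin 1) := Subsingleton.elim (α := Fin 1) _ _
      change (Pi.single (0 : Fin 1) (1 : A) : Fin 1 → A) 0 ∈ 𝒜 (sqDeg ∅)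
      rw [Pi.single_eq_same, sqDeg_empty]
      exact SetLike.GradedOne.one_mem)
    (fun F v hv => ⟨fun _ => v, fun i => by
      change v ∈ 𝒜 (sqDeg F - sqDeg ∅)
      rwa [sqDeg_empty, sub_zero], rfl⟩)
    (fun j => j.elim0)
    (fun F f hf h => ⟨fun j => j.elim0, fun j => j.elim0, by
      funext i
      obtain rfl : i = (0 : Fin 1) := Subsingleton.elim (α := Fin 1) _ _
      have : ∑ j : Fin (unitMatrix K n).q, (j.elim0 : A) • SqModel.colOf (unitMatrix K n) m j = 0 :=
        Finset.sum_eq_zero fun j _ => j.elim0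
      rw [this]
      exact h⟩)

end Model

/-! ### The Cartan complex over the exterior algebra -/

section Cartan

variable {K : Type u} [Field K] {n : ℕ}

theorem subsingleton_strandHomology_iff {X : Type*} [AddCommGroup X] [Module K X]
    {B : Set (Fin n → ℕ)} {𝒳 : (Fin n → ℤ) → Submodule K X}
    {ξ : Fin n → (Fin n → ℤ) → X →ₗ[K] X} {a : Fin n → ℤ} {k : ℕ} :
    Subsingleton (strandHomology B 𝒳 ξ a k) ↔
      strandCycles B 𝒳 ξ a k ≤ strandBoundaries B 𝒳 ξ a k := by
  rw [Submodule.subsingleton_iff_eq_bot, strandHomology, ← LinearMap.le_ker_iff_map,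
    Submodule.ker_mkQ]

/-- A nonzero component needs `a - c` square-free, hence `c ≥ a - 1` coordinatewise, so `|c|` is at
least `∑ (a_j - 1)`. -/
theorem SqIso.eq_zero_of_mem_chains_of_lt {M : Type*} [AddCommGroup M] [Module K M]
    {N : Type*} [AddCommGroup N] [Module K N] {𝒳 : (Fin n → ℤ) → Submodule K M}
    {ξ : Fin n → (Fin n → ℤ) → M →ₗ[K] M} {𝒴 : (Fin n → ℤ) → Submodule K N}
    {η : Fin n → (Fin n → ℤ) → N →ₗ[K] N} (I : SqIso 𝒳 ξ 𝒴 η) (a : Fin n → ℕ) {k : ℕ}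
    (hk : k < ∑ j, (a j - 1)) {m : (Fin n → ℕ) → N}
    (hm : m ∈ chains Set.univ 𝒴 (natDeg a) k) : m = 0 := by
  funext c
  by_cases hc : a - 1 ≤ c
  · refine hm.2 c fun h => ?_
    have : ∑ j, (a j - 1) ≤ ∑ j, c j := Finset.sum_le_sum fun j _ => hc j
    omega
  · exact I.chains_eq_zero_of_not_le a hm hc

variable (K n) in
/-- The square-free parts of the polynomial ring and of the exterior algebra. -/
def unitIso : SqIso (symGrading K n) (opAct (MvPolynomial.X : Fin n → Sy K n) (koszulSign K) _)
    (extGrading K n) (opAct (extVar K n) (fun _ _ => 1) _) :=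
  (symSqMonomials K).selfModel.sqIso (extSqMonomials K).selfModel
    ((symKoszulData K n).isKoszul _).map_mem
    -- The degree condition over `E` is proved directly: `extKoszulData` contains the acyclicity
    -- that is itself deduced from this isomorphism.
    (fun j d v hv => by
      rw [opAct_apply, one_smul, add_comm]
      exact SetLike.mul_mem_graded (extVar_mem K n j) hv)
    (fun _ _ hd _ hv => symGrading_eq_zero_of_neg hd hv)
    (fun _ hd _ hv => extGrading_eq_zero_of_not_isSq K hd hv)

/-- `E` is the square-free counterpart of `S`, so its strand in degree `b` is a shifted Koszul
strand of `S` in degree `supp(b)`. For `b ≠ 0` that strand is exact everywhere; for `b = 0` there is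
no shift, and positive homological degree suffices. -/
theorem ext_acyclic : Acyclic Set.univ (extGrading K n)
    (opAct (extVar K n) (fun _ _ => 1) (Ex K n)) := by
  intro a k
  have hzero : ∀ m ∈ strandCycles Set.univ (extGrading K n)
      (opAct (extVar K n) (fun _ _ => 1) (Ex K n)) a (k + 1), m = 0 → m ∈ strandBoundaries
      Set.univ (extGrading K n) (opAct (extVar K n) (fun _ _ => 1) (Ex K n)) a (k + 1) :=
    fun m _ h => h ▸ Submodule.zero_mem _
  by_cases ha : ∃ j, a j < 0
  · obtain ⟨j, hj⟩ := ha
    intro m hm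
    refine hzero m hm (funext fun c => extGrading_eq_zero_of_not_isSq K (fun h => ?_) (hm.1.1 c))
    have := (h j).1
    simp only [natDeg, Pi.sub_apply] at this
    omega
  · push Not at ha
    obtain ⟨b, rfl⟩ : ∃ b : Fin n → ℕ, a = natDeg b :=
      ⟨fun j => (a j).toNat, funext fun j => (Int.toNat_of_nonneg (ha j)).symm⟩
    by_cases hk : k + 1 < ∑ j, (b j - 1)
    · intro m hm
      exact hzero m hm ((unitIso K n).eq_zero_of_mem_chains_of_lt b hk hm.1)
    · obtain ⟨l, hl⟩ : ∃ l, k + 1 = l + ∑ j, (b j - 1) := ⟨k + 1 - ∑ j, (b j - 1), by omega⟩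
      obtain ⟨e⟩ := (unitIso K n).nonempty_strandHomology_equiv b l
      rw [← hl] at e
      rw [← subsingleton_strandHomology_iff, ← e.toEquiv.subsingleton_congr,
        subsingleton_strandHomology_iff]
      by_cases hb : b = 0
      · subst hb
        have : l = k + 1 := by simpa using hl.symm
        subst this
        have := sym_acyclic (K := K) (n := n) 0 (sqDeg (SqIso.expSupp (0 : Fin n → ℕ))) k
        simpa only [add_zero] using this
      · obtain ⟨j, hj⟩ := Function.ne_iff.1 hb
        have := sym_strand_exact (K := K) (n := n) 0 (sqDeg (SqIso.expSupp b)) (j := j)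
          (by
            have : j ∈ SqIso.expSupp b := by simpa using hj
            simp only [sqDeg, if_pos this, le_refl]) l
        simpa only [add_zero] using this

theorem ext_exists_sum {d : Fin n → ℤ} (hd : d ≠ 0) {y : Ex K n} (hy : y ∈ extGrading K n d) :
    ∃ z : Fin n → Ex K n, y = ∑ j, extVar K n j * z j := by
  refine Submodule.span_induction ?_ ⟨0, by simp⟩ ?_ ?_ hy
  · rintro _ ⟨l, hl, rfl⟩
    cases l with
    | nil => exact absurd (hl.symm.trans (funext fun j => by simp [listDeg])) hd
    | cons j l =>
      refine ⟨Pi.single j (extListProd K n l), ?_⟩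
      rw [Finset.sum_eq_single j]
      · simp [extListProd]
      · intro i _ hi
        rw [Pi.single_eq_of_ne hi, mul_zero]
      · simp
  · rintro _ _ - - ⟨z, rfl⟩ ⟨z', rfl⟩
    exact ⟨z + z', by simp [mul_add, Finset.sum_add_distrib]⟩
  · rintro r _ - ⟨z, rfl⟩
    exact ⟨r • z, by simp [Finset.smul_sum]⟩

variable (K n) in
/-- The data of the Cartan complex over the exterior algebra. -/
def extKoszulData : KoszulData (extGrading K n) where
  B := Set.univ
  x := extVar K n
  sg _ _ := 1
  lower := isLowerSet_univ
  zero_mem := Set.mem_univ _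
  single_mem _ := Set.mem_univ _
  x_mem := extVar_mem K n
  sg_ne _ _ := one_ne_zero
  anti j k _ d := by
    rw [one_mul, one_smul, one_smul, extVar_anticomm K n j k, neg_add_cancel]
  sq j _ _ := extVar_sq K n j
  exists_sum _ hd _ hy := ext_exists_sum hd hy
  mul_x y j := by
    induction y using DirectSum.Decomposition.inductionOn (extGrading K n) with
    | zero => exact ⟨0, by simp⟩
    | @homogeneous d y =>
      by_cases hd : IsSq d
      · refine ext_exists_sum (d := d + Pi.single j 1) (fun h => ?_)
          (SetLike.mul_mem_graded y.2 (extVar_mem K n j))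
        have h1 := congrFun h j
        have h2 := (hd j).1
        simp only [Pi.add_apply, Pi.single_eq_same, Pi.zero_apply] at h1
        omega
      · exact ⟨0, by simp [extGrading_eq_zero_of_not_isSq K hd y.2]⟩
    | add y y' h h' =>
      obtain ⟨z, hz⟩ := h
      obtain ⟨z', hz'⟩ := h'
      exact ⟨z + z', by simp [mul_add, add_mul, Finset.sum_add_distrib, hz, hz']⟩
  acyclic _ := ext_acyclic

end Cartan

/-! ### Modules with a square-free presentation -/

section Presented

variable {K : Type u} [Field K] {A : Type u} [Ring A] [Algebra K A] {n : ℕ}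
  {𝒜 : (Fin n → ℤ) → Submodule K A} [GradedAlgebra 𝒜]
  {M : Type v} [AddCommGroup M] [Module K M] [Module A M] [IsScalarTower K A M]
  {𝓜 : (Fin n → ℤ) → Submodule K M} [DirectSum.Decomposition 𝓜] [SetLike.GradedSMul 𝒜 𝓜]

/-- A homogeneous surjection from a finite free module is surjective in each degree. -/
theorem exists_homogeneous_lift (D : KoszulData 𝒜) {p : ℕ} (deg : Fin p → Fin n → ℤ) (π : (Fin p → A) →ₗ[A] M)
    (hs : Function.Surjective π) (hπ : ∀ i, π (Pi.single i 1) ∈ 𝓜 (deg i)) {d : Fin n → ℤ}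
    {v : M} (hv : v ∈ 𝓜 d) : ∃ f : Fin p → A, (∀ i, f i ∈ 𝒜 (d - deg i)) ∧ π f = v := by
  classical
  obtain ⟨f, hf, hfv⟩ := (isSurj_of_surjective D deg (𝒴 := 𝓜)
    (π ∘ₗ (Finsupp.linearEquivFunOnFinite A A (Fin p)).toLinearMap)
    (fun i => by simpa using hπ i)
    (hs.comp (Finsupp.linearEquivFunOnFinite A A (Fin p)).surjective)).exists_lift d v hv
  exact ⟨f, hf, hfv⟩

/-- Homogeneous relations are homogeneous combinations of homogeneous generating relations. -/
theorem exists_homogeneous_relation (D : KoszulData 𝒜) {p : ℕ} (deg : Fin p → Fin n → ℤ) (π : (Fin p → A) →ₗ[A] M)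
    {X : Type w} (degX : X → Fin n → ℤ) (c : X → Fin p → A)
    (hc : ∀ x i, c x i ∈ 𝒜 (degX x - deg i))
    (hker : LinearMap.ker π = Submodule.span A (Set.range c)) {d : Fin n → ℤ}
    {f : Fin p → A} (hf : ∀ i, f i ∈ 𝒜 (d - deg i)) (h0 : π f = 0) :
    ∃ y ∈ freePart 𝒜 degX d, Finsupp.linearCombination A c y = f := by
  classical
  let e := Finsupp.linearEquivFunOnFinite A A (Fin p)
  let ψ : (X →₀ A) →ₗ[A] (Fin p →₀ A) := e.symm.toLinearMap ∘ₗ Finsupp.linearCombination A c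
  have hex : Function.Exact ψ (π ∘ₗ e.toLinearMap) := by
    intro g
    have h1 : g ∈ Set.range ψ ↔ e g ∈ LinearMap.range (Finsupp.linearCombination A c) := by
      constructor
      · rintro ⟨y, rfl⟩
        exact ⟨y, (e.apply_symm_apply _).symm⟩
      · rintro ⟨y, hy⟩
        exact ⟨y, by simp [ψ, hy]⟩
    rw [h1, Finsupp.range_linearCombination, ← hker]
    rfl
  -- The hypothesis on the kernel says that the free module on the generating relations is exact
  -- over `π`; degreewise surjectivity onto the kernel then gives homogeneous coefficients.
  obtain ⟨y, hy, hyf⟩ := (isSurj_kerPart D degX (𝒴 := freePart 𝒜 deg) ψ (fun x i => by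
    simpa [ψ, e] using hc x i) _ hex).exists_lift d (e.symm f) ⟨hf, by simpa using h0⟩
  refine ⟨y, hy, e.symm.injective hyf⟩

end Presented

/-! ### Finite dimensionality of graded components and of strand homology. -/

section Finiteness

variable {K : Type u} [Field K] {n : ℕ}

/-- Only finitely many exponents satisfy `|c| = k`, so a strand involves finitely many
finite-dimensional components in each homological degree. -/
theorem finite_strandHomology {X : Type*} [AddCommGroup X] [Module K X]
    {B : Set (Fin n → ℕ)} {𝒳 : (Fin n → ℤ) → Submodule K X}
    {ξ : Fin n → (Fin n → ℤ) → X →ₗ[K] X} (hfin : ∀ d, Module.Finite K (𝒳 d))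
    (a : Fin n → ℤ) (k : ℕ) : Module.Finite K (strandHomology B 𝒳 ξ a k) := by
  classical
  have h1 : Module.Finite K (chains B 𝒳 a k) := by
    let f : chains B 𝒳 a k →ₗ[K]
        ((c : Finset.piAntidiag (Finset.univ : Finset (Fin n)) k) → 𝒳 (a - natDeg c.1)) :=
      LinearMap.pi fun c => ((LinearMap.proj c.1).comp (chains B 𝒳 a k).subtype).codRestrict _
        fun m => m.2.1 c.1
    refine Module.Finite.of_injective f ((injective_iff_map_eq_zero f).2 fun m hm => ?_)
    ext c
    by_cases hc : ∑ j, c j = k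
    · exact congrArg Subtype.val (congrFun hm ⟨c, by simp [Finset.mem_piAntidiag, hc]⟩)
    · exact m.2.2 c fun h => hc h.2
  have h2 : strandCycles B 𝒳 ξ a k ≤ chains B 𝒳 a k := fun m hm => (mem_strandCycles.1 hm).1
  have h3 : Module.Finite K (strandCycles B 𝒳 ξ a k) :=
    Submodule.finiteDimensional_of_le h2
  exact Module.Finite.map _ _

/-- Graded components of a finitely generated module are finite-dimensional if those of the
algebra are at most one-dimensional. -/
theorem finite_component {A : Type u} [Ring A] [Algebra K A]
    {𝒜 : (Fin n → ℤ) → Submodule K A} [GradedAlgebra 𝒜] (D : KoszulData 𝒜)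
    (h𝒜 : ∀ d, ∃ z : A, ∀ y ∈ 𝒜 d, ∃ r : K, y = r • z)
    {M : Type v} [AddCommGroup M] [Module K M] [Module A M] [IsScalarTower K A M]
    {𝓜 : (Fin n → ℤ) → Submodule K M} [DirectSum.Decomposition 𝓜] [SetLike.GradedSMul 𝒜 𝓜]
    {p : ℕ} (deg : Fin p → Fin n → ℤ) (π : (Fin p → A) →ₗ[A] M)
    (hs : Function.Surjective π) (hπ : ∀ i, π (Pi.single i 1) ∈ 𝓜 (deg i)) (d : Fin n → ℤ) :
    Module.Finite K (𝓜 d) := by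
  choose z hz using h𝒜
  let g : (Fin p → K) →ₗ[K] M := (π.restrictScalars K) ∘ₗ LinearMap.pi fun i =>
    LinearMap.toSpanSingleton K A (z (d - deg i)) ∘ₗ LinearMap.proj i
  have : 𝓜 d ≤ LinearMap.range g := by
    intro v hv
    obtain ⟨f, hf, rfl⟩ := exists_homogeneous_lift D deg π hs hπ hv
    choose r hr using fun i => hz _ _ (hf i)
    refine ⟨r, congrArg π (funext fun i => ?_)⟩
    exact (hr i).symm
  exact Submodule.finiteDimensional_of_le this

variable (K) in
theorem symGrading_le_span (d : Fin n → ℤ) :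
    ∃ z : Sy K n, ∀ y ∈ symGrading K n d, ∃ r : K, y = r • z := by
  by_cases h : ∃ z ∈ symGrading K n d, z ≠ 0
  · obtain ⟨z, hz, hz0⟩ := h
    exact ⟨z, fun y hy => exists_smul_of_mem_symGrading K hz0 hz hy⟩
  · push Not at h
    exact ⟨0, fun y hy => ⟨0, by rw [h y hy, smul_zero]⟩⟩

variable (K) in
theorem extGrading_le_span (d : Fin n → ℤ) :
    ∃ z : Ex K n, ∀ y ∈ extGrading K n d, ∃ r : K, y = r • z := by
  by_cases h : IsSq d
  · refine ⟨extMon K (degSupp d), fun y hy => eq_smul_extMon_of_mem K ?_⟩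
    rwa [← h.eq_sqDeg]
  · exact ⟨0, fun y hy => ⟨0, by
      rw [extGrading_eq_zero_of_not_isSq K h hy, smul_zero]⟩⟩

end Finiteness

/-! ### Modules presented by a square-free matrix, and their Betti numbers. -/

namespace SquareFreeMatrix

variable {K : Type u} [Field K] {n : ℕ} {P : SquareFreeMatrix K n}

theorem symCol_eq (P : SquareFreeMatrix K n) : P.symCol = SqModel.colOf P (symSqMonomials K) := by
  funext j i
  simp only [symCol, SqModel.colOf, symSqMonomials]
  by_cases h : P.coeff i j = 0
  · simp [h]
  · rw [if_pos (P.subset i j h)]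

theorem extCol_eq (P : SquareFreeMatrix K n) : P.extCol = SqModel.colOf P (extSqMonomials K) := by
  funext j i
  simp only [extCol, SqModel.colOf, extSqMonomials]
  by_cases h : P.coeff i j = 0
  · simp [h]
  · rw [if_pos (P.subset i j h)]

theorem colOf_mem {A : Type u} [Ring A] [Algebra K A] {𝒜 : (Fin n → ℤ) → Submodule K A}
    {x : Fin n → A} {sg : Fin n → (Fin n → ℤ) → K} (P : SquareFreeMatrix K n)
    (m : SqMonomials K 𝒜 x sg) (j : Fin P.q) (i : Fin P.p) :
    SqModel.colOf P m j i ∈ 𝒜 (sqDeg (P.col j) - sqDeg (P.row i)) :=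
  Submodule.smul_mem _ _ (m.mem _ _)

section PolynomialRing

variable {M : Type v} [AddCommGroup M] [Module K M] [Module (Sy K n) M]
  [IsScalarTower K (Sy K n) M] {𝓜 : (Fin n → ℤ) → Submodule K M} [DirectSum.Decomposition 𝓜]
  [SetLike.GradedSMul (symGrading K n) 𝓜]

theorem PresentsSym.finite (h : P.PresentsSym 𝓜) (d : Fin n → ℤ) : Module.Finite K (𝓜 d) := by
  obtain ⟨π, hs, hπ, -⟩ := h
  exact finite_component (symKoszulData K n) (symGrading_le_span K) _ π hs hπ d

theorem PresentsSym.eq_zero_of_neg (h : P.PresentsSym 𝓜) (d : Fin n → ℤ) (j : Fin n)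
    (hd : d j < 0) (v : M) (hv : v ∈ 𝓜 d) : v = 0 := by
  obtain ⟨π, hs, hπ, -⟩ := h
  obtain ⟨f, hf, rfl⟩ := exists_homogeneous_lift (symKoszulData K n) _ π hs hπ hv
  have : f = 0 := funext fun i => symGrading_eq_zero_of_neg (j := j) (by
    have := (isSq_sqDeg (P.row i) j).1
    simp only [Pi.sub_apply]
    omega) (hf i)
  rw [this, map_zero]

theorem PresentsSym.exists_relation {π : (Fin P.p → Sy K n) →ₗ[Sy K n] M}
    (hker : LinearMap.ker π = Submodule.span (Sy K n) (Set.range P.symCol)) {d : Fin n → ℤ}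
    {f : Fin P.p → Sy K n} (hf : ∀ i, f i ∈ symGrading K n (d - sqDeg (P.row i)))
    (h0 : π f = 0) : ∃ y : Fin P.q → Sy K n,
      (∀ j, y j ∈ symGrading K n (d - sqDeg (P.col j))) ∧ f = ∑ j, y j • P.symCol j := by
  obtain ⟨y, hy, hyf⟩ := exists_homogeneous_relation (symKoszulData K n) _ π
    (fun j => sqDeg (P.col j)) P.symCol
    (fun j i => by rw [symCol_eq]; exact P.colOf_mem _ j i) hker hf h0
  refine ⟨y, hy, ?_⟩
  rw [← hyf, Finsupp.linearCombination_apply, Finsupp.sum_fintype _ _ (by simp)]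

theorem PresentsSym.nonempty_model (h : P.PresentsSym 𝓜) :
    Nonempty (SqModel P 𝓜 (opAct (MvPolynomial.X : Fin n → Sy K n) (koszulSign K) M)) := by
  obtain ⟨π, hs, hπ, hker⟩ := h
  refine ⟨SqModel.ofPresentation (symSqMonomials K) π hπ
    (fun F v hv => exists_homogeneous_lift (symKoszulData K n) _ π hs hπ hv) (fun j => ?_)
    (fun F f hf h0 => ?_)⟩
  · rw [← symCol_eq, ← LinearMap.mem_ker, hker]
    exact Submodule.subset_span ⟨j, rfl⟩
  · rw [← symCol_eq]
    exact PresentsSym.exists_relation hker hf h0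

/-- Strands of the Koszul complex of a square-free module in degrees that are not square-free
are exact. -/
theorem PresentsSym.strand_exact (h : P.PresentsSym 𝓜) (a : Fin n → ℤ) (j : Fin n)
    (ha : 2 ≤ a j) (k : ℕ) : strandCycles (sqExp n) 𝓜 ((symKoszulData K n).op M) a k ≤
      strandBoundaries (sqExp n) 𝓜 ((symKoszulData K n).op M) a k := by
  obtain ⟨π, hs, hπ, hker⟩ := h
  -- Generators and relations have degree at most one in direction `j`, whereas `d j ≥ 1`. All
  -- coefficients in degree `d + e_j` are therefore divisible by `x_j`, for generators and relations
  -- alike.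
  have hdiv : ∀ (d : Fin n → ℤ) (s : Finset (Fin n)), d j = a j - 1 →
      ∀ v ∈ symGrading K n (d + Pi.single j 1 - sqDeg s),
      ∃ u ∈ symGrading K n (d - sqDeg s), MvPolynomial.X j * u = v := by
    intro d s hd v hv
    refine exists_X_mul_of_mem_symGrading ?_ (by rwa [sub_add_eq_add_sub])
    have := (isSq_sqDeg s j).2
    simp only [Pi.sub_apply]
    omega
  refine strand_exact_of_bijective ((symKoszulData K n).isKoszul 𝓜) a j ?_ ?_ k
  · intro d hd u hu h0
    obtain ⟨f, hf, rfl⟩ := exists_homogeneous_lift (symKoszulData K n) _ π hs hπ hu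
    replace h0 : koszulSign K j d • (MvPolynomial.X j : Sy K n) • π f = 0 := h0
    rw [smul_eq_zero_iff_right (koszulSign_ne_zero _ _), ← map_smul] at h0
    have hXf : ∀ i, ((MvPolynomial.X j : Sy K n) • f) i ∈
        symGrading K n (d + Pi.single j 1 - sqDeg (P.row i)) := by
      intro i
      have := SetLike.mul_mem_graded (X_mem_symGrading (K := K) j) (hf i)
      rwa [← add_sub_assoc, add_comm _ d] at this
    obtain ⟨y, hy, hyf⟩ := PresentsSym.exists_relation hker hXf h0
    choose y' _ hy'' using fun i => hdiv d (P.col i) hd _ (hy i)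
    have : (MvPolynomial.X j : Sy K n) • f =
        (MvPolynomial.X j : Sy K n) • ∑ i, y' i • P.symCol i := by
      rw [hyf, Finset.smul_sum]
      refine Finset.sum_congr rfl fun i _ => ?_
      rw [smul_smul, hy'']
    -- The factor `x_j` is cancelled in the free module, which leaves `f` as a combination of
    -- relations.
    rw [smul_right_injective _ (MvPolynomial.X_ne_zero j) this, ← LinearMap.mem_ker, hker]
    exact Submodule.sum_mem _ fun i _ => Submodule.smul_mem _ _ (Submodule.subset_span ⟨i, rfl⟩)
  · intro d hd v hv
    obtain ⟨f, hf, rfl⟩ := exists_homogeneous_lift (symKoszulData K n) _ π hs hπ hv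
    choose f' hf' hff' using fun i => hdiv d (P.row i) hd _ (hf i)
    refine ⟨((symKoszulData K n).sg j d)⁻¹ • π f',
      Submodule.smul_mem _ _ (SqModel.map_pi_mem π hπ hf'), ?_⟩
    rw [map_smul, opAct_apply, smul_smul, inv_mul_cancel₀ ((symKoszulData K n).sg_ne _ _),
      one_smul, ← map_smul]
    exact congrArg π (funext hff')

end PolynomialRing

section ExteriorAlgebra

variable {N : Type w} [AddCommGroup N] [Module K N] [Module (Ex K n) N]
  [IsScalarTower K (Ex K n) N] {𝓝 : (Fin n → ℤ) → Submodule K N} [DirectSum.Decomposition 𝓝]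
  [SetLike.GradedSMul (extGrading K n) 𝓝]

theorem PresentsExt.finite (h : P.PresentsExt 𝓝) (d : Fin n → ℤ) : Module.Finite K (𝓝 d) := by
  obtain ⟨π, hs, hπ, -⟩ := h
  exact finite_component (extKoszulData K n) (extGrading_le_span K) _ π hs hπ d

theorem PresentsExt.eq_zero_of_not (h : P.PresentsExt 𝓝) (d : Fin n → ℤ)
    (hd : ¬ IsSq d) (v : N) (hv : v ∈ 𝓝 d) : v = 0 := by
  obtain ⟨π, hs, hπ, hker⟩ := h
  obtain ⟨f, hf, rfl⟩ := exists_homogeneous_lift (extKoszulData K n) _ π hs hπ hv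
  rw [← LinearMap.mem_ker, hker]
  exact Submodule.subset_span (Or.inr ⟨d, fun h => hd (isSq_iff.2 h), hf⟩)

/-- Multiples of non-square-free elements vanish in square-free degrees. -/
theorem smul_nonSquareFree_eq_zero {d : Fin n → ℤ} (hd : ¬ IsSq d) {v : Fin P.p → Ex K n}
    (hv : ∀ i, v i ∈ extGrading K n (d - sqDeg (P.row i))) {F : Finset (Fin n)} {y : Ex K n}
    (hy : y ∈ extGrading K n (sqDeg F - d)) : y • v = 0 := by
  by_contra hne
  obtain ⟨i, hi⟩ := Function.ne_iff.1 hne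
  have h1 : IsSq (sqDeg F - d) := by
    by_contra h
    exact hne (by rw [extGrading_eq_zero_of_not_isSq K h hy, zero_smul])
  have h2 : IsSq (d - sqDeg (P.row i)) := by
    by_contra h
    exact hi (by rw [Pi.smul_apply, extGrading_eq_zero_of_not_isSq K h (hv i), smul_zero]; rfl)
  -- If both factors are nonzero, then `row i ≤ d ≤ F` coordinatewise, which squeezes `d` into
  -- square-free degrees.
  refine hd fun j => ?_
  have h3 := h1 j
  have h4 := h2 j
  have h5 := isSq_sqDeg F j
  have h6 := isSq_sqDeg (P.row i) j
  simp only [Pi.sub_apply] at h3 h4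
  omega

theorem PresentsExt.nonempty_model (h : P.PresentsExt 𝓝) :
    Nonempty (SqModel P 𝓝 (opAct (extVar K n) (fun _ _ => 1) N)) := by
  classical
  obtain ⟨π, hs, hπ, hker⟩ := h
  refine ⟨SqModel.ofPresentation (extSqMonomials K) π hπ
    (fun F v hv => exists_homogeneous_lift (extKoszulData K n) _ π hs hπ hv) (fun j => ?_)
    (fun F f hf h0 => ?_)⟩
  · rw [← extCol_eq, ← LinearMap.mem_ker, hker]
    exact Submodule.subset_span (Or.inl ⟨j, rfl⟩)
  · rw [← extCol_eq]
    choose degv hdegv hmem using fun v : P.nonSquareFree => v.2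
    -- Columns and non-square-free elements are treated as one homogeneous family of relations. In a
    -- square-free degree the second kind contributes nothing, so the columns alone remain, as over
    -- `S`.
    let c : Fin P.q ⊕ P.nonSquareFree → Fin P.p → Ex K n := Sum.elim P.extCol Subtype.val
    have hrange : Set.range P.extCol ∪ P.nonSquareFree = Set.range c := by
      rw [Set.Sum.elim_range, Subtype.range_coe]
    rw [hrange] at hker
    obtain ⟨y, hy, hyf⟩ := exists_homogeneous_relation (extKoszulData K n) _ π
      (Sum.elim (fun j => sqDeg (P.col j)) degv) c
      (by
        rintro (j | v) i
        · change P.extCol j i ∈ _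
          rw [extCol_eq]
          exact P.colOf_mem _ j i
        · exact hmem v i) hker hf h0
    refine ⟨fun j => y (Sum.inl j), fun j => hy (Sum.inl j), ?_⟩
    rw [← hyf, Finsupp.linearCombination_apply, Finsupp.sum,
      Finset.sum_sum_eq_sum_toLeft_add_sum_toRight]
    rw [Finset.sum_eq_zero (s := y.support.toRight) fun v _ => ?_, add_zero]
    · refine Finset.sum_subset (Finset.subset_univ _) fun j _ hj => ?_
      have : y (Sum.inl j) = 0 := by simpa using hj
      rw [this, zero_smul]
    · exact smul_nonSquareFree_eq_zero (fun h => hdegv v (isSq_iff.1 h)) (hmem v) (hy (Sum.inr v))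

end ExteriorAlgebra

section Betti

variable {M : Type v} [AddCommGroup M] [Module K M] [Module (Sy K n) M]
  [IsScalarTower K (Sy K n) M] {𝓜 : (Fin n → ℤ) → Submodule K M} [DirectSum.Decomposition 𝓜]
  [SetLike.GradedSMul (symGrading K n) 𝓜]
  {N : Type w} [AddCommGroup N] [Module K N] [Module (Ex K n) N]
  [IsScalarTower K (Ex K n) N] {𝓝 : (Fin n → ℤ) → Submodule K N} [DirectSum.Decomposition 𝓝]
  [SetLike.GradedSMul (extGrading K n) 𝓝]

theorem PresentsSym.finite_tor (h : P.PresentsSym 𝓜) (i : ℕ) (a : Fin n → ℤ) :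
    Module.Finite K (Tor (symGrading K n) 𝓜 i a) := by
  obtain ⟨e⟩ := (standardResolution (symGrading K n) 𝓜).nonempty_homology_equiv
    (symKoszulData K n) i a
  have := finite_strandHomology (B := (symKoszulData K n).B) (ξ := (symKoszulData K n).op M) h.finite a i
  exact Module.Finite.equiv e.symm

theorem PresentsExt.finite_tor (h : P.PresentsExt 𝓝) (i : ℕ) (a : Fin n → ℤ) :
    Module.Finite K (Tor (extGrading K n) 𝓝 i a) := by
  obtain ⟨e⟩ := (standardResolution (extGrading K n) 𝓝).nonempty_homology_equiv
    (extKoszulData K n) i a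
  have := finite_strandHomology (B := (extKoszulData K n).B) (ξ := (extKoszulData K n).op N) h.finite a i
  exact Module.Finite.equiv e.symm

theorem PresentsSym.betti_eq_zero (h : P.PresentsSym 𝓜) (i : ℕ) (a : Fin n → ℤ) (j : Fin n)
    (ha : 2 ≤ a j) : betti (symGrading K n) 𝓜 i a = 0 := by
  obtain ⟨e⟩ := (standardResolution (symGrading K n) 𝓜).nonempty_homology_equiv
    (symKoszulData K n) i a
  have : Subsingleton (strandHomology (symKoszulData K n).B 𝓜 ((symKoszulData K n).op M) a i) :=
    subsingleton_strandHomology_iff.2 (h.strand_exact a j ha i)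
  exact e.finrank_eq.trans (Module.finrank_zero_of_subsingleton)

theorem nonempty_sqIso (hM : P.PresentsSym 𝓜) (hN : P.PresentsExt 𝓝) :
    Nonempty (SqIso 𝓜 ((symKoszulData K n).op M) 𝓝 ((extKoszulData K n).op N)) := by
  obtain ⟨m⟩ := hM.nonempty_model
  obtain ⟨m'⟩ := hN.nonempty_model
  exact ⟨m.sqIso m' ((symKoszulData K n).isKoszul _).map_mem
    ((extKoszulData K n).isKoszul _).map_mem hM.eq_zero_of_neg hN.eq_zero_of_not⟩

/-- The coefficientwise form of the final identity: both `Tor` spaces are strand homologies, and the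
strands agree after the shift by `∑ (a_j - 1)`. -/
theorem betti_ext_add (hM : P.PresentsSym 𝓜) (hN : P.PresentsExt 𝓝) (a : Fin n → ℕ) (k : ℕ) :
    betti (extGrading K n) 𝓝 (k + ∑ j, (a j - 1)) (natDeg a) =
      betti (symGrading K n) 𝓜 k (sqDeg (SqIso.expSupp a)) := by
  obtain ⟨I⟩ := nonempty_sqIso hM hN
  obtain ⟨e⟩ := (standardResolution (extGrading K n) 𝓝).nonempty_homology_equiv
    (extKoszulData K n) (k + ∑ j, (a j - 1)) (natDeg a)
  obtain ⟨e'⟩ := (standardResolution (symGrading K n) 𝓜).nonempty_homology_equiv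
    (symKoszulData K n) k (sqDeg (SqIso.expSupp a))
  obtain ⟨e''⟩ := I.nonempty_strandHomology_equiv a k
  exact (e'.trans (e''.trans e.symm)).finrank_eq.symm

theorem betti_ext_eq_zero (hM : P.PresentsSym 𝓜) (hN : P.PresentsExt 𝓝) (a : Fin n → ℕ) {i : ℕ}
    (hi : i < ∑ j, (a j - 1)) : betti (extGrading K n) 𝓝 i (natDeg a) = 0 := by
  obtain ⟨I⟩ := nonempty_sqIso hM hN
  obtain ⟨e⟩ := (standardResolution (extGrading K n) 𝓝).nonempty_homology_equiv
    (extKoszulData K n) i (natDeg a)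
  have : Subsingleton (strandHomology (extKoszulData K n).B 𝓝
      ((extKoszulData K n).op N) (natDeg a) i) := by
    refine subsingleton_strandHomology_iff.2 fun m hm => ?_
    rw [I.eq_zero_of_mem_chains_of_lt a hi (mem_strandCycles.1 hm).1]
    exact Submodule.zero_mem _
  exact e.finrank_eq.trans (Module.finrank_zero_of_subsingleton)

end Betti

end SquareFreeMatrix

/-! ### Coefficients of the series `tⁱ uᵃ / ∏ (1 - t uⱼ)` -/

section SeriesCoeff

variable {n : ℕ}

open Classical in
/-- The power series `∏_{j ∈ F} ∑ₖ (t uⱼ)ᵏ`. -/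
def geomSeries (F : Finset (Fin n)) : MvPowerSeries (Option (Fin n)) ℚ := fun m =>
  if (∀ j, m (some j) ≠ 0 → j ∈ F) ∧ m none = ∑ j, m (some j) then 1 else 0

open Classical in
theorem coeff_geomSeries (F : Finset (Fin n)) (m : Option (Fin n) →₀ ℕ) :
    MvPowerSeries.coeff m (geomSeries F) =
      if (∀ j, m (some j) ≠ 0 → j ∈ F) ∧ m none = ∑ j, m (some j) then 1 else 0 := rfl

theorem tVar_mul_uVar (j : Fin n) : tVar n * uVar j =
    MvPowerSeries.monomial (Finsupp.single none 1 + Finsupp.single (some j) 1) 1 := by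
  rw [tVar, uVar, MvPowerSeries.X, MvPowerSeries.X, MvPowerSeries.monomial_mul_monomial, mul_one]

/-- Telescoping of the geometric series in `t u_j`. If `t u_j` divides the monomial `m`, the
coefficients at `m` and `m / (t u_j)` cancel; otherwise nothing is subtracted, and `j` imposes no
further restriction. -/
theorem geomSeries_insert_mul {F : Finset (Fin n)} {j : Fin n} (hj : j ∉ F) :
    geomSeries (insert j F) * (1 - tVar n * uVar j) = geomSeries F := by
  classical
  ext m
  rw [mul_sub, mul_one, map_sub, tVar_mul_uVar, MvPowerSeries.coeff_mul_monomial, mul_one]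
  simp only [coeff_geomSeries]
  set e : Option (Fin n) →₀ ℕ := Finsupp.single none 1 + Finsupp.single (some j) 1 with he
  have he0 : e none = 1 := by simp [he]
  have hej : e (some j) = 1 := by simp [he]
  have hek : ∀ k, k ≠ j → e (some k) = 0 := fun k hk => by simp [he, Ne.symm hk]
  have hsum : ∑ k, e (some k) = 1 := by
    rw [Finset.sum_eq_single j (fun k _ hk => hek k hk) (by simp), hej]
  by_cases hle : e ≤ m
  · rw [if_pos hle]
    have hmj : 1 ≤ m (some j) := hej ▸ hle (some j)
    have hm0 : 1 ≤ m none := he0 ▸ hle none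
    have h1 : ¬ ((∀ k, m (some k) ≠ 0 → k ∈ F) ∧ m none = ∑ k, m (some k)) :=
      fun h => hj (h.1 j (by omega))
    have h2 : ∑ k, (m - e) (some k) + 1 = ∑ k, m (some k) := by
      rw [← hsum, ← Finset.sum_add_distrib]
      refine Finset.sum_congr rfl fun k _ => ?_
      rw [Finsupp.tsub_apply, tsub_add_cancel_of_le (hle _)]
    have h3 : ((∀ k, (m - e) (some k) ≠ 0 → k ∈ insert j F) ∧
        (m - e) none = ∑ k, (m - e) (some k)) ↔
        ((∀ k, m (some k) ≠ 0 → k ∈ insert j F) ∧ m none = ∑ k, m (some k)) := by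
      refine and_congr (forall_congr' fun k => ?_) ?_
      · by_cases hk : k = j
        · simp [hk]
        · rw [Finsupp.tsub_apply, hek k hk, tsub_zero]
      · rw [← h2, Finsupp.tsub_apply, he0]
        omega
    rw [if_neg h1, if_congr h3 rfl rfl, sub_self]
  · rw [if_neg hle, sub_zero]
    refine if_congr ?_ rfl rfl
    by_cases hmj : m (some j) = 0
    · refine and_congr_left fun _ => forall_congr' fun k => ?_
      by_cases hk : k = j
      · simp [hk, hmj]
      · simp [hk]
    · have hm0 : m none = 0 := by
        by_contra hm0
        apply hle
        rintro (_ | k)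
        · rw [he0]; omega
        · by_cases hk : k = j
          · subst hk; rw [hej]; omega
          · rw [hek k hk]; exact Nat.zero_le _
      have hs : m none ≠ ∑ k, m (some k) := by
        rw [hm0]
        intro h
        exact hmj ((Finset.sum_eq_zero_iff.1 h.symm) j (Finset.mem_univ j))
      simp [hs]

theorem prod_inv_eq_geomSeries (F : Finset (Fin n)) :
    ∏ j ∈ F, (1 - tVar n * uVar j)⁻¹ = geomSeries F := by
  classical
  induction F using Finset.induction_on with
  | empty =>
    ext m
    rw [Finset.prod_empty, MvPowerSeries.coeff_one, coeff_geomSeries]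
    refine if_congr ⟨fun h => by simp [h], fun h => ?_⟩ rfl rfl
    have h1 : ∀ j, m (some j) = 0 := fun j => by
      by_contra hne
      exact absurd (h.1 j hne) (Finset.notMem_empty j)
    ext (_ | j)
    · rw [h.2]; simp [h1]
    · exact h1 j
  | insert j F hj ih =>
    rw [Finset.prod_insert hj, ih, mul_comm, eq_comm,
      MvPowerSeries.eq_mul_inv_iff_mul_eq, geomSeries_insert_mul hj]
    simp [tVar, uVar]

/-- The exponent of the monomial `tⁱ uᵃ`. -/
def bigradedExp (i : ℕ) (a : Fin n → ℕ) : Option (Fin n) →₀ ℕ :=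
  Finsupp.equivFunOnFinite.symm fun o => o.elim i a

theorem tVar_pow_mul_prod (i : ℕ) (a : Fin n → ℕ) :
    tVar n ^ i * ∏ j, uVar j ^ a j = MvPowerSeries.monomial (bigradedExp i a) 1 := by
  classical
  have h : ∀ s : Finset (Fin n), ∏ j ∈ s, uVar j ^ a j =
      MvPowerSeries.monomial (∑ j ∈ s, Finsupp.single (some j) (a j)) (1 : ℚ) := by
    intro s
    induction s using Finset.induction_on with
    | empty => simp [MvPowerSeries.monomial_zero_one]
    | insert j s hj ih =>
      rw [Finset.prod_insert hj, Finset.sum_insert hj, ih, uVar, MvPowerSeries.X_pow_eq,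
        MvPowerSeries.monomial_mul_monomial, one_mul]
  rw [h, tVar, MvPowerSeries.X_pow_eq, MvPowerSeries.monomial_mul_monomial, one_mul]
  congr 2
  ext (_ | j)
  · simp [bigradedExp]
  · simp [bigradedExp, Finsupp.single_apply]

-- For square-free `a`, the factor belonging to `j ∈ supp(a)` is `u_j (1 + t u_j + ⋯)`, so an
-- exponent `m_j ≥ 1` of `u_j` costs `m_j - 1` powers of `t`. Hence a monomial determines both `a`
-- and `i`.
open Classical in
theorem coeff_cartanTerm (i : ℕ) {a : Fin n → ℕ} (ha : ∀ j, a j ≤ 1)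
    (m : Option (Fin n) →₀ ℕ) : MvPowerSeries.coeff m (cartanTerm i a) =
      if (a = fun j => min (m (some j)) 1) ∧ m none = i + ∑ j, (m (some j) - 1) then 1 else 0 := by
  rw [cartanTerm, prod_inv_eq_geomSeries, tVar_pow_mul_prod, MvPowerSeries.coeff_monomial_mul,
    one_mul, coeff_geomSeries, ← ite_and]
  refine if_congr ?_ rfl rfl
  have e0 : (m - bigradedExp i a) none = m none - i := rfl
  have e1 : ∀ j, (m - bigradedExp i a) (some j) = m (some j) - a j := fun j => rfl
  have hle : bigradedExp i a ≤ m ↔ i ≤ m none ∧ ∀ j, a j ≤ m (some j) :=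
    ⟨fun h => ⟨h none, fun j => h (some j)⟩, fun h => by
      rintro (_ | j)
      · exact h.1
      · exact h.2 j⟩
  simp only [e0, e1, hle, Finset.mem_filter, Finset.mem_univ, true_and]
  have key : (∀ j, a j ≤ m (some j)) → (∀ j, m (some j) - a j ≠ 0 → a j ≠ 0) →
      ∀ j, a j = min (m (some j)) 1 := fun h1 h2 j => by
    have := h1 j
    have := h2 j
    have := ha j
    omega
  have hsub : (∀ j, a j = min (m (some j)) 1) →
      ∑ j, (m (some j) - a j) = ∑ j, (m (some j) - 1) := fun h =>
    Finset.sum_congr rfl fun j _ => by rw [h j]; omega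
  constructor
  · rintro ⟨⟨h1, h2⟩, h3, h4⟩
    have h5 := key h2 h3
    rw [hsub h5] at h4
    exact ⟨funext h5, by omega⟩
  · rintro ⟨h1, h2⟩
    have h5 := congrFun h1
    rw [hsub h5]
    refine ⟨⟨by omega, fun j => by rw [h5 j]; omega⟩, fun j => ?_, by omega⟩
    rw [h5 j]
    omega

end SeriesCoeff

end SqFree

end

/-! ### Comparison of the two power series. -/

theorem corollary5p7 {K : Type u} [Field K] (n : ℕ)
    {M : Type v} [AddCommGroup M] [Module K M] [Module (SqFree.Sy K n) M]
    [IsScalarTower K (SqFree.Sy K n) M]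
    (𝓜 : (Fin n → ℤ) → Submodule K M) [DirectSum.Decomposition 𝓜]
    [SetLike.GradedSMul (SqFree.symGrading K n) 𝓜]
    {N : Type w} [AddCommGroup N] [Module K N] [Module (SqFree.Ex K n) N]
    [IsScalarTower K (SqFree.Ex K n) N]
    (𝓝 : (Fin n → ℤ) → Submodule K N) [DirectSum.Decomposition 𝓝]
    [SetLike.GradedSMul (SqFree.extGrading K n) 𝓝]
    (P : SqFree.SquareFreeMatrix K n) (hM : P.PresentsSym 𝓜) (hN : P.PresentsExt 𝓝) :
    (∀ i a, Module.Finite K (SqFree.Tor (SqFree.symGrading K n) 𝓜 i a)) ∧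
    (∀ i a, Module.Finite K (SqFree.Tor (SqFree.extGrading K n) 𝓝 i a)) ∧
    HasSum
      (fun ia : ℕ × (Fin n → ℕ) =>
        SqFree.betti (SqFree.symGrading K n) 𝓜 ia.1 (SqFree.natDeg ia.2) •
          SqFree.cartanTerm ia.1 ia.2)
      (SqFree.poincareSeries (SqFree.betti (SqFree.extGrading K n) 𝓝)) := by
  classical
  refine ⟨hM.finite_tor, hN.finite_tor, ?_⟩
  rw [MvPowerSeries.WithPiTopology.hasSum_iff_hasSum_coeff]
  intro m
  let b : Fin n → ℕ := fun j => m (some j)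
  have hcoeff : MvPowerSeries.coeff m
      (SqFree.poincareSeries (SqFree.betti (SqFree.extGrading K n) 𝓝)) =
      (SqFree.betti (SqFree.extGrading K n) 𝓝 (m none) (SqFree.natDeg b) : ℚ) := rfl
  -- At a fixed monomial at most one pair `(i, a)` contributes. Terms with non-square-free `a` drop
  -- out because their Betti number over `S` is zero.
  have hterm : ∀ ia : ℕ × (Fin n → ℕ),
      ¬ ((ia.2 = fun j => min (b j) 1) ∧ m none = ia.1 + ∑ j, (b j - 1)) →
      MvPowerSeries.coeff m (SqFree.betti (SqFree.symGrading K n) 𝓜 ia.1 (SqFree.natDeg ia.2) •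
        SqFree.cartanTerm ia.1 ia.2) = 0 := by
    intro ia hia
    by_cases ha : ∀ j, ia.2 j ≤ 1
    · rw [map_nsmul, SqFree.coeff_cartanTerm ia.1 ha, if_neg hia, smul_zero]
    · push Not at ha
      obtain ⟨j, hj⟩ := ha
      rw [hM.betti_eq_zero ia.1 (SqFree.natDeg ia.2) j (by
        simp only [SqFree.natDeg]; omega), zero_smul, map_zero]
  rw [hcoeff]
  -- Below this bound no `i ≥ 0` solves `m none = i + ∑ (b_j - 1)`, and the Betti number over `E` is
  -- zero too; otherwise the unique contributing index is `i = k`.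
  by_cases hk : m none < ∑ j, (b j - 1)
  · rw [SqFree.SquareFreeMatrix.betti_ext_eq_zero hM hN b hk, Nat.cast_zero]
    have : (fun ia : ℕ × (Fin n → ℕ) => MvPowerSeries.coeff m
        (SqFree.betti (SqFree.symGrading K n) 𝓜 ia.1 (SqFree.natDeg ia.2) •
        SqFree.cartanTerm ia.1 ia.2)) = fun _ => 0 :=
      funext fun ia => hterm ia fun h => by omega
    rw [this]
    exact hasSum_zero
  · obtain ⟨k, hk⟩ : ∃ k, m none = k + ∑ j, (b j - 1) := ⟨m none - ∑ j, (b j - 1), by omega⟩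
    have hsupp : SqFree.natDeg (fun j => min (b j) 1) = SqFree.sqDeg (SqFree.SqIso.expSupp b) := by
      funext j
      simp only [SqFree.natDeg, SqFree.sqDeg, Finset.mem_filter, Finset.mem_univ, true_and]
      split_ifs <;> omega
    have h1 := hasSum_single (f := fun ia : ℕ × (Fin n → ℕ) => MvPowerSeries.coeff m
      (SqFree.betti (SqFree.symGrading K n) 𝓜 ia.1 (SqFree.natDeg ia.2) •
        SqFree.cartanTerm ia.1 ia.2)) (k, fun j => min (b j) 1) (fun ia hia =>
        hterm ia fun h => hia (Prod.ext (by
          change ia.1 = k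
          omega) h.1))
    have h2 : MvPowerSeries.coeff m (SqFree.betti (SqFree.symGrading K n) 𝓜 k
        (SqFree.natDeg fun j => min (b j) 1) • SqFree.cartanTerm k fun j => min (b j) 1) =
        (SqFree.betti (SqFree.extGrading K n) 𝓝 (m none) (SqFree.natDeg b) : ℚ) := by
      rw [map_nsmul, SqFree.coeff_cartanTerm k (fun j => min_le_right _ _), if_pos ⟨rfl, hk⟩,
        nsmul_one, hsupp, hk, SqFree.SquareFreeMatrix.betti_ext_add hM hN]
    dsimp only at h1
    rwa [h2] at h1
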